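/- **Setting.** Let $\mu>0$, and let $F(\mathbf u)=f(|\mathbf u|)=\tfrac12 g(|\mathbf u|)^2$ where $g\ge 0$ is locally Lipschitz on $[0,\infty)$ with $g(0)=g(1)=0$ and $\int_0^1 g=1$; $f\in C^\infty([0,\infty))$, $f>0$ on $(0,\infty)\setminus\{1\}$; for some $s_0\in(0,1)$, $f'>0$ on $(0,s_0)$ and $f'<0$ on $(s_0,1)$; $f'(0)=f'(1)=0$ and $f''(0),f''(1)>0$. Let $\phi\in C^\infty(\mathbb R)$ be even, non-increasing on $[0,1]$, positive on $(-1,1)$, zero for $|z|\ge1$, with $1-4z^2\le\phi(z)\le 1-\tfrac12z^2$ for $|z|\le\tfrac12$. Let $I_0\subset\mathbb R^2$ be a smooth simple closed curve with inner unit normal $\mathbf n$. Let $d_{I_0}$ be the signed distance to $I_0$, positive in the region enclosed by $I_0$ and negative outside. Let $\delta_0\in(0,1)$ be such that the nearest point projection onto $I_0$ is well defined and smooth on $\{|d_{I_0}|<4\delta_0\}$. Put $\boldsymbol\xi=\phi(d_{I_0}/\delta_0)\nabla d_{I_0}$. For a bounded domain $\Omega\subset\mathbb R^2$ with $I_0\subset\Omega$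 and $\operatorname{dist}(I_0,\partial\Omega)\ge4\delta_0$ (neither smoothness of $\partial\Omega$ nor simple connectedness is required), put $\Omega_0^\pm=\{x\in\Omega: d_{I_0}(x)\gtrless0\}$ and $I_0(\delta)=\{x\in\Omega:|d_{I_0}(x)|<\delta\}$. For $\mathbf u\in H^1(\Omega;\mathbb R^2)$ with $|\mathbf u|\le1$ a.e. and $0<\varepsilon\le1$, let $$A_\varepsilon(\mathbf u)=\int_\Omega\Big(\tfrac\varepsilon2\mu|\operatorname{div}\mathbf u|^2+\tfrac\varepsilon2|\nabla\mathbf u|^2+\tfrac1\varepsilon F(\mathbf u)\Big)dx,\qquad \psi[\mathbf u](x)=\int_0^{|\mathbf u(x)|}g(s)\,ds,$$ $$E_\varepsilon[\mathbf u|I_0]=\int_\Omega\tfrac\varepsilon2\mu|\operatorname{div}\mathbf u|^2dx+\int_\Omega\Big(\tfrac\varepsilon2|\nabla\mathbf u|^2+\tfrac1\varepsilon F(\mathbf u)-\boldsymbol\xi\cdot\nabla\psi[\mathbf u]\Big)dx .$$ **Proposition.** With $\mu,f,g,\phi,I_0,\delta_0$ fixed, there is a heteroclinic profile $\theta:\mathbb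 R\to(0,1)$, that is, a $C^2$ solution of $-\theta''+f'(\theta)=0$ with $\theta(-\infty)=0$ and $\theta(+\infty)=1$, and for every $M$ there is a constant $c_1>0$ such that the following holds. For every $\Omega$ as above and every $\mathbf u^{in}\in H^1(\Omega;\mathbb S^1)$ with $\|\mathbf u^{in}\|_{H^1(\Omega)}\le M$ whose trace on $I_0$ satisfies $\mathbf u^{in}|_{I_0}\cdot\mathbf n=0$ a.e. on $I_0$, there exist functions $\mathbf u^{in}_\varepsilon\in H^1(\Omega)\cap L^\infty(\Omega)$, $0<\varepsilon\le1$, with $\psi[\mathbf u^{in}_\varepsilon]\in H^1(\Omega)$, such that for every $\varepsilon\in(0,1]$: 1. $\mathbf u^{in}_\varepsilon=\mathbf u^{in}$ in $\Omega_0^+\setminus I_0(\delta_0)$ and $\mathbf u^{in}_\varepsilon=0$ in $\Omega_0^-\setminus I_0(\delta_0)$; 2. $\mathbf u^{in}_\varepsilon=\theta(d_{I_0}/\varepsilon)\,\mathbf u^{in}$ in $I_0(\delta_0/2)$; 3. $A_\varepsilon(\mathbf u^{in}_\varepsilon)\le c_1$ and $\|\mathbf u^{in}_\varepsilon\|_{L^\infty(\Omega)}\le1$;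 4. $E_\varepsilon[\mathbf u^{in}_\varepsilon|I_0]+\displaystyle\int_{I_0(\delta_0)}\big|\psi[\mathbf u^{in}_\varepsilon]-\mathbf 1_{\Omega_0^+}\big|\,|d_{I_0}|\,dx\le c_1\varepsilon$. -/

import Mathlib

open MeasureTheory Set Filter Topology
open scoped ContDiff ENNReal RealInnerProductSpace

noncomputable section

namespace AnisoGL

/-- The Euclidean plane `ℝ²`. -/
abbrev Plane := EuclideanSpace ℝ (Fin 2)

/-! ### Sobolev functions on an open set of the plane -/

section Sobolev

variable {V : Type*} [NormedAddCommGroup V] [NormedSpace ℝ V]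

/-- `G` is a weak (distributional) derivative of `u` on the open set `Ω`:
`∫_Ω (∂_v φ) u = - ∫_Ω φ (G v)` for every test function `φ ∈ C_c^∞(Ω)` and every direction `v`. -/
def IsWeakGrad (Ω : Set Plane) (u : Plane → V) (G : Plane → Plane →L[ℝ] V) : Prop :=
  LocallyIntegrableOn u Ω ∧ LocallyIntegrableOn G Ω ∧
    ∀ φ : Plane → ℝ, ContDiff ℝ ∞ φ → HasCompactSupport φ → tsupport φ ⊆ Ω → ∀ v : Plane,
      ∫ x in Ω, fderiv ℝ φ x v • u x = -∫ x in Ω, φ x • G x v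

/-- `u ∈ H¹(Ω; V)`. -/
def MemH1 (Ω : Set Plane) (u : Plane → V) : Prop :=
  MemLp u 2 (volume.restrict Ω) ∧
    ∃ G : Plane → Plane →L[ℝ] V, IsWeakGrad Ω u G ∧ MemLp G 2 (volume.restrict Ω)

open Classical in
/-- The weak derivative of `u` on `Ω`, which is unique up to null sets of `Ω`
(and is set to `0` if `u` is not weakly differentiable). -/
def weakGrad (Ω : Set Plane) (u : Plane → V) : Plane → Plane →L[ℝ] V :=
  if h : ∃ G : Plane → Plane →L[ℝ] V, IsWeakGrad Ω u G then h.choose else 0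

end Sobolev

/-- The squared Frobenius norm `|A|² = ∑ᵢⱼ Aᵢⱼ²`. -/
def frobSq (A : Plane →L[ℝ] Plane) : ℝ :=
  ∑ i : Fin 2, ∑ j : Fin 2, (A (EuclideanSpace.single j 1) i) ^ 2

/-- The trace `∑ᵢ Aᵢᵢ`; for `A = ∇u` this is `div u`. -/
def divOf (A : Plane →L[ℝ] Plane) : ℝ :=
  ∑ i : Fin 2, A (EuclideanSpace.single i 1) i

/-- The norm of `H¹(Ω; ℝ²)`. -/
def h1Norm (Ω : Set Plane) (u : Plane → Plane) : ℝ :=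
  Real.sqrt ((∫ x in Ω, ‖u x‖ ^ 2) + ∫ x in Ω, frobSq (weakGrad Ω u x))

/-- `u ∈ H¹(Ω; 𝕊¹)`. -/
def MemH1Circle (Ω : Set Plane) (u : Plane → Plane) : Prop :=
  MemH1 Ω u ∧ ∀ᵐ x ∂(volume.restrict Ω), ‖u x‖ = 1

/-! ### The curve, its interior, its normal, its signed distance -/

/-- `γ` is a regular `1`-periodic smooth parametrization of a simple closed curve. -/
structure IsSmoothSimpleClosedCurve (γ : ℝ → Plane) : Prop where
  smooth : ContDiff ℝ ∞ γ
  periodic : Function.Periodic γ 1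
  regular : ∀ t, deriv γ t ≠ 0
  simple : InjOn γ (Ico 0 1)

/-- The region enclosed by `I`: the points of the complement of `I` whose connected component
in the complement of `I` is bounded. -/
def enclosed (I : Set Plane) : Set Plane :=
  {x | x ∉ I ∧ Bornology.IsBounded (connectedComponentIn Iᶜ x)}

/-- `n` is the inner unit normal vector along the closed curve `γ`. -/
structure IsInnerNormal (γ n : ℝ → Plane) : Prop where
  unit : ∀ t, ‖n t‖ = 1
  orthogonal : ∀ t, ⟪n t, deriv γ t⟫ = 0
  inward : ∀ t, ∀ᶠ r in 𝓝[>] (0 : ℝ), γ t + r • n t ∈ enclosed (range γ)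

open Classical in
/-- The signed distance `d_I` to `I`, positive in the enclosed region, negative outside. -/
def signedDistTo (I : Set Plane) (x : Plane) : ℝ :=
  if x ∈ enclosed I then Metric.infDist x I else -Metric.infDist x I

/-- `Ω⁺ = {x ∈ Ω : d_I(x) > 0}`. -/
def plusRegion (Ω I : Set Plane) : Set Plane := {x ∈ Ω | 0 < signedDistTo I x}

/-- `Ω⁻ = {x ∈ Ω : d_I(x) < 0}`. -/
def minusRegion (Ω I : Set Plane) : Set Plane := {x ∈ Ω | signedDistTo I x < 0}

/-- The open `δ`-neighbourhood `I(δ) = {x ∈ Ω : |d_I(x)| < δ}`. -/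
def tube (Ω I : Set Plane) (δ : ℝ) : Set Plane := {x ∈ Ω | |signedDistTo I x| < δ}

/-- The nearest point projection onto `I` is well defined and smooth on the open neighbourhood of
radius `r` of `I`. -/
def HasSmoothProjection (I : Set Plane) (r : ℝ) : Prop :=
  ∃ P : Plane → Plane, ContDiffOn ℝ ∞ P {x | Metric.infDist x I < r} ∧
    ∀ x, Metric.infDist x I < r →
      P x ∈ I ∧ dist x (P x) = Metric.infDist x I ∧
        ∀ y ∈ I, dist x y = Metric.infDist x I → y = P x

/-- `w` is the trace of `u ∈ H¹(Ω; ℝ²)` on the closed curve `γ` contained in `Ω`, written in the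
parameter of the curve: the restriction map from functions smooth in `Ω` to the curve,
extended by continuity from `H¹(Ω)` to `L²` of the curve, sends `u` to `w`.
(As `|γ'|` is bounded above and below, `L²` in the parameter and in arc length agree.) -/
def IsTraceOn (Ω : Set Plane) (γ : ℝ → Plane) (u : Plane → Plane) (w : ℝ → Plane) : Prop :=
  MemLp w 2 (volume.restrict (Ioc 0 1)) ∧
    ∃ v : ℕ → Plane → Plane,
      (∀ k, ContDiffOn ℝ ∞ (v k) Ω) ∧
      Tendsto (fun k => eLpNorm (fun x => v k x - u x) 2 (volume.restrict Ω)) atTop (𝓝 0) ∧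
      Tendsto (fun k => eLpNorm (fun x => fderiv ℝ (v k) x - weakGrad Ω u x) 2
        (volume.restrict Ω)) atTop (𝓝 0) ∧
      Tendsto (fun k => eLpNorm (fun t => v k (γ t) - w t) 2 (volume.restrict (Ioc 0 1)))
        atTop (𝓝 0)

/-! ### The potential, the cut-off profile, the heteroclinic profile -/

/-- Structural assumptions on the double equal-well potential `F(u) = f(|u|) = g(|u|)² / 2`,
including the normalization `∫₀¹ g = 1`. Only values on `[0, ∞)` matter, and derivatives at `0`
are one-sided. -/
structure IsPotential (f g : ℝ → ℝ) : Prop where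
  f_eq : ∀ s, 0 ≤ s → f s = g s ^ 2 / 2
  g_nonneg : ∀ s, 0 ≤ s → 0 ≤ g s
  g_lipschitz : LocallyLipschitzOn (Ici 0) g
  g_zero : g 0 = 0
  g_one : g 1 = 0
  f_smooth : ContDiffOn ℝ ∞ f (Ici 0)
  f_pos : ∀ s, 0 < s → s ≠ 1 → 0 < f s
  f_mono : ∃ s₀ ∈ Ioo (0 : ℝ) 1,
    (∀ s ∈ Ioo 0 s₀, 0 < derivWithin f (Ici 0) s) ∧
      ∀ s ∈ Ioo s₀ 1, derivWithin f (Ici 0) s < 0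
  f_deriv_zero : derivWithin f (Ici 0) 0 = 0
  f_deriv_one : derivWithin f (Ici 0) 1 = 0
  f_deriv2_zero : 0 < iteratedDerivWithin 2 f (Ici 0) 0
  f_deriv2_one : 0 < iteratedDerivWithin 2 f (Ici 0) 1
  normalization : ∫ s in (0 : ℝ)..1, g s = 1

/-- The even smooth profile used to cut off the extended normal field. -/
structure IsCutoffProfile (φ : ℝ → ℝ) : Prop where
  smooth : ContDiff ℝ ∞ φ
  even : ∀ z, φ (-z) = φ z
  antitone : AntitoneOn φ (Icc 0 1)
  pos : ∀ z, |z| < 1 → 0 < φ z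
  zero : ∀ z, 1 ≤ |z| → φ z = 0
  lower : ∀ z, |z| ≤ 1 / 2 → 1 - 4 * z ^ 2 ≤ φ z
  upper : ∀ z, |z| ≤ 1 / 2 → φ z ≤ 1 - z ^ 2 / 2

/-- `θ : ℝ → (0,1)` solves `-θ'' + f'(θ) = 0`, `θ(-∞) = 0`, `θ(+∞) = 1`. -/
structure IsHeteroclinic (f θ : ℝ → ℝ) : Prop where
  smooth : ContDiff ℝ 2 θ
  mem : ∀ z, θ z ∈ Ioo (0 : ℝ) 1
  ode : ∀ z, -deriv (deriv θ) z + derivWithin f (Ici 0) (θ z) = 0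
  atBot : Tendsto θ atBot (𝓝 0)
  atTop : Tendsto θ atTop (𝓝 1)

/-! ### The energies -/

/-- `A_ε(u) = ∫_Ω (ε/2) μ |div u|² + (ε/2) |∇u|² + (1/ε) F(u)`, with `F(u) = f(|u|)`. -/
def energy (Ω : Set Plane) (μ : ℝ) (f : ℝ → ℝ) (ε : ℝ) (u : Plane → Plane) : ℝ :=
  ∫ x in Ω, (ε / 2 * μ * divOf (weakGrad Ω u x) ^ 2 + ε / 2 * frobSq (weakGrad Ω u x)
    + 1 / ε * f ‖u x‖)

/-- `ψ(x) = ∫₀^{|u(x)|} g(s) ds`. -/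
def psi (g : ℝ → ℝ) (u : Plane → Plane) (x : Plane) : ℝ :=
  ∫ s in (0 : ℝ)..‖u x‖, g s

/-- The extended normal field `ξ = φ(d_I / δ₀) ∇d_I`. -/
def xi (I : Set Plane) (φ : ℝ → ℝ) (δ₀ : ℝ) (x : Plane) : Plane :=
  φ (signedDistTo I x / δ₀) • gradient (signedDistTo I) x

/-- The modulated energy
`E_ε[u | I] = ∫_Ω (ε/2) μ |div u|² + ∫_Ω ((ε/2) |∇u|² + (1/ε) F(u) - ξ · ∇ψ)`. -/
def modulatedEnergy (Ω I : Set Plane) (μ : ℝ) (f g φ : ℝ → ℝ) (δ₀ ε : ℝ)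
    (u : Plane → Plane) : ℝ :=
  (∫ x in Ω, ε / 2 * μ * divOf (weakGrad Ω u x) ^ 2) +
    ∫ x in Ω, (ε / 2 * frobSq (weakGrad Ω u x) + 1 / ε * f ‖u x‖
      - weakGrad Ω (psi g u) x (xi I φ δ₀ x))

/-- `∫_{I(δ₀)} |ψ - 1_{Ω⁺}| |d_I| dx`. -/
def bulkError (Ω I : Set Plane) (g : ℝ → ℝ) (δ₀ : ℝ) (u : Plane → Plane) : ℝ :=
  ∫ x in tube Ω I δ₀,
    |psi g u x - (plusRegion Ω I).indicator (fun _ => (1 : ℝ)) x| * |signedDistTo I x|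

end AnisoGL

end

open AnisoGL

/-!
The competitor is `p(d_I) u`, where `p` follows the transition `θ(r / ε)` near the curve and is
constant away from it. Since `θ` solves the first-order equation `θ' = g(θ)`, there is equipartition
of energy across the layer, and the energy density minus its calibration `ξ · ∇ψ` is
`(1 - φ(r / δ₀)) g(θ)² / ε ≲ r² g(θ)² / ε`. As `θ` tends exponentially to its limits, this is of
order `ε` pointwise. Differentiating `|u|² = 1` shows that `u` is orthogonal to the columns of `∇u`,
so `|∇(p u)|²` has no cross term and exceeds the one-dimensional energy by at most `|∇u|²`, whose
contribution carries a factor `ε`.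

The dangerous part of the divergence is `p'(d_I) u · ∇d_I`, of size `1 / ε` in a layer of width
`ε`. The vanishing of the trace of `u · n` gives the weighted estimate
`∫ e^{-c |d_I| / ε} / ε |u · ∇d_I|² ≲ ε (1 + ‖∇u‖²)` in the tubular coordinates
`(t, s) ↦ γ(t) + s ν(t)`, which are locally bi-Lipschitz, hence finite-to-one near the curve; this
is all that the change of variables needs.
-/

noncomputable section

open scoped NNReal

namespace AnisoGL

/-! ### The potential and the heteroclinic profile -/

section Potential

lemma eventually_sq_le_of_iteratedDerivWithin_two_pos {f : ℝ → ℝ} {S : Set ℝ} {a : ℝ}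
    (hS : Convex ℝ S) (ha : a ∈ S) (hf : ContDiffOn ℝ 2 f S) (hfa : f a = 0)
    (hf' : derivWithin f S a = 0) (hf'' : 0 < iteratedDerivWithin 2 f S a) :
    ∀ᶠ s in 𝓝[S] a, iteratedDerivWithin 2 f S a / 4 * (s - a) ^ 2 ≤ f s := by
  have htaylor : ∀ s, taylorWithinEval f 2 S a s = iteratedDerivWithin 2 f S a / 2 * (s - a) ^ 2 :=
    fun s => by
      simp only [taylorWithinEval_succ, taylor_within_zero_eval, zero_add,
        iteratedDerivWithin_one, hfa, hf', smul_eq_mul]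
      norm_num
      ring
  filter_upwards [(taylor_isLittleO hS ha (n := 2) (by exact_mod_cast hf)).bound
    (by positivity : 0 < iteratedDerivWithin 2 f S a / 4)] with s hs
  rw [htaylor, Real.norm_eq_abs, Real.norm_eq_abs, abs_of_nonneg (sq_nonneg (s - a))] at hs
  linarith [(abs_le.1 hs).1]

lemma exists_mul_le_of_isCompact {X : Type*} [TopologicalSpace X] {S : Set X} (hS : IsCompact S)
    {w q : X → ℝ} (hw : ∀ x ∈ S, 0 ≤ w x)
    (hloc : ∀ a ∈ S, ∃ c : ℝ, 0 < c ∧ ∀ᶠ x in 𝓝[S] a, c * w x ≤ q x) :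
    ∃ c : ℝ, 0 < c ∧ ∀ x ∈ S, c * w x ≤ q x := by
  have h := hS.induction_on (p := fun T => ∃ c : ℝ, 0 < c ∧ ∀ x ∈ T ∩ S, c * w x ≤ q x)
    ⟨1, one_pos, by simp⟩
    (fun T T' hTT' ⟨c, hc, h⟩ => ⟨c, hc, fun x hx => h x ⟨hTT' hx.1, hx.2⟩⟩)
    (fun T T' ⟨c, hc, h⟩ ⟨c', hc', h'⟩ => ⟨min c c', lt_min hc hc', fun x hx => hx.1.elim
      (fun hxT => (mul_le_mul_of_nonneg_right (min_le_left _ _) (hw x hx.2)).trans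
        (h x ⟨hxT, hx.2⟩))
      fun hxT => (mul_le_mul_of_nonneg_right (min_le_right _ _) (hw x hx.2)).trans
        (h' x ⟨hxT, hx.2⟩)⟩)
    fun a ha => by
      obtain ⟨c, hc, h⟩ := hloc a ha
      exact ⟨_, h, c, hc, fun x hx => hx.1⟩
  simpa only [inter_self] using h

lemma exists_eventually_mul_le_of_pos {X : Type*} [TopologicalSpace X] {S : Set X} {w q : X → ℝ}
    {a : X} (hw : ContinuousWithinAt w S a) (hq : ContinuousWithinAt q S a) (hwa : 0 ≤ w a)
    (hqa : 0 < q a) : ∃ c : ℝ, 0 < c ∧ ∀ᶠ x in 𝓝[S] a, c * w x ≤ q x := by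
  refine ⟨q a / (w a + 1), by positivity, ?_⟩
  have hlt : q a / (w a + 1) * w a < q a := by
    rw [div_mul_eq_mul_div, div_lt_iff₀ (by positivity)]
    linarith
  exact ((hw.const_mul _).eventually_lt hq hlt).mono fun _ => le_of_lt

namespace IsPotential

variable {f g : ℝ → ℝ}

lemma g_continuousOn (h : IsPotential f g) : ContinuousOn g (Ici 0) :=
  h.g_lipschitz.continuousOn

lemma g_pos (h : IsPotential f g) {s : ℝ} (hs : s ∈ Ioo (0 : ℝ) 1) : 0 < g s := by
  refine (h.g_nonneg s hs.1.le).lt_of_ne fun h0 => ?_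
  have hf := h.f_pos s hs.1 hs.2.ne
  rw [h.f_eq s hs.1.le, ← h0] at hf
  norm_num at hf

lemma exists_eventually_mul_abs_sub_le (h : IsPotential f g) {a : ℝ} (ha : 0 ≤ a) (hga : g a = 0)
    (hf' : derivWithin f (Ici 0) a = 0) (hf'' : 0 < iteratedDerivWithin 2 f (Ici 0) a) :
    ∃ c : ℝ, 0 < c ∧ ∀ᶠ s in 𝓝[Ici 0] a, c * |s - a| ≤ g s := by
  refine ⟨√(iteratedDerivWithin 2 f (Ici 0) a / 2), by positivity, ?_⟩
  filter_upwards [eventually_sq_le_of_iteratedDerivWithin_two_pos (convex_Ici 0) ha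
    (h.f_smooth.of_le (by norm_cast)) (by simp [h.f_eq a ha, hga]) hf' hf'',
    self_mem_nhdsWithin] with s hs hs0
  rw [h.f_eq s hs0] at hs
  refine abs_le_of_sq_le_sq' ?_ (h.g_nonneg s hs0) |>.2
  rw [mul_pow, Real.sq_sqrt (by positivity), sq_abs]
  linarith

lemma exists_eventually_le_mul_abs_sub (h : IsPotential f g) {a : ℝ} (ha : 0 ≤ a) (hga : g a = 0) :
    ∃ C : ℝ, 0 < C ∧ ∀ᶠ s in 𝓝[Ici 0] a, g s ≤ C * |s - a| := by
  obtain ⟨K, t, ht, hK⟩ := h.g_lipschitz (mem_Ici.2 ha)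
  refine ⟨K + 1, by positivity, ?_⟩
  filter_upwards [ht] with s hs
  have hdist := hK.dist_le_mul s hs a (mem_of_mem_nhdsWithin (mem_Ici.2 ha) ht)
  rw [hga, Real.dist_eq, Real.dist_eq, sub_zero] at hdist
  linarith [le_abs_self (g s), abs_nonneg (s - a)]

lemma exists_mul_le_g (h : IsPotential f g) :
    ∃ c : ℝ, 0 < c ∧ ∀ s ∈ Icc (0 : ℝ) 1, c * (s * (1 - s)) ≤ g s := by
  have hwell : ∀ a ∈ Icc (0 : ℝ) 1, (∀ s ∈ Icc (0 : ℝ) 1, s * (1 - s) ≤ |s - a|) →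
      (∃ c : ℝ, 0 < c ∧ ∀ᶠ s in 𝓝[Ici 0] a, c * |s - a| ≤ g s) →
      ∃ c : ℝ, 0 < c ∧ ∀ᶠ s in 𝓝[Icc 0 1] a, c * (s * (1 - s)) ≤ g s := by
    rintro a - hle ⟨c, hc, hev⟩
    refine ⟨c, hc, ?_⟩
    filter_upwards [nhdsWithin_mono a Icc_subset_Ici_self hev, self_mem_nhdsWithin] with s hs hs01
    exact (mul_le_mul_of_nonneg_left (hle s hs01) hc.le).trans hs
  refine exists_mul_le_of_isCompact isCompact_Icc
    (fun s hs => mul_nonneg hs.1 (sub_nonneg.2 hs.2)) fun a ha => ?_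
  rcases eq_endpoints_or_mem_Ioo_of_mem_Icc ha with rfl | rfl | ha'
  · refine hwell 0 ha (fun s hs => ?_)
      (h.exists_eventually_mul_abs_sub_le le_rfl h.g_zero h.f_deriv_zero h.f_deriv2_zero)
    rw [sub_zero, abs_of_nonneg hs.1]
    nlinarith [hs.1]
  · refine hwell 1 ha (fun s hs => ?_)
      (h.exists_eventually_mul_abs_sub_le zero_le_one h.g_one h.f_deriv_one h.f_deriv2_one)
    rw [abs_sub_comm, abs_of_nonneg (sub_nonneg.2 hs.2)]
    nlinarith [hs.2]
  · exact exists_eventually_mul_le_of_pos (by fun_prop)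
      ((h.g_continuousOn a ha.1).mono Icc_subset_Ici_self)
      (mul_nonneg ha.1 (sub_nonneg.2 ha.2)) (h.g_pos ha')

lemma exists_g_le_mul (h : IsPotential f g) :
    ∃ C : ℝ, 0 < C ∧ ∀ s ∈ Icc (0 : ℝ) 1, g s ≤ C * (s * (1 - s)) := by
  have hwell : ∀ a : ℝ, (∀ᶠ s in 𝓝[Icc 0 1] a, |s - a| ≤ 2 * (s * (1 - s))) →
      (∃ C : ℝ, 0 < C ∧ ∀ᶠ s in 𝓝[Ici 0] a, g s ≤ C * |s - a|) →
      ∃ c : ℝ, 0 < c ∧ ∀ᶠ s in 𝓝[Icc 0 1] a, c * g s ≤ s * (1 - s) := by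
    rintro a hle ⟨C, hC, hev⟩
    refine ⟨(2 * C)⁻¹, by positivity, ?_⟩
    filter_upwards [nhdsWithin_mono a Icc_subset_Ici_self hev, hle] with s hs hs'
    rw [inv_mul_le_iff₀ (by positivity)]
    nlinarith
  suffices hcomp : ∃ c : ℝ, 0 < c ∧ ∀ s ∈ Icc (0 : ℝ) 1, c * g s ≤ s * (1 - s) by
    obtain ⟨c, hc, hle⟩ := hcomp
    exact ⟨c⁻¹, inv_pos.2 hc, fun s hs => (le_inv_mul_iff₀ hc).2 (hle s hs)⟩
  refine exists_mul_le_of_isCompact isCompact_Icc (fun s hs => h.g_nonneg s hs.1) fun a ha => ?_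
  rcases eq_endpoints_or_mem_Ioo_of_mem_Icc ha with rfl | rfl | ha'
  · refine hwell 0 ?_ (h.exists_eventually_le_mul_abs_sub le_rfl h.g_zero)
    filter_upwards [self_mem_nhdsWithin,
      mem_nhdsWithin_of_mem_nhds (Iio_mem_nhds (show (0 : ℝ) < 1 / 2 by norm_num))] with s hs hs'
    rw [sub_zero, abs_of_nonneg hs.1]
    nlinarith [hs.1, mem_Iio.1 hs']
  · refine hwell 1 ?_ (h.exists_eventually_le_mul_abs_sub zero_le_one h.g_one)
    filter_upwards [self_mem_nhdsWithin,
      mem_nhdsWithin_of_mem_nhds (Ioi_mem_nhds (show (1 / 2 : ℝ) < 1 by norm_num))] with s hs hs'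
    rw [abs_sub_comm, abs_of_nonneg (sub_nonneg.2 hs.2)]
    nlinarith [hs.2, mem_Ioi.1 hs']
  · exact exists_eventually_mul_le_of_pos ((h.g_continuousOn a ha.1).mono Icc_subset_Ici_self)
      (by fun_prop) (h.g_nonneg a ha.1) (mul_pos ha'.1 (sub_pos.2 ha'.2))

end IsPotential

end Potential

section Heteroclinic

lemma exists_hasDerivAt_of_continuous_of_bounds {k : ℝ → ℝ} (hk : Continuous k) {c C : ℝ}
    (hc : 0 < c) (hck : ∀ x, c ≤ k x) (hkC : ∀ x, k x ≤ C) :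
    ∃ l : ℝ → ℝ, l 0 = 0 ∧ ∀ z, HasDerivAt l (k (l z)) z := by
  have hk0 : ∀ x, 0 < k x := fun x => hc.trans_le (hck x)
  have hC : 0 < C := (hk0 0).trans_le (hkC 0)
  have hki : Continuous fun x => (k x)⁻¹ := hk.inv₀ fun x => (hk0 x).ne'
  -- `l` is the inverse of the travel time `H`
  set H : ℝ → ℝ := fun x => ∫ y in (0 : ℝ)..x, (k y)⁻¹
  have hH : ∀ x, HasDerivAt H (k x)⁻¹ x := fun x =>
    intervalIntegral.integral_hasDerivAt_right (hki.intervalIntegrable _ _)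
      (hki.stronglyMeasurableAtFilter _ _) hki.continuousAt
  have hH0 : H 0 = 0 := intervalIntegral.integral_same
  have hdiff : Differentiable ℝ H := fun x => (hH x).differentiableAt
  have hmono : StrictMono H := strictMono_of_deriv_pos fun x => by
    rw [(hH x).deriv]
    exact inv_pos.2 (hk0 x)
  have hgrowth : ∀ ⦃x y⦄, x ≤ y → C⁻¹ * (y - x) ≤ H y - H x :=
    mul_sub_le_image_sub_of_le_deriv hdiff fun x => by
      rw [(hH x).deriv]
      exact inv_anti₀ (hk0 x) (hkC x)
  have hsurj : Function.Surjective H := by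
    refine hdiff.continuous.surjective ?_ ?_
    · refine tendsto_atTop_mono' atTop ?_ (tendsto_id.const_mul_atTop (inv_pos.2 hC))
      filter_upwards [eventually_ge_atTop 0] with x hx
      simpa only [hH0, sub_zero, id] using hgrowth hx
    · refine tendsto_atBot_mono' atBot ?_ (tendsto_id.const_mul_atBot (inv_pos.2 hC))
      filter_upwards [eventually_le_atBot 0] with x hx
      have := hgrowth hx
      rw [hH0] at this
      simp only [id]
      linarith
  let e := hmono.orderIsoOfSurjective H hsurj
  refine ⟨e.symm, e.symm_apply_eq.2 hH0.symm, fun z => ?_⟩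
  simpa only [inv_inv] using HasDerivAt.of_local_left_inverse (f := H) (g := e.symm) (a := z)
    e.symm.continuous.continuousAt (hH _) (inv_pos.2 (hk0 _)).ne'
    (Eventually.of_forall e.apply_symm_apply)

lemma sigmoid_le_exp (x : ℝ) : Real.sigmoid x ≤ Real.exp x := by
  have h := Real.sigmoid_mul_rexp_neg (-x)
  rw [neg_neg] at h
  rw [← h]
  exact mul_le_of_le_one_left (Real.exp_pos x).le (Real.sigmoid_le_one _)

/-- A solution `θ : ℝ → (0,1)` of the first-order equation `θ' = g(θ)` that approaches `0` at `-∞`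
and `1` at `+∞` exponentially with rate `c`. -/
structure IsExpTransition (g θ : ℝ → ℝ) (c : ℝ) : Prop where
  rate_pos : 0 < c
  mem_Ioo : ∀ z, θ z ∈ Ioo (0 : ℝ) 1
  hasDerivAt : ∀ z, HasDerivAt θ (g (θ z)) z
  le_exp : ∀ z ≤ 0, θ z ≤ Real.exp (-(c * |z|))
  one_sub_le_exp : ∀ z, 0 ≤ z → 1 - θ z ≤ Real.exp (-(c * |z|))

namespace IsPotential

variable {f g : ℝ → ℝ}

lemma exists_isExpTransition (h : IsPotential f g) : ∃ θ c, IsExpTransition g θ c := by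
  obtain ⟨c, hc, hcg⟩ := h.exists_mul_le_g
  obtain ⟨C, -, hgC⟩ := h.exists_g_le_mul
  have hσ : ∀ x, Real.sigmoid x ∈ Ioo (0 : ℝ) 1 := fun x =>
    ⟨Real.sigmoid_pos x, Real.sigmoid_lt_one x⟩
  have hσ_pos : ∀ x, 0 < Real.sigmoid x * (1 - Real.sigmoid x) := fun x =>
    mul_pos (hσ x).1 (sub_pos.2 (hσ x).2)
  -- in the variable `l` with `θ = sigmoid l` the equation becomes `l' = k(l)` with `c ≤ k ≤ C`
  set k : ℝ → ℝ := fun x => g (Real.sigmoid x) / (Real.sigmoid x * (1 - Real.sigmoid x)) with hk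
  have hk_cont : Continuous k :=
    (h.g_continuousOn.comp_continuous continuous_sigmoid fun x => (hσ x).1.le).div
      (continuous_sigmoid.mul (continuous_const.sub continuous_sigmoid)) fun x => (hσ_pos x).ne'
  have hck : ∀ x, c ≤ k x := fun x =>
    (le_div_iff₀ (hσ_pos x)).2 (hcg _ (Ioo_subset_Icc_self (hσ x)))
  have hkC : ∀ x, k x ≤ C := fun x =>
    (div_le_iff₀ (hσ_pos x)).2 (hgC _ (Ioo_subset_Icc_self (hσ x)))
  obtain ⟨l, hl0, hl⟩ := exists_hasDerivAt_of_continuous_of_bounds hk_cont hc hck hkC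
  have hgrowth : ∀ ⦃x y⦄, x ≤ y → c * (y - x) ≤ l y - l x :=
    mul_sub_le_image_sub_of_le_deriv (fun x => (hl x).differentiableAt) fun x => by
      rw [(hl x).deriv]
      exact hck _
  refine ⟨fun z => Real.sigmoid (l z), c, hc, fun z => hσ _, fun z => ?_, fun z hz => ?_,
    fun z hz => ?_⟩
  · refine ((Real.hasDerivAt_sigmoid (l z)).comp z (hl z)).congr_deriv ?_
    rw [hk, mul_div_cancel₀ _ (hσ_pos (l z)).ne']
  · refine (sigmoid_le_exp _).trans (Real.exp_le_exp.2 ?_)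
    rw [abs_of_nonpos hz]
    linarith [hgrowth hz]
  · rw [← Real.sigmoid_neg]
    refine (sigmoid_le_exp _).trans (Real.exp_le_exp.2 ?_)
    rw [abs_of_nonneg hz]
    linarith [hgrowth hz]

end IsPotential

namespace IsExpTransition

variable {f g θ : ℝ → ℝ} {c : ℝ}

lemma tendsto_atBot (h : IsExpTransition g θ c) : Tendsto θ atBot (𝓝 0) := by
  have hexp : Tendsto (fun z : ℝ => Real.exp (-(c * |z|))) atBot (𝓝 0) :=
    Real.tendsto_exp_neg_atTop_nhds_zero.comp (tendsto_abs_atBot_atTop.const_mul_atTop h.rate_pos)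
  refine tendsto_of_tendsto_of_tendsto_of_le_of_le' tendsto_const_nhds hexp
    (Eventually.of_forall fun z => (h.mem_Ioo z).1.le) ?_
  filter_upwards [eventually_le_atBot 0] with z hz using h.le_exp z hz

lemma tendsto_atTop (h : IsExpTransition g θ c) : Tendsto θ atTop (𝓝 1) := by
  have hexp : Tendsto (fun z : ℝ => 1 - Real.exp (-(c * |z|))) atTop (𝓝 1) := by
    simpa using (Real.tendsto_exp_neg_atTop_nhds_zero.comp
      (tendsto_abs_atTop_atTop.const_mul_atTop h.rate_pos)).const_sub 1
  refine tendsto_of_tendsto_of_tendsto_of_le_of_le' hexp tendsto_const_nhds ?_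
    (Eventually.of_forall fun z => (h.mem_Ioo z).2.le)
  filter_upwards [eventually_ge_atTop 0] with z hz
  linarith [h.one_sub_le_exp z hz]

lemma f_pos (h : IsExpTransition g θ c) (hfg : IsPotential f g) (z : ℝ) : 0 < f (θ z) :=
  hfg.f_pos _ (h.mem_Ioo z).1 (h.mem_Ioo z).2.ne

lemma contDiffAt_f (h : IsExpTransition g θ c) (hfg : IsPotential f g) (z : ℝ) :
    ContDiffAt ℝ ∞ f (θ z) :=
  hfg.f_smooth.contDiffAt (Ici_mem_nhds (h.mem_Ioo z).1)

lemma deriv_eq_sqrt (h : IsExpTransition g θ c) (hfg : IsPotential f g) :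
    deriv θ = fun z => √(2 * f (θ z)) := funext fun z => by
  have hθ := (h.mem_Ioo z).1.le
  rw [(h.hasDerivAt z).deriv, hfg.f_eq _ hθ, mul_div_cancel₀ _ two_ne_zero,
    Real.sqrt_sq (hfg.g_nonneg _ hθ)]

lemma contDiff_two (h : IsExpTransition g θ c) (hfg : IsPotential f g) : ContDiff ℝ 2 θ := by
  have hsucc : ∀ m : ℕ, ContDiff ℝ m θ → ContDiff ℝ (m + 1) θ := fun m hm => by
    refine contDiff_succ_iff_deriv.2 ⟨fun z => (h.hasDerivAt z).differentiableAt, by simp, ?_⟩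
    rw [h.deriv_eq_sqrt hfg]
    refine contDiff_iff_contDiffAt.2 fun z =>
      ContDiffAt.sqrt ?_ (mul_pos two_pos (h.f_pos hfg z)).ne'
    exact contDiffAt_const.mul
      (((h.contDiffAt_f hfg z).of_le (by exact_mod_cast le_top)).comp z hm.contDiffAt)
  have h0 : ContDiff ℝ (0 : ℕ) θ := by
    exact_mod_cast contDiff_zero.2 (continuous_iff_continuousAt.2
      fun z => (h.hasDerivAt z).continuousAt)
  exact_mod_cast hsucc 1 (by exact_mod_cast hsucc 0 h0)

lemma deriv_deriv_eq (h : IsExpTransition g θ c) (hfg : IsPotential f g) (z : ℝ) :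
    deriv (deriv θ) z = derivWithin f (Ici 0) (θ z) := by
  have hf : HasDerivAt f (derivWithin f (Ici 0) (θ z)) (θ z) := by
    rw [derivWithin_of_mem_nhds (Ici_mem_nhds (h.mem_Ioo z).1)]
    exact ((h.contDiffAt_f hfg z).differentiableAt (by norm_num)).hasDerivAt
  have hθ : HasDerivAt θ √(2 * f (θ z)) z := by
    rw [← congrFun (h.deriv_eq_sqrt hfg) z]
    exact (h.hasDerivAt z).differentiableAt.hasDerivAt
  have hpos := h.f_pos hfg z
  have hsqrt : HasDerivAt (fun z => √(2 * f (θ z))) _ z :=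
    ((hf.comp z hθ).const_mul 2).sqrt (mul_pos two_pos hpos).ne'
  rw [h.deriv_eq_sqrt hfg, hsqrt.deriv]
  simp only [Function.comp_apply]
  field

lemma isHeteroclinic (h : IsExpTransition g θ c) (hfg : IsPotential f g) : IsHeteroclinic f θ where
  smooth := h.contDiff_two hfg
  mem := h.mem_Ioo
  ode z := by rw [h.deriv_deriv_eq hfg, neg_add_cancel]
  atBot := h.tendsto_atBot
  atTop := h.tendsto_atTop

end IsExpTransition

end Heteroclinic

/-! ### The transition layer -/

section LayerEstimates

/-- The profile of a sharp interface, which transition layers of vanishing width approach. -/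
def step (r : ℝ) : ℝ := if 0 < r then 1 else 0

/-- The rate at which a transition layer of width `ε` approaches its limits at distance `|r|` from
the interface. -/
def layerDecay (c ε r : ℝ) : ℝ := Real.exp (-(c * |r / ε|))

lemma layerDecay_pos (c ε r : ℝ) : 0 < layerDecay c ε r := Real.exp_pos _

lemma layerDecay_le_one {c : ℝ} (hc : 0 ≤ c) (ε r : ℝ) : layerDecay c ε r ≤ 1 :=
  Real.exp_le_one_iff.2 (neg_nonpos.2 (mul_nonneg hc (abs_nonneg _)))

lemma layerDecay_sq_le {c : ℝ} (hc : 0 ≤ c) (ε r : ℝ) : layerDecay c ε r ^ 2 ≤ layerDecay c ε r :=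
  pow_le_of_le_one (layerDecay_pos c ε r).le (layerDecay_le_one hc ε r) two_ne_zero

lemma mul_exp_neg_mul_le {c : ℝ} (hc : 0 < c) (y : ℝ) : y * Real.exp (-(c * y)) ≤ 1 / c := by
  have h := Real.add_one_le_exp (c * y)
  rw [Real.exp_neg, ← div_eq_mul_inv, div_le_div_iff₀ (Real.exp_pos _) hc]
  linarith

lemma abs_div_mul_layerDecay_le {c : ℝ} (hc : 0 < c) (ε r : ℝ) :
    |r / ε| * layerDecay c ε r ≤ 1 / c :=
  mul_exp_neg_mul_le hc _

lemma layerDecay_div_le_of_le_abs {c ρ ε r : ℝ} (hc : 0 < c) (hρ : 0 < ρ) (hε : 0 < ε)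
    (hr : ρ ≤ |r|) : layerDecay c ε r / ε ≤ (2 / (c * ρ)) ^ 2 * ε := by
  have hsq : layerDecay c ε r ≤ Real.exp (-(c * ρ / 2 * (1 / ε))) ^ 2 := by
    rw [← Real.exp_nat_mul]
    refine Real.exp_le_exp.2 ?_
    have hle : ρ / ε ≤ |r / ε| := by
      rw [abs_div, abs_of_pos hε]
      gcongr
    have := mul_le_mul_of_nonneg_left hle hc.le
    push_cast
    linarith [show 2 * -(c * ρ / 2 * (1 / ε)) = -(c * (ρ / ε)) by ring]
  calc layerDecay c ε r / ε ≤ Real.exp (-(c * ρ / 2 * (1 / ε))) ^ 2 / ε := by gcongr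
    _ = (1 / ε * Real.exp (-(c * ρ / 2 * (1 / ε)))) ^ 2 * ε := by
      rw [mul_pow]
      field
    _ ≤ (1 / (c * ρ / 2)) ^ 2 * ε := by
      gcongr
      exact mul_exp_neg_mul_le (by positivity) _
    _ = (2 / (c * ρ)) ^ 2 * ε := by field

lemma mul_one_sub_le_abs_sub_step {t : ℝ} (ht : t ∈ Icc (0 : ℝ) 1) (r : ℝ) :
    t * (1 - t) ≤ |t - step r| := by
  have ht' : 0 ≤ 1 - t := sub_nonneg.2 ht.2
  unfold step
  split_ifs
  · rw [abs_sub_comm, abs_of_nonneg ht']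
    exact mul_le_of_le_one_left ht' ht.2
  · rw [sub_zero, abs_of_nonneg ht.1]
    exact mul_le_of_le_one_right ht.1 (by linarith [ht.1])

lemma le_mul_of_abs_sub_step_le {g : ℝ → ℝ} {C : ℝ} (hC : 0 ≤ C)
    (hgC : ∀ s ∈ Icc (0 : ℝ) 1, g s ≤ C * (s * (1 - s))) {t r b : ℝ} (ht : t ∈ Icc (0 : ℝ) 1)
    (hb : |t - step r| ≤ b) : g t ≤ C * b :=
  (hgC t ht).trans
    (mul_le_mul_of_nonneg_left ((mul_one_sub_le_abs_sub_step ht r).trans hb) hC)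

lemma IsCutoffProfile.mem_Icc {φ : ℝ → ℝ} (h : IsCutoffProfile φ) (z : ℝ) :
    φ z ∈ Icc (0 : ℝ) 1 := by
  rcases le_or_gt 1 |z| with hz | hz
  · rw [h.zero z hz]
    exact left_mem_Icc.2 zero_le_one
  · have habs : φ z = φ |z| := by rcases abs_choice z with hz | hz <;> simp only [hz, h.even]
    refine ⟨(h.pos z hz).le, ?_⟩
    calc φ z = φ |z| := habs
      _ ≤ φ 0 := h.antitone (left_mem_Icc.2 zero_le_one) ⟨abs_nonneg z, hz.le⟩ (abs_nonneg z)
      _ ≤ 1 := by simpa using h.upper 0 (by simp)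

namespace IsPotential

variable {f g φ : ℝ → ℝ} {C : ℝ}

lemma intervalIntegrable_g (h : IsPotential f g) {a b : ℝ} (ha : 0 ≤ a) (hb : 0 ≤ b) :
    IntervalIntegrable g volume a b :=
  (h.g_continuousOn.mono fun _ hs => (le_inf ha hb).trans hs.1).intervalIntegrable

lemma abs_integral_g_sub_step_le (h : IsPotential f g)
    (hgC : ∀ s ∈ Icc (0 : ℝ) 1, g s ≤ C) {t : ℝ} (ht : t ∈ Icc (0 : ℝ) 1) (r : ℝ) :
    |(∫ s in (0 : ℝ)..t, g s) - step r| ≤ C * |t - step r| := by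
  have hle : ∀ a ∈ Icc (0 : ℝ) 1, ∀ b ∈ Icc (0 : ℝ) 1, |∫ s in a..b, g s| ≤ C * |b - a| := by
    intro a ha b hb
    rw [← Real.norm_eq_abs]
    refine intervalIntegral.norm_integral_le_of_norm_le_const fun s hs => ?_
    have hs' : s ∈ Icc (0 : ℝ) 1 :=
      ⟨(le_inf ha.1 hb.1).trans hs.1.le, hs.2.trans (sup_le ha.2 hb.2)⟩
    rw [Real.norm_eq_abs, abs_of_nonneg (h.g_nonneg s hs'.1)]
    exact hgC s hs'
  have h0 : (0 : ℝ) ∈ Icc (0 : ℝ) 1 := left_mem_Icc.2 zero_le_one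
  have h1 : (1 : ℝ) ∈ Icc (0 : ℝ) 1 := right_mem_Icc.2 zero_le_one
  unfold step
  split_ifs
  · have hsplit := intervalIntegral.integral_interval_sub_left
      (h.intervalIntegrable_g le_rfl ht.1) (h.intervalIntegrable_g le_rfl zero_le_one)
    rw [h.normalization] at hsplit
    rw [hsplit]
    exact hle 1 h1 t ht
  · simpa only [sub_zero] using hle 0 h0 t ht

lemma defect_le_of_abs_le_half (h : IsPotential f g) (hφ : IsCutoffProfile φ) {δ ε c r t : ℝ}
    (hδ : 0 < δ) (hε : 0 < ε) (hc : 0 < c) (hr : |r| ≤ δ / 2) (ht : 0 ≤ t)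
    (hgt : g t ≤ C * layerDecay c ε r) :
    ε / 2 * (g t / ε) ^ 2 + 1 / ε * f t - φ (r / δ) * (g t * (g t / ε))
      ≤ 4 * C ^ 2 / (δ * c) ^ 2 * ε := by
  have hrδ : |r / δ| ≤ 1 / 2 := by
    rw [abs_div, abs_of_pos hδ, div_le_iff₀ hδ]
    linarith
  have hφr : 1 - φ (r / δ) ≤ 4 * (r / δ) ^ 2 := by linarith [hφ.lower _ hrδ]
  have hdecay := layerDecay_pos c ε r
  calc ε / 2 * (g t / ε) ^ 2 + 1 / ε * f t - φ (r / δ) * (g t * (g t / ε))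
      = (1 - φ (r / δ)) * (g t ^ 2 / ε) := by
        rw [h.f_eq t ht]
        field
    _ ≤ 4 * (r / δ) ^ 2 * ((C * layerDecay c ε r) ^ 2 / ε) := by
        have := h.g_nonneg t ht
        gcongr
    _ = 4 * C ^ 2 / δ ^ 2 * (|r / ε| * layerDecay c ε r) ^ 2 * ε := by
        rw [mul_pow, mul_pow, sq_abs]
        field
    _ ≤ 4 * C ^ 2 / δ ^ 2 * (1 / c) ^ 2 * ε := by
        gcongr
        exact abs_div_mul_layerDecay_le hc ε r
    _ = 4 * C ^ 2 / (δ * c) ^ 2 * ε := by field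

lemma f_le_mul_layerDecay (h : IsPotential f g) {ε c r t : ℝ} (hc : 0 ≤ c) (ht : 0 ≤ t)
    (hgt : g t ≤ C * layerDecay c ε r) : f t ≤ C ^ 2 * layerDecay c ε r := by
  have hg := h.g_nonneg t ht
  calc f t = g t ^ 2 / 2 := h.f_eq t ht
    _ ≤ g t ^ 2 := half_le_self (sq_nonneg _)
    _ ≤ (C * layerDecay c ε r) ^ 2 := by gcongr
    _ = C ^ 2 * layerDecay c ε r ^ 2 := mul_pow ..
    _ ≤ C ^ 2 * layerDecay c ε r := by
        gcongr
        exact layerDecay_sq_le hc ε r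

lemma defect_le_of_half_le_abs (h : IsPotential f g) (hφ : IsCutoffProfile φ)
    {δ ε c K r t q : ℝ} (hδ : 0 < δ) (hε : 0 < ε) (hc : 0 < c) (hC : 0 ≤ C) (hr : δ / 2 ≤ |r|)
    (ht : 0 ≤ t) (hgt : g t ≤ C * layerDecay c ε r) (hq : |q| ≤ K / ε * layerDecay c ε r) :
    ε / 2 * q ^ 2 + 1 / ε * f t - φ (r / δ) * (g t * q)
      ≤ (K ^ 2 + C ^ 2 + C * K) * (4 / (c * δ)) ^ 2 * ε := by
  set E := layerDecay c ε r
  have hE0 : 0 < E := layerDecay_pos c ε r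
  have hE2 : E ^ 2 ≤ E := layerDecay_sq_le hc.le ε r
  have hK : 0 ≤ K := by
    have := (abs_nonneg q).trans hq
    rwa [div_mul_eq_mul_div, le_div_iff₀ hε, zero_mul, mul_nonneg_iff_of_pos_right hE0] at this
  have hg := h.g_nonneg t ht
  have hdirichlet : ε / 2 * q ^ 2 ≤ K ^ 2 * (E / ε) :=
    calc ε / 2 * q ^ 2 ≤ ε / 2 * (K / ε * E) ^ 2 := by
          rw [← sq_abs q]
          gcongr
      _ = K ^ 2 * (E ^ 2 / ε) / 2 := by field
      _ ≤ K ^ 2 * (E ^ 2 / ε) := half_le_self (by positivity)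
      _ ≤ K ^ 2 * (E / ε) := by gcongr
  have hpotential : 1 / ε * f t ≤ C ^ 2 * (E / ε) :=
    calc 1 / ε * f t ≤ 1 / ε * (C ^ 2 * E) := by
          gcongr
          exact h.f_le_mul_layerDecay hc.le ht hgt
      _ = C ^ 2 * (E / ε) := by ring
  have hcalibration : -(φ (r / δ) * (g t * q)) ≤ C * K * (E / ε) :=
    calc -(φ (r / δ) * (g t * q)) ≤ φ (r / δ) * (g t * |q|) := by
          rw [← mul_neg, ← mul_neg]
          have := (hφ.mem_Icc (r / δ)).1
          gcongr
          exact neg_le_abs q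
      _ ≤ 1 * (C * E * (K / ε * E)) := by
          have := (hφ.mem_Icc (r / δ)).2
          gcongr
      _ = C * K * (E ^ 2 / ε) := by ring
      _ ≤ C * K * (E / ε) := by gcongr
  calc ε / 2 * q ^ 2 + 1 / ε * f t - φ (r / δ) * (g t * q)
      ≤ (K ^ 2 + C ^ 2 + C * K) * (E / ε) := by linarith
    _ ≤ (K ^ 2 + C ^ 2 + C * K) * ((2 / (c * (δ / 2))) ^ 2 * ε) := by
        gcongr
        exact layerDecay_div_le_of_le_abs hc (half_pos hδ) hε hr
    _ = (K ^ 2 + C ^ 2 + C * K) * (4 / (c * δ)) ^ 2 * ε := by field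

end IsPotential

end LayerEstimates

section LayerProfile

/-- The cut-off that equals `1` on `[-δ / 2, δ / 2]` and vanishes outside `(-δ, δ)`. -/
def layerCutoff {δ : ℝ} (hδ : 0 < δ) : ContDiffBump (0 : ℝ) :=
  ⟨δ / 2, δ, half_pos hδ, half_lt_self hδ⟩

/-- A smooth function that agrees with `step` outside `(-δ / 2, δ / 2)`. -/
def softStep (δ r : ℝ) : ℝ := Real.smoothTransition (r / δ + 1 / 2)

/-- The transition layer of width `ε`: the rescaled profile `θ (r / ε)` for `|r| ≤ δ / 2`, changed
smoothly into `step` for `|r| ≥ δ`. -/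
def layerProfile {δ : ℝ} (hδ : 0 < δ) (θ : ℝ → ℝ) (ε r : ℝ) : ℝ :=
  layerCutoff hδ r * θ (r / ε) + (1 - layerCutoff hδ r) * softStep δ r

variable {δ : ℝ}

lemma layerCutoff_eq_one (hδ : 0 < δ) {r : ℝ} (hr : |r| ≤ δ / 2) : layerCutoff hδ r = 1 :=
  (layerCutoff hδ).one_of_mem_closedBall (mem_closedBall_zero_iff.2 hr)

lemma layerCutoff_eq_zero (hδ : 0 < δ) {r : ℝ} (hr : δ ≤ |r|) : layerCutoff hδ r = 0 :=
  (layerCutoff hδ).zero_of_le_dist (by rwa [dist_zero_right])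

lemma deriv_layerCutoff_eq_zero (hδ : 0 < δ) {r : ℝ} (hr : |r| ≤ δ / 2) :
    deriv (layerCutoff hδ) r = 0 :=
  IsLocalMax.deriv_eq_zero <| .of_forall fun x => by
    rw [layerCutoff_eq_one hδ hr]
    exact (layerCutoff hδ).le_one

lemma exists_abs_deriv_layerCutoff_le (hδ : 0 < δ) :
    ∃ B, 0 ≤ B ∧ ∀ r, |deriv (layerCutoff hδ) r| ≤ B := by
  have hsmooth : ContDiff ℝ 1 (layerCutoff hδ) := (layerCutoff hδ).contDiff
  obtain ⟨B, hB⟩ := (hsmooth.continuous_deriv le_rfl).bounded_above_of_compact_support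
    (layerCutoff hδ).hasCompactSupport.deriv
  exact ⟨B, (norm_nonneg _).trans (hB 0), hB⟩

lemma contDiff_softStep (δ : ℝ) : ContDiff ℝ 1 (softStep δ) :=
  Real.smoothTransition.contDiff.comp (by fun_prop)

lemma softStep_mem_Icc (δ r : ℝ) : softStep δ r ∈ Icc (0 : ℝ) 1 :=
  ⟨Real.smoothTransition.nonneg _, Real.smoothTransition.le_one _⟩

lemma softStep_eq_step (hδ : 0 < δ) {r : ℝ} (hr : δ / 2 ≤ |r|) : softStep δ r = step r := by
  unfold softStep step
  rcases le_abs.1 hr with hr | hr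
  · rw [if_pos (by linarith)]
    refine Real.smoothTransition.one_of_one_le ?_
    have : 1 / 2 ≤ r / δ := by rw [le_div_iff₀ hδ]; linarith
    linarith
  · rw [if_neg (by linarith)]
    refine Real.smoothTransition.zero_of_nonpos ?_
    have : r / δ ≤ -(1 / 2) := by rw [div_le_iff₀ hδ]; linarith
    linarith

lemma deriv_softStep_eq_zero (hδ : 0 < δ) {r : ℝ} (hr : δ / 2 ≤ |r|) :
    deriv (softStep δ) r = 0 := by
  have hstep := softStep_eq_step hδ hr
  unfold step at hstep
  split_ifs at hstep
  · exact IsLocalMax.deriv_eq_zero (.of_forall fun x => hstep ▸ (softStep_mem_Icc δ x).2)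
  · exact IsLocalMin.deriv_eq_zero (.of_forall fun x => hstep ▸ (softStep_mem_Icc δ x).1)

lemma layerProfile_eq_of_abs_le_half (hδ : 0 < δ) (θ : ℝ → ℝ) (ε : ℝ) {r : ℝ}
    (hr : |r| ≤ δ / 2) : layerProfile hδ θ ε r = θ (r / ε) := by
  rw [layerProfile, layerCutoff_eq_one hδ hr]
  ring

lemma layerProfile_eq_of_half_le_abs (hδ : 0 < δ) (θ : ℝ → ℝ) (ε : ℝ) {r : ℝ}
    (hr : δ / 2 ≤ |r|) :
    layerProfile hδ θ ε r = step r + layerCutoff hδ r * (θ (r / ε) - step r) := by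
  rw [layerProfile, softStep_eq_step hδ hr]
  ring

lemma layerProfile_eq_step (hδ : 0 < δ) (θ : ℝ → ℝ) (ε : ℝ) {r : ℝ} (hr : δ ≤ |r|) :
    layerProfile hδ θ ε r = step r := by
  rw [layerProfile_eq_of_half_le_abs hδ θ ε ((half_le_self hδ.le).trans hr),
    layerCutoff_eq_zero hδ hr, zero_mul, add_zero]

lemma contDiff_layerProfile {θ : ℝ → ℝ} (hθ : ContDiff ℝ 1 θ) (hδ : 0 < δ) (ε : ℝ) :
    ContDiff ℝ 1 (layerProfile hδ θ ε) := by
  have hη : ContDiff ℝ 1 (layerCutoff hδ) := (layerCutoff hδ).contDiff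
  exact (hη.mul (hθ.comp (by fun_prop : ContDiff ℝ 1 fun r : ℝ => r / ε))).add
    ((contDiff_const.sub hη).mul (contDiff_softStep δ))

namespace IsExpTransition

variable {g θ : ℝ → ℝ} {c C : ℝ}

lemma abs_sub_step_le (h : IsExpTransition g θ c) {ε : ℝ} (hε : 0 < ε) (r : ℝ) :
    |θ (r / ε) - step r| ≤ layerDecay c ε r := by
  have hmem := h.mem_Ioo (r / ε)
  unfold step
  split_ifs with hr
  · rw [abs_sub_comm, abs_of_pos (sub_pos.2 hmem.2)]
    exact h.one_sub_le_exp _ (by positivity)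
  · rw [sub_zero, abs_of_pos hmem.1]
    exact h.le_exp _ (div_nonpos_of_nonpos_of_nonneg (not_lt.1 hr) hε.le)

lemma layerProfile_mem_Icc (h : IsExpTransition g θ c) (hδ : 0 < δ) (ε r : ℝ) :
    layerProfile hδ θ ε r ∈ Icc (0 : ℝ) 1 :=
  convex_Icc (0 : ℝ) 1 (Ioo_subset_Icc_self (h.mem_Ioo (r / ε))) (softStep_mem_Icc δ r)
    (layerCutoff hδ).nonneg (sub_nonneg.2 (layerCutoff hδ).le_one) (add_sub_cancel ..)

lemma abs_layerProfile_sub_step_le (h : IsExpTransition g θ c) (hδ : 0 < δ) {ε : ℝ} (hε : 0 < ε)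
    (r : ℝ) : |layerProfile hδ θ ε r - step r| ≤ layerDecay c ε r := by
  rcases le_total |r| (δ / 2) with hr | hr
  · rw [layerProfile_eq_of_abs_le_half hδ θ ε hr]
    exact h.abs_sub_step_le hε r
  · rw [layerProfile_eq_of_half_le_abs hδ θ ε hr, add_sub_cancel_left, abs_mul,
      abs_of_nonneg (layerCutoff hδ).nonneg]
    exact (mul_le_of_le_one_left (abs_nonneg _) (layerCutoff hδ).le_one).trans
      (h.abs_sub_step_le hε r)

lemma hasDerivAt_comp_div (h : IsExpTransition g θ c) (ε r : ℝ) :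
    HasDerivAt (fun r => θ (r / ε)) (g (θ (r / ε)) / ε) r := by
  simpa only [Function.comp_def, mul_one_div, id] using
    (h.hasDerivAt (r / ε)).comp r ((hasDerivAt_id r).div_const ε)

lemma deriv_layerProfile (h : IsExpTransition g θ c) (hδ : 0 < δ) (ε r : ℝ) :
    deriv (layerProfile hδ θ ε) r =
      deriv (layerCutoff hδ) r * (θ (r / ε) - softStep δ r)
        + layerCutoff hδ r * (g (θ (r / ε)) / ε) := by
  have hη : ContDiff ℝ 1 (layerCutoff hδ) := (layerCutoff hδ).contDiff
  have hη' := (hη.differentiable one_ne_zero r).hasDerivAt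
  have hS' := ((contDiff_softStep δ).differentiable one_ne_zero r).hasDerivAt
  have hdisjoint : (1 - layerCutoff hδ r) * deriv (softStep δ) r = 0 := by
    rcases le_total |r| (δ / 2) with hr | hr
    · rw [layerCutoff_eq_one hδ hr, sub_self, zero_mul]
    · rw [deriv_softStep_eq_zero hδ hr, mul_zero]
  refine ((hη'.mul (h.hasDerivAt_comp_div ε r)).add
    ((hη'.const_sub 1).mul hS')).deriv.trans ?_
  linear_combination hdisjoint

lemma deriv_layerProfile_of_abs_le_half (h : IsExpTransition g θ c) (hδ : 0 < δ) (ε : ℝ) {r : ℝ}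
    (hr : |r| ≤ δ / 2) :
    deriv (layerProfile hδ θ ε) r = g (layerProfile hδ θ ε r) / ε := by
  rw [h.deriv_layerProfile, deriv_layerCutoff_eq_zero hδ hr, layerCutoff_eq_one hδ hr,
    layerProfile_eq_of_abs_le_half hδ θ ε hr, zero_mul, one_mul, zero_add]

lemma abs_deriv_layerProfile_le (h : IsExpTransition g θ c) (hC : 0 ≤ C)
    (hgC : ∀ s ∈ Icc (0 : ℝ) 1, g s ≤ C * (s * (1 - s))) (hg : ∀ s, 0 ≤ s → 0 ≤ g s)
    (hδ : 0 < δ) {B : ℝ} (hB0 : 0 ≤ B) (hB : ∀ r, |deriv (layerCutoff hδ) r| ≤ B)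
    {ε : ℝ} (hε : 0 < ε) (hε1 : ε ≤ 1) (r : ℝ) :
    |deriv (layerProfile hδ θ ε) r| ≤ (B + C) / ε * layerDecay c ε r := by
  have hdecay := layerDecay_pos c ε r
  have hmem := h.mem_Ioo (r / ε)
  have hgθ := hg _ hmem.1.le
  have hcut : |deriv (layerCutoff hδ) r * (θ (r / ε) - softStep δ r)|
      ≤ B / ε * layerDecay c ε r := by
    rcases le_total |r| (δ / 2) with hr | hr
    · rw [deriv_layerCutoff_eq_zero hδ hr, zero_mul, abs_zero]
      positivity
    · rw [abs_mul, softStep_eq_step hδ hr]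
      calc |deriv (layerCutoff hδ) r| * |θ (r / ε) - step r| ≤ B * layerDecay c ε r := by
            gcongr
            exacts [hB r, h.abs_sub_step_le hε r]
        _ ≤ B / ε * layerDecay c ε r := by
            gcongr
            exact le_div_self hB0 hε hε1
  have htransition : |layerCutoff hδ r * (g (θ (r / ε)) / ε)| ≤ C / ε * layerDecay c ε r := by
    rw [abs_of_nonneg (mul_nonneg (layerCutoff hδ).nonneg (by positivity)), div_mul_eq_mul_div]
    refine (mul_le_of_le_one_left (by positivity) (layerCutoff hδ).le_one).trans ?_
    gcongr
    exact le_mul_of_abs_sub_step_le hC hgC (Ioo_subset_Icc_self hmem) (h.abs_sub_step_le hε r)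
  rw [h.deriv_layerProfile, add_div, add_mul]
  exact (abs_add_le _ _).trans (add_le_add hcut htransition)

end IsExpTransition

/-- The properties of a transition layer `p` of width `ε` on which the energy estimates rest. The
constants `c` and `K` are meant to be independent of `ε`. The field `defect_le` bounds the
one-dimensional energy density minus the calibration `φ (r / δ) (∫₀ᵖ g)'`. -/
structure IsLayerProfile (f g φ θ : ℝ → ℝ) (δ c K ε : ℝ) (p : ℝ → ℝ) : Prop where
  contDiff : ContDiff ℝ 1 p
  mem_Icc : ∀ r, p r ∈ Icc (0 : ℝ) 1
  inner : ∀ r, |r| ≤ δ / 2 → p r = θ (r / ε)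
  outer : ∀ r, δ ≤ |r| → p r = step r
  deriv_le : ∀ r, |deriv p r| ≤ K / ε * layerDecay c ε r
  potential_le : ∀ r, f (p r) ≤ K * layerDecay c ε r
  defect_le : ∀ r, ε / 2 * deriv p r ^ 2 + 1 / ε * f (p r) - φ (r / δ) * (g (p r) * deriv p r)
    ≤ K * ε
  bulk_le : ∀ r, |(∫ s in (0 : ℝ)..p r, g s) - step r| * |r| ≤ K * ε

lemma IsLayerProfile.deriv_outer {f g φ θ p : ℝ → ℝ} {c K ε : ℝ}
    (h : IsLayerProfile f g φ θ δ c K ε p) {r : ℝ} (hr : δ ≤ |r|) : deriv p r = 0 := by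
  have hstep := h.outer r hr
  unfold step at hstep
  split_ifs at hstep
  · exact IsLocalMax.deriv_eq_zero (.of_forall fun x => hstep ▸ (h.mem_Icc x).2)
  · exact IsLocalMin.deriv_eq_zero (.of_forall fun x => hstep ▸ (h.mem_Icc x).1)

namespace IsPotential

variable {f g φ θ : ℝ → ℝ} {c C : ℝ}

lemma defect_layerProfile_le (h : IsPotential f g) (hφ : IsCutoffProfile φ)
    (hθ : IsExpTransition g θ c) (hC : 0 ≤ C)
    (hgC : ∀ s ∈ Icc (0 : ℝ) 1, g s ≤ C * (s * (1 - s))) (hδ : 0 < δ) {K ε : ℝ} (hε : 0 < ε)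
    (hK : ∀ r, |deriv (layerProfile hδ θ ε) r| ≤ K / ε * layerDecay c ε r) (r : ℝ) :
    ε / 2 * deriv (layerProfile hδ θ ε) r ^ 2 + 1 / ε * f (layerProfile hδ θ ε r)
        - φ (r / δ) * (g (layerProfile hδ θ ε r) * deriv (layerProfile hδ θ ε) r)
      ≤ max (4 * C ^ 2 / (δ * c) ^ 2) ((K ^ 2 + C ^ 2 + C * K) * (4 / (c * δ)) ^ 2) * ε := by
  have hmem := hθ.layerProfile_mem_Icc hδ ε r
  have hgp : g (layerProfile hδ θ ε r) ≤ C * layerDecay c ε r :=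
    le_mul_of_abs_sub_step_le hC hgC hmem (hθ.abs_layerProfile_sub_step_le hδ hε r)
  rcases le_total |r| (δ / 2) with hr | hr
  · rw [hθ.deriv_layerProfile_of_abs_le_half hδ ε hr]
    refine (h.defect_le_of_abs_le_half hφ hδ hε hθ.rate_pos hr hmem.1 hgp).trans ?_
    gcongr
    exact le_max_left ..
  · refine (h.defect_le_of_half_le_abs hφ hδ hε hθ.rate_pos hC hr hmem.1 hgp (hK r)).trans ?_
    gcongr
    exact le_max_right ..

lemma bulk_layerProfile_le (h : IsPotential f g) (hθ : IsExpTransition g θ c) (hC : 0 ≤ C)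
    (hgC : ∀ s ∈ Icc (0 : ℝ) 1, g s ≤ C * (s * (1 - s))) (hδ : 0 < δ) {ε : ℝ} (hε : 0 < ε)
    (r : ℝ) : |(∫ s in (0 : ℝ)..layerProfile hδ θ ε r, g s) - step r| * |r| ≤ C / c * ε := by
  have hgC' : ∀ s ∈ Icc (0 : ℝ) 1, g s ≤ C := fun s hs =>
    (hgC s hs).trans (mul_le_of_le_one_right hC
      (mul_le_one₀ hs.2 (sub_nonneg.2 hs.2) (sub_le_self 1 hs.1)))
  calc |(∫ s in (0 : ℝ)..layerProfile hδ θ ε r, g s) - step r| * |r|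
      ≤ C * layerDecay c ε r * |r| := by
        gcongr
        refine (h.abs_integral_g_sub_step_le hgC' (hθ.layerProfile_mem_Icc hδ ε r) r).trans ?_
        gcongr
        exact hθ.abs_layerProfile_sub_step_le hδ hε r
    _ = C * (|r / ε| * layerDecay c ε r) * ε := by
        rw [abs_div, abs_of_pos hε]
        field
    _ ≤ C * (1 / c) * ε := by
        gcongr
        exact abs_div_mul_layerDecay_le hθ.rate_pos ε r
    _ = C / c * ε := by ring

lemma exists_isLayerProfile (h : IsPotential f g) (hφ : IsCutoffProfile φ)
    (hθ : IsExpTransition g θ c) (hθs : ContDiff ℝ 1 θ) (hδ : 0 < δ) :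
    ∃ K, 0 < K ∧ ∀ ε, 0 < ε → ε ≤ 1 → ∃ p, IsLayerProfile f g φ θ δ c K ε p := by
  obtain ⟨C, hC, hgC⟩ := h.exists_g_le_mul
  obtain ⟨B, hB0, hB⟩ := exists_abs_deriv_layerCutoff_le hδ
  have hc := hθ.rate_pos
  set D := max (4 * C ^ 2 / (δ * c) ^ 2) (((B + C) ^ 2 + C ^ 2 + C * (B + C)) * (4 / (c * δ)) ^ 2)
  have hD : 0 < D := lt_max_of_lt_left (by positivity)
  have hbulk : 0 < C / c := by positivity
  have hC2 : 0 < C ^ 2 := by positivity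
  refine ⟨(B + C) + C ^ 2 + D + C / c, by positivity, fun ε hε hε1 => ⟨layerProfile hδ θ ε, ?_⟩⟩
  have hderiv := hθ.abs_deriv_layerProfile_le hC.le hgC h.g_nonneg hδ hB0 hB hε hε1
  have hdecay := layerDecay_pos c ε
  refine
    { contDiff := contDiff_layerProfile hθs hδ ε
      mem_Icc := hθ.layerProfile_mem_Icc hδ ε
      inner := fun r => layerProfile_eq_of_abs_le_half hδ θ ε
      outer := fun r => layerProfile_eq_step hδ θ ε
      deriv_le := fun r => (hderiv r).trans ?_
      potential_le := fun r => (h.f_le_mul_layerDecay hc.le (hθ.layerProfile_mem_Icc hδ ε r).1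
        (le_mul_of_abs_sub_step_le hC.le hgC (hθ.layerProfile_mem_Icc hδ ε r)
          (hθ.abs_layerProfile_sub_step_le hδ hε r))).trans ?_
      defect_le := fun r =>
        (h.defect_layerProfile_le hφ hθ hC.le hgC hδ hε hderiv r).trans ?_
      bulk_le := fun r => (h.bulk_layerProfile_le hθ hC.le hgC hδ hε r).trans ?_ }
  · have := hdecay r
    have : B + C ≤ (B + C) + C ^ 2 + D + C / c := by linarith
    gcongr
  · have := hdecay r
    gcongr
    linarith
  · gcongr
    linarith
  · gcongr
    linarith

end IsPotential

end LayerProfile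

/-! ### The signed distance -/

section SignedDistance

lemma eq_of_norm_le_one_of_inner_eq_one {E : Type*} [NormedAddCommGroup E] [InnerProductSpace ℝ E]
    {v e : E} (hv : ‖v‖ ≤ 1) (he : ‖e‖ = 1) (hve : ⟪v, e⟫ = 1) : v = e := by
  have hv1 : ‖v‖ = 1 := le_antisymm hv (by simpa [he, hve] using real_inner_le_norm v e)
  exact (inner_eq_one_iff_of_norm_eq_one (𝕜 := ℝ) hv1 he).1 hve

lemma abs_signedDistTo (I : Set Plane) (x : Plane) : |signedDistTo I x| = Metric.infDist x I := by
  unfold signedDistTo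
  split_ifs <;> simp [abs_of_nonneg Metric.infDist_nonneg]

lemma infDist_add_infDist_le {I : Set Plane} {x y : Plane} (hx : x ∈ enclosed I)
    (hy : y ∉ enclosed I) : Metric.infDist x I + Metric.infDist y I ≤ dist x y := by
  by_cases h : ∃ z ∈ segment ℝ x y, z ∈ I
  · obtain ⟨z, hz, hzI⟩ := h
    rw [← dist_add_dist_of_mem_segment hz, dist_comm z y]
    exact add_le_add (Metric.infDist_le_dist_of_mem hzI) (Metric.infDist_le_dist_of_mem hzI)
  · push Not at h
    refine absurd ?_ hy
    have hs : segment ℝ x y ⊆ Iᶜ := fun z hz => h z hz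
    have hsub := (convex_segment x y).isPreconnected.subset_connectedComponentIn
      (left_mem_segment ℝ x y) hs
    refine ⟨hs (right_mem_segment ℝ x y), ?_⟩
    rw [← connectedComponentIn_eq (hsub (right_mem_segment ℝ x y))]
    exact hx.2

lemma lipschitzWith_signedDistTo (I : Set Plane) : LipschitzWith 1 (signedDistTo I) := by
  refine LipschitzWith.of_le_add fun x y => ?_
  have hxy : Metric.infDist x I ≤ Metric.infDist y I + dist x y :=
    Metric.infDist_le_infDist_add_dist
  have hyx : Metric.infDist y I ≤ Metric.infDist x I + dist x y :=
    dist_comm x y ▸ Metric.infDist_le_infDist_add_dist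
  have hx0 := Metric.infDist_nonneg (x := x) (s := I)
  unfold signedDistTo
  split_ifs with hx hy hy
  · exact hxy
  · linarith [infDist_add_infDist_le hx hy]
  · linarith [dist_nonneg (x := x) (y := y)]
  · linarith

variable {I : Set Plane} {x y : Plane}

lemma infDist_sub_smul (hy : y ∈ I) (hxy : dist x y = Metric.infDist x I) {s : ℝ}
    (hs : s ∈ Icc (0 : ℝ) 1) :
    Metric.infDist (x - s • (x - y)) I = (1 - s) * Metric.infDist x I := by
  refine le_antisymm ?_ ?_
  · refine (Metric.infDist_le_dist_of_mem hy).trans_eq ?_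
    rw [dist_eq_norm, show x - s • (x - y) - y = (1 - s) • (x - y) by module, norm_smul,
      Real.norm_of_nonneg (sub_nonneg.2 hs.2), ← dist_eq_norm, hxy]
  · have htriangle : Metric.infDist x I ≤
        Metric.infDist (x - s • (x - y)) I + dist x (x - s • (x - y)) :=
      Metric.infDist_le_infDist_add_dist
    rw [dist_eq_norm x (x - _), sub_sub_cancel, norm_smul, Real.norm_of_nonneg hs.1,
      ← dist_eq_norm, hxy] at htriangle
    linarith

/-- The sign cannot change on the way from `x` to its nearest point, because `signedDistTo I` is
`1`-Lipschitz. -/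
lemma signedDistTo_sub_smul (hy : y ∈ I) (hxy : dist x y = Metric.infDist x I) {s : ℝ}
    (hs : s ∈ Icc (0 : ℝ) 1) :
    signedDistTo I (x - s • (x - y)) = (1 - s) * signedDistTo I x := by
  have habs := abs_signedDistTo I (x - s • (x - y))
  rw [infDist_sub_smul hy hxy hs] at habs
  have hlip := (lipschitzWith_signedDistTo I).dist_le_mul x (x - s • (x - y))
  rw [NNReal.coe_one, one_mul, dist_eq_norm x, sub_sub_cancel, norm_smul, Real.norm_of_nonneg hs.1,
    ← dist_eq_norm, hxy, Real.dist_eq] at hlip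
  rw [← abs_signedDistTo I x] at habs hlip
  obtain ⟨hlower, hupper⟩ := abs_le.1 hlip
  rcases le_total 0 (signedDistTo I x) with h | h
  · rw [abs_of_nonneg h] at habs hlower hupper
    linarith [le_abs_self (signedDistTo I (x - s • (x - y)))]
  · rw [abs_of_nonpos h] at habs hlower hupper
    linarith [neg_abs_le (signedDistTo I (x - s • (x - y)))]

lemma fderiv_signedDistTo_sub (hy : y ∈ I) (hxy : dist x y = Metric.infDist x I)
    (hd : DifferentiableAt ℝ (signedDistTo I) x) :
    fderiv ℝ (signedDistTo I) x (x - y) = signedDistTo I x := by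
  have hpath : HasDerivAt (fun s : ℝ => x - s • (x - y)) (-(x - y)) 0 := by
    simpa using ((hasDerivAt_id (0 : ℝ)).smul_const (x - y)).const_sub x
  have hd' : HasFDerivAt (signedDistTo I) (fderiv ℝ (signedDistTo I) x)
      (x - (0 : ℝ) • (x - y)) := by
    simpa using hd.hasFDerivAt
  have hchain := (hd'.comp_hasDerivAt 0 hpath).hasDerivWithinAt (s := Icc 0 1)
  have hlinear : HasDerivWithinAt (fun s : ℝ => (1 - s) * signedDistTo I x) (-signedDistTo I x)
      (Icc 0 1) 0 := by
    simpa using (((hasDerivAt_id (0 : ℝ)).const_sub 1).mul_const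
      (signedDistTo I x)).hasDerivWithinAt
  have h0 : (0 : ℝ) ∈ Icc (0 : ℝ) 1 := left_mem_Icc.2 zero_le_one
  have heq := (uniqueDiffOn_Icc zero_lt_one (0 : ℝ) h0).eq_deriv _ hchain
    (hlinear.congr_of_mem (fun s hs => signedDistTo_sub_smul hy hxy hs) h0)
  rwa [map_neg, neg_inj] at heq

lemma gradient_signedDistTo (hy : y ∈ I) (hxy : dist x y = Metric.infDist x I)
    (hpos : 0 < Metric.infDist x I) (hd : DifferentiableAt ℝ (signedDistTo I) x) :
    gradient (signedDistTo I) x = (signedDistTo I x)⁻¹ • (x - y) := by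
  have habs := abs_signedDistTo I x
  have hne : signedDistTo I x ≠ 0 := abs_pos.1 (habs.symm ▸ hpos)
  refine eq_of_norm_le_one_of_inner_eq_one ?_ ?_ ?_
  · rw [gradient, LinearIsometryEquiv.norm_map]
    exact_mod_cast norm_fderiv_le_of_lipschitz ℝ (lipschitzWith_signedDistTo I)
  · rw [norm_smul, ← dist_eq_norm, hxy, norm_inv, Real.norm_eq_abs, habs,
      inv_mul_cancel₀ hpos.ne']
  · rw [inner_smul_right, gradient, InnerProductSpace.toDual_symm_apply,
      fderiv_signedDistTo_sub hy hxy hd, inv_mul_cancel₀ hne]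

lemma norm_gradient_signedDistTo (hI : IsCompact I) (hx : 0 < Metric.infDist x I)
    (hd : DifferentiableAt ℝ (signedDistTo I) x) : ‖gradient (signedDistTo I) x‖ = 1 := by
  have hne : I.Nonempty := nonempty_iff_ne_empty.2 fun h => by simp [h] at hx
  obtain ⟨y, hy, hxy⟩ := hI.exists_infDist_eq_dist hne x
  rw [gradient_signedDistTo hy hxy.symm hx hd, norm_smul, norm_inv, Real.norm_eq_abs,
    abs_signedDistTo, ← dist_eq_norm, ← hxy, inv_mul_cancel₀ hx.ne']

end SignedDistance

/-! ### Normal coordinates along a closed curve -/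

section NormalCoordinates

/-- A closed `C²` curve, parametrized regularly with period `1`. It may intersect itself. -/
structure IsRegularClosedCurve (γ : ℝ → Plane) : Prop where
  contDiff : ContDiff ℝ 2 γ
  periodic : Function.Periodic γ 1
  regular : ∀ t, deriv γ t ≠ 0

lemma IsSmoothSimpleClosedCurve.isRegularClosedCurve {γ : ℝ → Plane}
    (h : IsSmoothSimpleClosedCurve γ) : IsRegularClosedCurve γ where
  contDiff := h.smooth.of_le (by norm_cast)
  periodic := h.periodic
  regular := h.regular

instance : Fact (Module.finrank ℝ Plane = 2) := ⟨finrank_euclideanSpace_fin⟩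

/-- The rotation of the plane by a quarter turn. -/
def quarterTurn : Plane ≃ₗᵢ[ℝ] Plane :=
  (EuclideanSpace.basisFun (Fin 2) ℝ).toBasis.orientation.rightAngleRotation

/-- The unit normal to `γ` obtained by turning the tangent; it is defined without reference to
the enclosed region. -/
def unitNormal (γ : ℝ → Plane) (t : ℝ) : Plane := ‖deriv γ t‖⁻¹ • quarterTurn (deriv γ t)

/-- The normal coordinates `(t, r) ↦ γ(t) + r N(t)`. -/
def normalCoord (γ : ℝ → Plane) (p : ℝ × ℝ) : Plane := γ p.1 + p.2 • unitNormal γ p.1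

lemma inner_unitNormal_deriv (γ : ℝ → Plane) (t : ℝ) : ⟪unitNormal γ t, deriv γ t⟫ = 0 := by
  rw [unitNormal, inner_smul_left, quarterTurn, Orientation.inner_rightAngleRotation_self, mul_zero]

lemma exists_eq_smul_of_inner_eq_zero {v w e : Plane} (hw : w ≠ 0) (he : e ≠ 0) (hwe : ⟪w, e⟫ = 0)
    (hve : ⟪v, e⟫ = 0) : ∃ a : ℝ, v = a • w := by
  have hmem : ∀ z : Plane, ⟪z, e⟫ = 0 → z ∈ (ℝ ∙ e)ᗮ := fun z hz =>
    Submodule.mem_orthogonal_singleton_iff_inner_left.2 hz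
  have hfinrank : Fact (Module.finrank ℝ Plane = 1 + 1) := ⟨finrank_euclideanSpace_fin⟩
  obtain ⟨a, ha⟩ := exists_smul_eq_of_finrank_eq_one
    (Submodule.finrank_orthogonal_span_singleton (n := 1) he)
    (x := ⟨w, hmem w hwe⟩) (Subtype.coe_ne_coe.1 hw) ⟨v, hmem v hve⟩
  exact ⟨a, (congrArg Subtype.val ha).symm⟩

namespace IsRegularClosedCurve

variable {γ : ℝ → Plane}

lemma norm_unitNormal (h : IsRegularClosedCurve γ) (t : ℝ) : ‖unitNormal γ t‖ = 1 := by
  rw [unitNormal, norm_smul, norm_inv, norm_norm, LinearIsometryEquiv.norm_map,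
    inv_mul_cancel₀ (norm_ne_zero_iff.2 (h.regular t))]

lemma unitNormal_ne_zero (h : IsRegularClosedCurve γ) (t : ℝ) : unitNormal γ t ≠ 0 :=
  norm_ne_zero_iff.1 (by rw [h.norm_unitNormal]; exact one_ne_zero)

lemma inner_unitNormal_eq_zero (h : IsRegularClosedCurve γ) {t : ℝ} {ν w : Plane} (hν : ν ≠ 0)
    (hνt : ⟪ν, deriv γ t⟫ = 0) (hw : ⟪w, ν⟫ = 0) : ⟪w, unitNormal γ t⟫ = 0 := by
  obtain ⟨a, ha⟩ := exists_eq_smul_of_inner_eq_zero hν (h.regular t) hνt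
    (inner_unitNormal_deriv γ t)
  rw [ha, inner_smul_right, hw, mul_zero]

lemma contDiff_unitNormal (h : IsRegularClosedCurve γ) : ContDiff ℝ 1 (unitNormal γ) := by
  have hd : ContDiff ℝ 1 (deriv γ) :=
    (contDiff_succ_iff_deriv.1 (one_add_one_eq_two (R := WithTop ℕ∞) ▸ h.contDiff)).2.2
  exact ((hd.norm ℝ h.regular).inv fun t => norm_ne_zero_iff.2 (h.regular t)).smul
    (quarterTurn.contDiff.comp hd)

lemma contDiff_normalCoord (h : IsRegularClosedCurve γ) : ContDiff ℝ 1 (normalCoord γ) :=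
  ((h.contDiff.of_le one_le_two).comp contDiff_fst).add
    (contDiff_snd.smul (h.contDiff_unitNormal.comp contDiff_fst))

lemma isCompact_range (h : IsRegularClosedCurve γ) : IsCompact (range γ) :=
  h.periodic.compact_of_continuous one_ne_zero h.contDiff.continuous

lemma image_Ioc_eq_range (h : IsRegularClosedCurve γ) : γ '' Ioc 0 1 = range γ := by
  simpa using h.periodic.image_Ioc one_pos 0

lemma exists_normalCoord_eq (h : IsRegularClosedCurve γ) (x : Plane) :
    ∃ t ∈ Ioc (0 : ℝ) 1, ∃ r : ℝ, |r| = Metric.infDist x (range γ) ∧ normalCoord γ (t, r) = x := by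
  obtain ⟨y, hy, hxy⟩ := h.isCompact_range.exists_infDist_eq_dist (range_nonempty γ) x
  rw [← h.image_Ioc_eq_range] at hy
  obtain ⟨t, ht, rfl⟩ := hy
  have hd : HasDerivAt γ (deriv γ t) t :=
    (h.contDiff.differentiable two_ne_zero t).hasDerivAt
  have hmin : IsLocalMin (fun s => ‖x - γ s‖ ^ 2) t := Eventually.of_forall fun s => by
    have : ‖x - γ t‖ ≤ ‖x - γ s‖ := by
      rw [← dist_eq_norm, ← dist_eq_norm, ← hxy]
      exact Metric.infDist_le_dist_of_mem (mem_range_self s)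
    exact pow_le_pow_left₀ (norm_nonneg _) this 2
  have horth : ⟪x - γ t, deriv γ t⟫ = 0 := by
    have := hmin.hasDerivAt_eq_zero (hd.const_sub x).norm_sq
    rw [inner_neg_right] at this
    linarith
  obtain ⟨r, hr⟩ := exists_eq_smul_of_inner_eq_zero (h.unitNormal_ne_zero t) (h.regular t)
    (inner_unitNormal_deriv γ t) horth
  refine ⟨t, ht, r, ?_, ?_⟩
  · rw [hxy, dist_eq_norm, hr, norm_smul, h.norm_unitNormal, mul_one, Real.norm_eq_abs]
  · rw [normalCoord, ← hr, add_sub_cancel]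

lemma sq_inner_gradient_signedDistTo (h : IsRegularClosedCurve γ) {t r : ℝ}
    (hr : |r| = Metric.infDist (normalCoord γ (t, r)) (range γ)) (hr0 : r ≠ 0)
    (hd : DifferentiableAt ℝ (signedDistTo (range γ)) (normalCoord γ (t, r))) (v : Plane) :
    ⟪v, gradient (signedDistTo (range γ)) (normalCoord γ (t, r))⟫ ^ 2
      = ⟪v, unitNormal γ t⟫ ^ 2 := by
  have hsub : normalCoord γ (t, r) - γ t = r • unitNormal γ t := add_sub_cancel_left ..
  have hdist : dist (normalCoord γ (t, r)) (γ t)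
      = Metric.infDist (normalCoord γ (t, r)) (range γ) := by
    rw [dist_eq_norm, hsub, norm_smul, h.norm_unitNormal, mul_one, Real.norm_eq_abs, hr]
  have hsq : signedDistTo (range γ) (normalCoord γ (t, r)) ^ 2 = r ^ 2 := by
    rw [← sq_abs, abs_signedDistTo, ← hr, sq_abs]
  rw [gradient_signedDistTo (mem_range_self t) hdist (hr ▸ abs_pos.2 hr0) hd, hsub,
    inner_smul_right, inner_smul_right, mul_pow, mul_pow, inv_pow, hsq,
    inv_mul_cancel_left₀ (pow_ne_zero 2 hr0)]

end IsRegularClosedCurve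

end NormalCoordinates

/-! ### Comparison of integrals in normal coordinates -/

section Comparison

/-- The integrals over `A` and over `Φ(A)` are comparable up to the factor `C`, for all
measurable `A ⊆ U`. Both inequalities tolerate a map that covers its image several times. -/
def ComparableOn {α β : Type*} [MeasureSpace α] [MeasureSpace β] (Φ : α → β) (C : ℝ≥0)
    (U : Set α) : Prop :=
  ∀ A ⊆ U, MeasurableSet A → ∀ H : β → ℝ≥0∞,
    ∫⁻ x in Φ '' A, H x ≤ C * ∫⁻ p in A, H (Φ p) ∧ ∫⁻ p in A, H (Φ p) ≤ C * ∫⁻ x in Φ '' A, H x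

namespace ComparableOn

variable {α β β' : Type*} [MeasureSpace α] [MeasureSpace β] [MeasureSpace β'] {Φ : α → β}
  {C D : ℝ≥0} {U V : Set α}

lemma mono (h : ComparableOn Φ C U) (hVU : V ⊆ U) : ComparableOn Φ C V :=
  fun A hA => h A (hA.trans hVU)

lemma empty (Φ : α → β) : ComparableOn Φ 0 ∅ := by
  intro A hA _ H
  simp [subset_empty_iff.1 hA]

lemma union (hU : ComparableOn Φ C U) (hV : ComparableOn Φ D V) (hm : MeasurableSet U) :
    ComparableOn Φ (C + D) (U ∪ V) := by
  intro A hA hAm H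
  obtain ⟨hU₁, hU₂⟩ := hU (A ∩ U) inter_subset_right (hAm.inter hm) H
  obtain ⟨hV₁, hV₂⟩ := hV (A \ U) (fun x hx => (hA hx.1).resolve_left hx.2) (hAm.diff hm) H
  have hsplit : A = A ∩ U ∪ A \ U := (inter_union_sdiff A U).symm
  have himage : Φ '' A = Φ '' (A ∩ U) ∪ Φ '' (A \ U) := by rw [← image_union, ← hsplit]
  rw [ENNReal.coe_add, add_mul, add_mul]
  constructor
  · calc ∫⁻ x in Φ '' A, H x ≤ (∫⁻ x in Φ '' (A ∩ U), H x) + ∫⁻ x in Φ '' (A \ U), H x := by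
          rw [himage]
          exact lintegral_union_le _ _ _
      _ ≤ C * (∫⁻ p in A ∩ U, H (Φ p)) + D * ∫⁻ p in A \ U, H (Φ p) := add_le_add hU₁ hV₁
      _ ≤ C * (∫⁻ p in A, H (Φ p)) + D * ∫⁻ p in A, H (Φ p) := by
          gcongr
          exacts [inter_subset_left, sdiff_subset]
  · calc ∫⁻ p in A, H (Φ p) ≤ (∫⁻ p in A ∩ U, H (Φ p)) + ∫⁻ p in A \ U, H (Φ p) := by
          nth_rw 1 [hsplit]
          exact lintegral_union_le _ _ _
      _ ≤ C * (∫⁻ x in Φ '' (A ∩ U), H x) + D * ∫⁻ x in Φ '' (A \ U), H x := add_le_add hU₂ hV₂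
      _ ≤ C * (∫⁻ x in Φ '' A, H x) + D * ∫⁻ x in Φ '' A, H x := by
          gcongr
          exacts [inter_subset_left, sdiff_subset]

lemma of_comp {e : β ≃ᵐ β'} (he : MeasurePreserving e) (h : ComparableOn (e ∘ Φ) C U) :
    ComparableOn Φ C U := by
  intro A hA hAm H
  have htransfer : ∫⁻ y in (e ∘ Φ) '' A, H (e.symm y) = ∫⁻ x in Φ '' A, H x := by
    have := he.setLIntegral_comp_emb e.measurableEmbedding (fun y => H (e.symm y)) (Φ '' A)
    rw [← image_comp] at this
    simpa only [MeasurableEquiv.symm_apply_apply] using this.symm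
  have := h A hA hAm fun y => H (e.symm y)
  rw [htransfer] at this
  simpa only [Function.comp_apply, MeasurableEquiv.symm_apply_apply] using this

end ComparableOn

lemma comparableOn_of_det_bounds {E : Type*} [NormedAddCommGroup E] [NormedSpace ℝ E]
    [FiniteDimensional ℝ E] [MeasureSpace E] [BorelSpace E] [(volume : Measure E).IsAddHaarMeasure]
    {Ψ : E → E} (hΨ : Differentiable ℝ Ψ) {U : Set E} (hinj : InjOn Ψ U) {C : ℝ≥0}
    (hle : ∀ p ∈ U, ENNReal.ofReal |(fderiv ℝ Ψ p).det| ≤ C)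
    (hge : ∀ p ∈ U, 1 ≤ C * ENNReal.ofReal |(fderiv ℝ Ψ p).det|) : ComparableOn Ψ C U := by
  intro A hA hAm H
  rw [lintegral_image_eq_lintegral_abs_det_fderiv_mul volume hAm
    (fun p _ => (hΨ p).hasFDerivAt.hasFDerivWithinAt) (hinj.mono hA)]
  constructor
  · rw [← lintegral_const_mul' _ _ ENNReal.coe_ne_top]
    refine setLIntegral_mono' hAm fun p hp => ?_
    gcongr
    exact hle p (hA hp)
  · rw [← lintegral_const_mul' _ _ ENNReal.coe_ne_top]
    refine setLIntegral_mono' hAm fun p hp => ?_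
    rw [← mul_assoc]
    exact le_mul_of_one_le_left' (hge p (hA hp))

lemma exists_mem_nhds_comparableOn {E : Type*} [NormedAddCommGroup E] [NormedSpace ℝ E]
    [FiniteDimensional ℝ E] [MeasureSpace E] [BorelSpace E] [(volume : Measure E).IsAddHaarMeasure]
    {Ψ : E → E} (hΨ : ContDiff ℝ 1 Ψ) {a : E} (ha : Function.Injective (fderiv ℝ Ψ a)) :
    ∃ U ∈ 𝓝 a, ∃ C, ComparableOn Ψ C U := by
  let L : E ≃L[ℝ] E :=
    (LinearEquiv.ofInjectiveEndo (fderiv ℝ Ψ a).toLinearMap ha).toContinuousLinearEquiv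
  have hL : (L : E →L[ℝ] E) = fderiv ℝ Ψ a := rfl
  have hstrict : HasStrictFDerivAt Ψ (L : E →L[ℝ] E) a :=
    hL ▸ hΨ.contDiffAt.hasStrictFDerivAt one_ne_zero
  let R := hstrict.toOpenPartialHomeomorph Ψ
  have hR : R.source ∈ 𝓝 a :=
    R.open_source.mem_nhds hstrict.mem_toOpenPartialHomeomorph_source
  let J : E → ℝ := fun p => |(fderiv ℝ Ψ p).det|
  have hJ : Continuous J :=
    (ContinuousLinearMap.continuous_det.comp (hΨ.continuous_fderiv one_ne_zero)).abs
  have hJa : 0 < J a :=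
    abs_pos.2 (hL ▸ (LinearEquiv.isUnit_det' L.toLinearEquiv).ne_zero)
  have hbounds : ∀ᶠ p in 𝓝 a, J a / 2 < J p ∧ J p < 2 * J a :=
    (hJ.continuousAt.eventually (lt_mem_nhds (half_lt_self hJa))).and
      (hJ.continuousAt.eventually (gt_mem_nhds (by linarith)))
  have hinv : 0 < (J a / 2)⁻¹ := by positivity
  refine ⟨_, inter_mem hR hbounds, (2 * J a + (J a / 2)⁻¹).toNNReal,
    comparableOn_of_det_bounds (hΨ.differentiable one_ne_zero) (R.injOn.mono inter_subset_left)
      (fun p hp => ENNReal.ofReal_le_ofReal (by linarith [hp.2.2])) fun p hp => ?_⟩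
  change 1 ≤ ENNReal.ofReal _ * ENNReal.ofReal (J p)
  rw [← ENNReal.ofReal_mul (by positivity), ENNReal.one_le_ofReal]
  calc 1 = (J a / 2)⁻¹ * (J a / 2) := (inv_mul_cancel₀ (by positivity)).symm
    _ ≤ (2 * J a + (J a / 2)⁻¹) * J p := by
      have := hp.2.1.le
      gcongr
      linarith

/-- The plane as `ℝ × ℝ`. -/
def planeEquiv : Plane ≃L[ℝ] ℝ × ℝ :=
  (EuclideanSpace.equiv (Fin 2) ℝ).trans (ContinuousLinearEquiv.finTwoArrow ℝ ℝ)

lemma measurePreserving_planeEquiv : MeasurePreserving planeEquiv :=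
  (volume_preserving_finTwoArrow ℝ).comp (PiLp.volume_preserving_ofLp (Fin 2))

lemma exists_mem_nhds_comparableOn_plane {Φ : ℝ × ℝ → Plane} (hΦ : ContDiff ℝ 1 Φ) {a : ℝ × ℝ}
    (ha : Function.Injective (fderiv ℝ Φ a)) : ∃ U ∈ 𝓝 a, ∃ C, ComparableOn Φ C U := by
  have hfderiv : fderiv ℝ (planeEquiv ∘ Φ) a =
      (planeEquiv : Plane →L[ℝ] ℝ × ℝ).comp (fderiv ℝ Φ a) :=
    planeEquiv.comp_fderiv
  obtain ⟨U, hU, C, hC⟩ := exists_mem_nhds_comparableOn (planeEquiv.contDiff.comp hΦ) (a := a)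
    (by rw [hfderiv]; exact planeEquiv.injective.comp ha)
  exact ⟨U, hU, C, hC.of_comp (e := planeEquiv.toHomeomorph.toMeasurableEquiv)
    measurePreserving_planeEquiv⟩

lemma exists_mem_nhdsSet_comparableOn {Φ : ℝ × ℝ → Plane} (hΦ : ContDiff ℝ 1 Φ) {K : Set (ℝ × ℝ)}
    (hK : IsCompact K) (hinj : ∀ a ∈ K, Function.Injective (fderiv ℝ Φ a)) :
    ∃ U, IsOpen U ∧ K ⊆ U ∧ ∃ C, ComparableOn Φ C U := by
  refine hK.induction_on (p := fun K => ∃ U, IsOpen U ∧ K ⊆ U ∧ ∃ C, ComparableOn Φ C U)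
    ⟨∅, isOpen_empty, le_rfl, 0, .empty Φ⟩
    (fun s t hst ⟨U, hU, htU, hC⟩ => ⟨U, hU, hst.trans htU, hC⟩) ?_ fun a ha => ?_
  · rintro s t ⟨U, hU, hsU, C, hC⟩ ⟨V, hV, htV, D, hD⟩
    exact ⟨U ∪ V, hU.union hV, union_subset_union hsU htV, C + D, hC.union hD hU.measurableSet⟩
  · obtain ⟨U, hU, C, hC⟩ := exists_mem_nhds_comparableOn_plane hΦ (hinj a ha)
    obtain ⟨V, hVU, hV, haV⟩ := mem_nhds_iff.1 hU
    exact ⟨V, mem_nhdsWithin_of_mem_nhds (hV.mem_nhds haV), V, hV, le_rfl, C, hC.mono hVU⟩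

namespace IsRegularClosedCurve

variable {γ : ℝ → Plane}

lemma hasFDerivAt_normalCoord (h : IsRegularClosedCurve γ) (p : ℝ × ℝ) :
    HasFDerivAt (normalCoord γ) (fderiv ℝ (normalCoord γ) p) p :=
  (h.contDiff_normalCoord.differentiable one_ne_zero p).hasFDerivAt

lemma fderiv_normalCoord_snd (h : IsRegularClosedCurve γ) (t r : ℝ) :
    fderiv ℝ (normalCoord γ) (t, r) (0, 1) = unitNormal γ t := by
  have hline : HasDerivAt (fun s : ℝ => ((t, s) : ℝ × ℝ)) (0, 1) r :=
    (hasDerivAt_const r t).prodMk (hasDerivAt_id r)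
  refine ((h.hasFDerivAt_normalCoord (t, r)).comp_hasDerivAt r hline).unique ?_
  simpa [normalCoord, Function.comp_def] using
    ((hasDerivAt_id r).smul_const (unitNormal γ t)).const_add (γ t)

lemma fderiv_normalCoord_fst (h : IsRegularClosedCurve γ) (t : ℝ) :
    fderiv ℝ (normalCoord γ) (t, 0) (1, 0) = deriv γ t := by
  have hline : HasDerivAt (fun s : ℝ => ((s, 0) : ℝ × ℝ)) (1, 0) t :=
    (hasDerivAt_id t).prodMk (hasDerivAt_const t 0)
  have hchain := (h.hasFDerivAt_normalCoord (t, 0)).comp_hasDerivAt t hline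
  have hγ : (normalCoord γ ∘ fun s : ℝ => ((s, 0) : ℝ × ℝ)) = γ := by
    ext1 s
    simp only [Function.comp_apply, normalCoord, zero_smul, add_zero]
  rw [hγ] at hchain
  exact hchain.deriv.symm

lemma injective_fderiv_normalCoord (h : IsRegularClosedCurve γ) (t : ℝ) :
    Function.Injective (fderiv ℝ (normalCoord γ) (t, 0)) := by
  refine (injective_iff_map_eq_zero _).2 fun p hp => ?_
  have hbasis : p = p.1 • ((1, 0) : ℝ × ℝ) + p.2 • ((0, 1) : ℝ × ℝ) := by ext <;> simp
  rw [hbasis, map_add, map_smul, map_smul, h.fderiv_normalCoord_fst,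
    h.fderiv_normalCoord_snd] at hp
  have hnormal := congrArg (fun v => ⟪unitNormal γ t, v⟫) hp
  simp only [inner_add_right, inner_smul_right, inner_unitNormal_deriv, mul_zero, zero_add,
    real_inner_self_eq_norm_sq, h.norm_unitNormal, one_pow, mul_one, inner_zero_right] at hnormal
  rw [hnormal, zero_smul, add_zero] at hp
  exact Prod.ext ((smul_eq_zero.1 hp).resolve_right (h.regular t)) hnormal

lemma exists_comparableOn (h : IsRegularClosedCurve γ) :
    ∃ C : ℝ≥0, ∃ ρ : ℝ, 0 < ρ ∧ ComparableOn (normalCoord γ) C (Icc 0 1 ×ˢ Ioo (-ρ) ρ) := by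
  obtain ⟨U, hU, hKU, C, hC⟩ := exists_mem_nhdsSet_comparableOn h.contDiff_normalCoord
    ((isCompact_Icc (a := (0 : ℝ)) (b := 1)).prod isCompact_singleton)
    (by
      rintro ⟨t, r⟩ ⟨_, rfl : r = 0⟩
      exact h.injective_fderiv_normalCoord t)
  obtain ⟨S, T, -, hT, hS, h0, hST⟩ := generalized_tube_lemma isCompact_Icc
    (isCompact_singleton (x := (0 : ℝ))) hU hKU
  obtain ⟨ρ, hρ, hρT⟩ := Metric.isOpen_iff.1 hT 0 (h0 rfl)
  rw [Real.ball_eq_Ioo, zero_sub, zero_add] at hρT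
  exact ⟨C, ρ, hρ, hC.mono ((prod_mono hS hρT).trans hST)⟩

end IsRegularClosedCurve

end Comparison

/-! ### Trace estimates near the curve -/

section Trace

lemma ennreal_add_sq_le (a b : ℝ≥0∞) : (a + b) ^ 2 ≤ 2 * (a ^ 2 + b ^ 2) := by
  have := ENNReal.rpow_add_le_mul_rpow_add_rpow a b one_le_two
  norm_num at this
  exact_mod_cast this

lemma sq_lintegral_le {α : Type*} [MeasurableSpace α] {μ : Measure α} {b : α → ℝ≥0∞}
    (hb : AEMeasurable b μ) : (∫⁻ x, b x ∂μ) ^ 2 ≤ μ univ * ∫⁻ x, b x ^ 2 ∂μ := by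
  have hhölder := ENNReal.lintegral_mul_le_Lp_mul_Lq μ Real.HolderConjugate.two_two
    (aemeasurable_const (b := (1 : ℝ≥0∞))) hb
  simp only [Pi.mul_apply, one_mul, lintegral_const, ENNReal.rpow_two, one_pow] at hhölder
  have hsq : ∀ x : ℝ≥0∞, (x ^ (1 / 2 : ℝ)) ^ 2 = x := fun x => by
    rw [← ENNReal.rpow_two, ← ENNReal.rpow_mul, one_div_mul_cancel two_ne_zero, ENNReal.rpow_one]
  refine (pow_le_pow_left₀ zero_le hhölder 2).trans_eq ?_
  rw [mul_pow, hsq, hsq]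

lemma enorm_sub_sq_le {E : Type*} [NormedAddCommGroup E] [NormedSpace ℝ E] {V : ℝ → E}
    {b : ℝ → ℝ≥0∞} {ρ r : ℝ} (hr : |r| < ρ) (hV : ContDiffOn ℝ 1 V (Ioo (-ρ) ρ))
    (hb : Measurable b) (hVb : ∀ s ∈ Ioo (-ρ) ρ, ‖deriv V s‖ₑ ≤ b s) :
    ‖V r - V 0‖ₑ ^ 2 ≤ ENNReal.ofReal |r| * ∫⁻ s in Ioo (-ρ) ρ, b s ^ 2 := by
  have hρ : 0 < ρ := (abs_nonneg r).trans_lt hr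
  have hordered : ∀ x y : ℝ, -ρ < x → y < ρ → x ≤ y →
      ‖V y - V x‖ₑ ^ 2 ≤ ENNReal.ofReal (y - x) * ∫⁻ s in Ioo (-ρ) ρ, b s ^ 2 := by
    intro x y hx hy hxy
    have hsub : Icc x y ⊆ Ioo (-ρ) ρ := Icc_subset_Ioo hx hy
    calc ‖V y - V x‖ₑ ^ 2 ≤ (∫⁻ s in Icc x y, ‖deriv V s‖ₑ) ^ 2 := by
          gcongr
          exact enorm_sub_le_lintegral_deriv_of_contDiffOn_Icc (hV.mono hsub) hxy
      _ ≤ (∫⁻ s in Icc x y, b s) ^ 2 := by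
          gcongr 1
          exact setLIntegral_mono' measurableSet_Icc fun s hs => hVb s (hsub hs)
      _ ≤ ENNReal.ofReal (y - x) * ∫⁻ s in Icc x y, b s ^ 2 := by
          simpa only [Measure.restrict_apply_univ, Real.volume_Icc] using
            sq_lintegral_le (μ := volume.restrict (Icc x y)) hb.aemeasurable
      _ ≤ ENNReal.ofReal (y - x) * ∫⁻ s in Ioo (-ρ) ρ, b s ^ 2 := by gcongr
  rcases le_total 0 r with h | h
  · simpa only [abs_of_nonneg h, sub_zero] using
      hordered 0 r (neg_lt_zero.2 hρ) (abs_lt.1 hr).2 h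
  · simpa only [abs_of_nonpos h, zero_sub, ← enorm_neg (V 0 - V r), neg_sub] using
      hordered r 0 (abs_lt.1 hr).1 hρ h

/-- Parameters `(t, r)` in which `|r|` is the distance to the curve and the signed distance is
differentiable. They cover almost every point of the tube of radius `ρ`. -/
def goodCoord (γ : ℝ → Plane) (ρ : ℝ) : Set (ℝ × ℝ) :=
  (Ioc 0 1 ×ˢ Ioo (-ρ) ρ) ∩ {p | |p.2| = Metric.infDist (normalCoord γ p) (range γ) ∧ p.2 ≠ 0 ∧
    DifferentiableAt ℝ (signedDistTo (range γ)) (normalCoord γ p)}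

namespace IsRegularClosedCurve

variable {γ : ℝ → Plane}

lemma infDist_normalCoord_le (h : IsRegularClosedCurve γ) (t r : ℝ) :
    Metric.infDist (normalCoord γ (t, r)) (range γ) ≤ |r| := by
  refine (Metric.infDist_le_dist_of_mem (mem_range_self t)).trans_eq ?_
  rw [normalCoord, dist_eq_norm, add_sub_cancel_left, norm_smul, h.norm_unitNormal, mul_one,
    Real.norm_eq_abs]

lemma volume_range (h : IsRegularClosedCurve γ) : volume (range γ) = 0 := by
  obtain ⟨C, ρ, hρ, hC⟩ := h.exists_comparableOn
  have hle := (hC (Icc 0 1 ×ˢ {0}) (prod_mono_right (by simpa using hρ))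
    (measurableSet_Icc.prod (measurableSet_singleton 0)) (fun _ => 1)).1
  have hnull : volume (Icc (0 : ℝ) 1 ×ˢ ({0} : Set ℝ)) = 0 := by
    rw [Measure.volume_eq_prod, Measure.prod_prod, Real.volume_singleton, mul_zero]
  have hsub : range γ ⊆ normalCoord γ '' (Icc 0 1 ×ˢ {0}) := by
    rw [← h.image_Ioc_eq_range]
    rintro _ ⟨t, ht, rfl⟩
    exact ⟨(t, 0), ⟨Ioc_subset_Icc_self ht, rfl⟩, by simp [normalCoord]⟩
  refine measure_mono_null hsub (nonpos_iff_eq_zero.1 ?_)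
  simpa only [setLIntegral_one, hnull, mul_zero] using hle

lemma measurableSet_goodCoord (h : IsRegularClosedCurve γ) (ρ : ℝ) :
    MeasurableSet (goodCoord γ ρ) := by
  have hc := h.contDiff_normalCoord.continuous
  refine (measurableSet_Ioc.prod measurableSet_Ioo).inter (MeasurableSet.inter ?_
    (MeasurableSet.inter ?_ ?_))
  · exact measurableSet_eq_fun (by fun_prop)
      ((Metric.continuous_infDist_pt _).comp hc).measurable
  · exact (measurableSet_eq_fun measurable_snd measurable_const).compl
  · exact hc.measurable (measurableSet_of_differentiableAt ℝ _)

lemma ae_mem_image_goodCoord (h : IsRegularClosedCurve γ) (ρ : ℝ) :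
    ∀ᵐ x : Plane, Metric.infDist x (range γ) < ρ → x ∈ normalCoord γ '' goodCoord γ ρ := by
  filter_upwards [(lipschitzWith_signedDistTo (range γ)).ae_differentiableAt (μ := volume),
    compl_mem_ae_iff.2 h.volume_range] with x hdiff hoff hρ
  obtain ⟨t, ht, r, hr, rfl⟩ := h.exists_normalCoord_eq x
  refine ⟨(t, r), ⟨⟨ht, abs_lt.1 (hr ▸ hρ)⟩, hr, ?_, hdiff⟩, rfl⟩
  rintro (rfl : r = 0)
  exact hoff ⟨t, by simp [normalCoord]⟩

variable {C : ℝ≥0} {ρ : ℝ}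

lemma setLIntegral_near_le (h : IsRegularClosedCurve γ)
    (hC : ComparableOn (normalCoord γ) C (Icc 0 1 ×ˢ Ioo (-ρ) ρ)) {H : Plane → ℝ≥0∞}
    {F : ℝ × ℝ → ℝ≥0∞} (hHF : ∀ p ∈ goodCoord γ ρ, H (normalCoord γ p) ≤ F p) :
    ∫⁻ x in {x | Metric.infDist x (range γ) < ρ}, H x
      ≤ C * ∫⁻ p in Ioc 0 1 ×ˢ Ioo (-ρ) ρ, F p := by
  have hsub : goodCoord γ ρ ⊆ Ioc 0 1 ×ˢ Ioo (-ρ) ρ := inter_subset_left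
  calc ∫⁻ x in {x | Metric.infDist x (range γ) < ρ}, H x
      ≤ ∫⁻ x in normalCoord γ '' goodCoord γ ρ, H x :=
        lintegral_mono_set' (h.ae_mem_image_goodCoord ρ)
    _ ≤ C * ∫⁻ p in goodCoord γ ρ, H (normalCoord γ p) :=
        (hC _ (hsub.trans (prod_mono_left Ioc_subset_Icc_self)) (h.measurableSet_goodCoord ρ) H).1
    _ ≤ C * ∫⁻ p in goodCoord γ ρ, F p := by
        gcongr 1
        exact setLIntegral_mono' (h.measurableSet_goodCoord ρ) hHF
    _ ≤ C * ∫⁻ p in Ioc 0 1 ×ˢ Ioo (-ρ) ρ, F p := by gcongr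

lemma setLIntegral_infDist_le (h : IsRegularClosedCurve γ)
    (hC : ComparableOn (normalCoord γ) C (Icc 0 1 ×ˢ Ioo (-ρ) ρ)) {k : ℝ → ℝ≥0∞}
    (hk : Measurable k) :
    ∫⁻ x in {x | Metric.infDist x (range γ) < ρ}, k (Metric.infDist x (range γ))
      ≤ C * ∫⁻ r in Ioo (-ρ) ρ, k |r| := by
  refine (h.setLIntegral_near_le hC (F := fun p => k |p.2|) fun p hp => by rw [← hp.2.1]).trans ?_
  gcongr 1
  rw [Measure.volume_eq_prod, setLIntegral_prod _ (by fun_prop)]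
  simp

variable {Ω : Set Plane} {v : Plane → Plane}

lemma normalCoord_mem (h : IsRegularClosedCurve γ)
    (hΩ : ∀ x, Metric.infDist x (range γ) < ρ → x ∈ Ω) (t : ℝ) {s : ℝ} (hs : s ∈ Ioo (-ρ) ρ) :
    normalCoord γ (t, s) ∈ Ω :=
  hΩ _ ((h.infDist_normalCoord_le t s).trans_lt (abs_lt.2 hs))

lemma enorm_sub_normalCoord_sq_le (h : IsRegularClosedCurve γ) (hΩo : IsOpen Ω)
    (hΩ : ∀ x, Metric.infDist x (range γ) < ρ → x ∈ Ω) (hv : ContDiffOn ℝ 1 v Ω) (t : ℝ) {r : ℝ}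
    (hr : |r| < ρ) :
    ‖v (normalCoord γ (t, r)) - v (γ t)‖ₑ ^ 2 ≤
      ENNReal.ofReal |r| * ∫⁻ s in Ioo (-ρ) ρ, ‖fderiv ℝ v (normalCoord γ (t, s))‖ₑ ^ 2 := by
  have hline : ContDiff ℝ 1 fun s => normalCoord γ (t, s) :=
    h.contDiff_normalCoord.comp (contDiff_const.prodMk contDiff_id)
  have hderiv : ∀ s ∈ Ioo (-ρ) ρ, deriv (fun s => v (normalCoord γ (t, s))) s
      = fderiv ℝ v (normalCoord γ (t, s)) (unitNormal γ t) := fun s hs => by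
    have hvd := ((hv.contDiffAt (hΩo.mem_nhds (h.normalCoord_mem hΩ t hs))).differentiableAt
      one_ne_zero).hasFDerivAt
    have hpath : HasDerivAt (fun s => normalCoord γ (t, s)) (unitNormal γ t) s := by
      simpa [normalCoord] using ((hasDerivAt_id s).smul_const (unitNormal γ t)).const_add (γ t)
    exact (hvd.comp_hasDerivAt s hpath).deriv
  have hmeas : Measurable fun s => ‖fderiv ℝ v (normalCoord γ (t, s))‖ₑ :=
    ((measurable_fderiv ℝ v).comp hline.continuous.measurable).enorm
  have hdiff := enorm_sub_sq_le (V := fun s => v (normalCoord γ (t, s))) hr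
    (hv.comp hline.contDiffOn fun s hs => h.normalCoord_mem hΩ t hs) hmeas fun s hs => by
      rw [hderiv s hs, enorm_le_iff_norm_le]
      simpa only [h.norm_unitNormal, mul_one] using
        (fderiv ℝ v (normalCoord γ (t, s))).le_opNorm (unitNormal γ t)
  simpa only [normalCoord, zero_smul, add_zero] using hdiff

lemma enorm_inner_gradient_sq_le (h : IsRegularClosedCurve γ) {p : ℝ × ℝ}
    (hp : p ∈ goodCoord γ ρ) (v : Plane → Plane) :
    ‖⟪v (normalCoord γ p), gradient (signedDistTo (range γ)) (normalCoord γ p)⟫‖ₑ ^ 2 ≤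
      2 * (‖⟪v (γ p.1), unitNormal γ p.1⟫‖ₑ ^ 2 + ‖v (normalCoord γ p) - v (γ p.1)‖ₑ ^ 2) := by
  obtain ⟨t, r⟩ := p
  obtain ⟨-, hrd, hr0, hd⟩ := hp
  rw [← enorm_pow, h.sq_inner_gradient_signedDistTo hrd hr0 hd, enorm_pow]
  refine le_trans ?_ (ennreal_add_sq_le _ _)
  have hsplit : ⟪v (normalCoord γ (t, r)), unitNormal γ t⟫ =
      ⟪v (γ t), unitNormal γ t⟫ + ⟪v (normalCoord γ (t, r)) - v (γ t), unitNormal γ t⟫ := by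
    rw [← inner_add_left, add_sub_cancel]
  rw [hsplit]
  gcongr
  refine (enorm_add_le _ _).trans ?_
  gcongr
  rw [enorm_le_iff_norm_le]
  simpa only [h.norm_unitNormal, mul_one] using
    norm_inner_le_norm (𝕜 := ℝ) (v (normalCoord γ (t, r)) - v (γ t)) (unitNormal γ t)

lemma setLIntegral_fderiv_normalCoord_le (h : IsRegularClosedCurve γ)
    (hC : ComparableOn (normalCoord γ) C (Icc 0 1 ×ˢ Ioo (-ρ) ρ))
    (hΩ : ∀ x, Metric.infDist x (range γ) < ρ → x ∈ Ω) (v : Plane → Plane) :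
    ∫⁻ p in Ioc 0 1 ×ˢ Ioo (-ρ) ρ, ‖fderiv ℝ v (normalCoord γ p)‖ₑ ^ 2
      ≤ C * ∫⁻ x in Ω, ‖fderiv ℝ v x‖ₑ ^ 2 := by
  refine (hC _ (prod_mono_left Ioc_subset_Icc_self) (measurableSet_Ioc.prod measurableSet_Ioo)
    fun x => ‖fderiv ℝ v x‖ₑ ^ 2).2.trans ?_
  gcongr
  rintro _ ⟨⟨t, s⟩, ⟨-, hs⟩, rfl⟩
  exact h.normalCoord_mem hΩ t hs

lemma setLIntegral_inner_gradient_le (h : IsRegularClosedCurve γ)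
    (hC : ComparableOn (normalCoord γ) C (Icc 0 1 ×ˢ Ioo (-ρ) ρ)) (hρ : 0 < ρ) {k : ℝ → ℝ≥0∞}
    (hk : Measurable k) (hΩo : IsOpen Ω) (hΩ : ∀ x, Metric.infDist x (range γ) < ρ → x ∈ Ω)
    (hv : ContDiffOn ℝ 1 v Ω) :
    ∫⁻ x in {x | Metric.infDist x (range γ) < ρ},
        k (Metric.infDist x (range γ)) * ‖⟪v x, gradient (signedDistTo (range γ)) x⟫‖ₑ ^ 2
      ≤ 2 * C * (∫⁻ r in Ioo (-ρ) ρ, k |r|)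
          * (∫⁻ t in Ioc (0 : ℝ) 1, ‖⟪v (γ t), unitNormal γ t⟫‖ₑ ^ 2)
        + 2 * C ^ 2 * (∫⁻ r in Ioo (-ρ) ρ, k |r| * ENNReal.ofReal |r|)
          * ∫⁻ x in Ω, ‖fderiv ℝ v x‖ₑ ^ 2 := by
  let Q : ℝ → ℝ≥0∞ := fun t => ‖⟪v (γ t), unitNormal γ t⟫‖ₑ ^ 2
  let b : ℝ × ℝ → ℝ≥0∞ := fun p => ‖fderiv ℝ v (normalCoord γ p)‖ₑ ^ 2
  let B : ℝ → ℝ≥0∞ := fun t => ∫⁻ s in Ioo (-ρ) ρ, b (t, s)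
  have hQ : Measurable Q := by
    have hvγ : Continuous fun t => v (γ t) :=
      hv.continuousOn.comp_continuous h.contDiff.continuous fun t => by
        simpa [normalCoord] using h.normalCoord_mem hΩ t ⟨neg_lt_zero.2 hρ, hρ⟩
    exact (hvγ.inner h.contDiff_unitNormal.continuous).measurable.enorm.pow_const 2
  have hb : Measurable b := ((measurable_fderiv ℝ v).comp
    h.contDiff_normalCoord.continuous.measurable).enorm.pow_const 2
  have hB : Measurable B := hb.lintegral_prod_right'
  have hkabs : Measurable fun r : ℝ => k |r| := hk.comp measurable_id.abs
  have hkabs' : Measurable fun r : ℝ => k |r| * ENNReal.ofReal |r| := hkabs.mul (by fun_prop)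
  have hBint : ∫⁻ t in Ioc (0 : ℝ) 1, B t ≤ C * ∫⁻ x in Ω, ‖fderiv ℝ v x‖ₑ ^ 2 := by
    rw [← setLIntegral_prod _ hb.aemeasurable.restrict, ← Measure.volume_eq_prod]
    exact h.setLIntegral_fderiv_normalCoord_le hC hΩ v
  refine (h.setLIntegral_near_le hC (F := fun p => 2 * (Q p.1 * k |p.2|) +
    2 * (B p.1 * (k |p.2| * ENNReal.ofReal |p.2|))) ?_).trans ?_
  · rintro ⟨t, r⟩ hp
    have hdiff := h.enorm_sub_normalCoord_sq_le hΩo hΩ hv t (abs_lt.2 hp.1.2)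
    rw [← hp.2.1]
    calc k |r| * _ ≤ k |r| * (2 * (Q t + ENNReal.ofReal |r| * B t)) := by
          gcongr
          refine (h.enorm_inner_gradient_sq_le hp v).trans ?_
          gcongr
      _ = 2 * (Q t * k |r|) + 2 * (B t * (k |r| * ENNReal.ofReal |r|)) := by ring
  · rw [Measure.volume_eq_prod, ← Measure.prod_restrict, lintegral_add_left (by fun_prop),
      lintegral_const_mul _ (by fun_prop), lintegral_const_mul _ (by fun_prop),
      lintegral_prod_mul hQ.aemeasurable hkabs.aemeasurable,
      lintegral_prod_mul hB.aemeasurable hkabs'.aemeasurable]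
    calc _ ≤ (C : ℝ≥0∞) * (2 * ((∫⁻ t in Ioc (0 : ℝ) 1, Q t) * ∫⁻ r in Ioo (-ρ) ρ, k |r|)
          + 2 * ((C * ∫⁻ x in Ω, ‖fderiv ℝ v x‖ₑ ^ 2)
            * ∫⁻ r in Ioo (-ρ) ρ, k |r| * ENNReal.ofReal |r|)) := by gcongr
      _ = _ := by ring

end IsRegularClosedCurve

end Trace

/-! ### Weak gradients -/

section WeakGradient

section Uniqueness

variable {V : Type*} [NormedAddCommGroup V] [NormedSpace ℝ V] {Ω : Set Plane} {φ : Plane → ℝ}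

lemma setIntegral_smul_eq_integral (hφΩ : tsupport φ ⊆ Ω) (F : Plane → V) :
    ∫ x in Ω, φ x • F x = ∫ x, φ x • F x :=
  setIntegral_eq_integral_of_forall_compl_eq_zero fun x hx => by
    rw [image_eq_zero_of_notMem_tsupport fun hx' => hx (hφΩ hx'), zero_smul]

lemma integrable_smul_of_locallyIntegrableOn {F : Plane → V} (hF : LocallyIntegrableOn F Ω)
    (hφ : Continuous φ) (hφc : HasCompactSupport φ) (hφΩ : tsupport φ ⊆ Ω) :
    Integrable fun x => φ x • F x := by
  have hcpt : IntegrableOn (fun x => φ x • F x) (tsupport φ) :=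
    (hF.integrableOn_compact_subset hφΩ hφc).continuousOn_smul hφ.continuousOn hφc
  refine (integrableOn_iff_integrable_of_support_subset fun x hx => ?_).1 hcpt
  exact subset_tsupport φ fun h0 => hx (by simp only [h0, zero_smul])

lemma integrable_fderiv_smul_of_locallyIntegrableOn {F : Plane → V}
    (hF : LocallyIntegrableOn F Ω) (hφ : ContDiff ℝ ∞ φ) (hφc : HasCompactSupport φ)
    (hφΩ : tsupport φ ⊆ Ω) (e : Plane) : Integrable fun x => fderiv ℝ φ x e • F x :=
  integrable_smul_of_locallyIntegrableOn hF
    ((hφ.continuous_fderiv (by simp)).clm_apply continuous_const) (hφc.fderiv_apply (𝕜 := ℝ) e)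
    ((tsupport_fderiv_apply_subset ℝ e).trans hφΩ)

lemma locallyIntegrableOn_clm_apply {G : Plane → Plane →L[ℝ] V} (hG : LocallyIntegrableOn G Ω)
    (e : Plane) : LocallyIntegrableOn (fun x => G x e) Ω := fun x hx => by
  obtain ⟨s, hs, hi⟩ := hG x hx
  exact ⟨s, hs, (ContinuousLinearMap.apply ℝ V e).integrable_comp hi⟩

lemma clm_ext_plane {A B : Plane →L[ℝ] V}
    (h : ∀ i : Fin 2, A (EuclideanSpace.single i 1) = B (EuclideanSpace.single i 1)) : A = B :=
  ContinuousLinearMap.coe_injective <|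
    (EuclideanSpace.basisFun (Fin 2) ℝ).toBasis.ext fun i => by simpa using h i

namespace IsWeakGrad

variable {u u' : Plane → V} {G G' : Plane → Plane →L[ℝ] V}

lemma ae_eq [CompleteSpace V] (hΩ : IsOpen Ω) (h : IsWeakGrad Ω u G) (h' : IsWeakGrad Ω u G') :
    G =ᵐ[volume.restrict Ω] G' := by
  have happly : ∀ e : Plane, ∀ᵐ x, x ∈ Ω → G x e - G' x e = 0 := fun e => by
    have hl := locallyIntegrableOn_clm_apply h.2.1 e
    have hl' := locallyIntegrableOn_clm_apply h'.2.1 e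
    refine hΩ.ae_eq_zero_of_integral_contDiff_smul_eq_zero (hl.sub hl') fun φ hφ hφc hφΩ => ?_
    have hparts := (h.2.2 φ hφ hφc hφΩ e).symm.trans (h'.2.2 φ hφ hφc hφΩ e)
    rw [neg_inj, setIntegral_smul_eq_integral hφΩ, setIntegral_smul_eq_integral hφΩ] at hparts
    simp only [smul_sub]
    rw [integral_sub (integrable_smul_of_locallyIntegrableOn hl hφ.continuous hφc hφΩ)
      (integrable_smul_of_locallyIntegrableOn hl' hφ.continuous hφc hφΩ), hparts, sub_self]
  refine (ae_restrict_iff' hΩ.measurableSet).2 ?_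
  filter_upwards [happly (EuclideanSpace.single 0 1), happly (EuclideanSpace.single 1 1)]
    with x h0 h1 hx
  exact clm_ext_plane (Fin.forall_fin_two.2 ⟨sub_eq_zero.1 (h0 hx), sub_eq_zero.1 (h1 hx)⟩)

lemma weakGrad_ae_eq [CompleteSpace V] (hΩ : IsOpen Ω) (h : IsWeakGrad Ω u G) :
    weakGrad Ω u =ᵐ[volume.restrict Ω] G := by
  have hex : ∃ G : Plane → Plane →L[ℝ] V, IsWeakGrad Ω u G := ⟨G, h⟩
  rw [weakGrad, dif_pos hex]
  exact hex.choose_spec.ae_eq hΩ h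

lemma congr_ae (h : IsWeakGrad Ω u G) (hu : u =ᵐ[volume.restrict Ω] u')
    (hG : G =ᵐ[volume.restrict Ω] G') : IsWeakGrad Ω u' G' := by
  refine ⟨(locallyIntegrableOn_congr hu).1 h.1, (locallyIntegrableOn_congr hG).1 h.2.1,
    fun φ hφ hφc hφΩ e => ?_⟩
  rw [← integral_congr_ae (hu.mono fun x hx => congrArg (fderiv ℝ φ x e • ·) hx),
    ← integral_congr_ae (hG.mono fun x hx => congrArg (fun A => φ x • A e) hx)]
  exact h.2.2 φ hφ hφc hφΩ e

end IsWeakGrad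

lemma MemH1.memLp_weakGrad [CompleteSpace V] (hΩ : IsOpen Ω) {u : Plane → V} (h : MemH1 Ω u) :
    MemLp (weakGrad Ω u) 2 (volume.restrict Ω) := by
  obtain ⟨-, G, hG, hG2⟩ := h
  exact (memLp_congr_ae (hG.weakGrad_ae_eq hΩ)).2 hG2

lemma isWeakGrad_of_lipschitzWith (Ω : Set Plane) {a : Plane → ℝ} {K : ℝ≥0}
    (ha : LipschitzWith K a) : IsWeakGrad Ω a (fderiv ℝ a) := by
  refine ⟨ha.continuous.locallyIntegrable.locallyIntegrableOn Ω, ?_, fun φ hφ hφc hφΩ e => ?_⟩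
  · have hbdd : MemLp (fderiv ℝ a) ∞ := memLp_top_of_bound
      (measurable_fderiv ℝ a).aestronglyMeasurable K
      (ae_of_all _ fun x => norm_fderiv_le_of_lipschitz ℝ ha)
    exact (hbdd.locallyIntegrable le_top).locallyIntegrableOn Ω
  · obtain ⟨L, hL⟩ := hφ.lipschitzWith_of_hasCompactSupport hφc (by simp)
    have hderiv : tsupport (fun x => fderiv ℝ φ x e) ⊆ Ω :=
      (tsupport_fderiv_apply_subset ℝ e).trans hφΩ
    have ha' : ∀ᵐ x, φ x • fderiv ℝ a x e = lineDeriv ℝ a x e * φ x := by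
      filter_upwards [ha.ae_differentiableAt (μ := volume)] with x hx
      rw [hx.lineDeriv_eq_fderiv, smul_eq_mul, mul_comm]
    rw [setIntegral_smul_eq_integral hderiv, setIntegral_smul_eq_integral hφΩ,
      integral_congr_ae ha', ha.integral_lineDeriv_mul_eq hL hφc e, ← integral_neg]
    refine integral_congr_ae (ae_of_all _ fun x => ?_)
    simp only [smul_eq_mul, (hφ.differentiable (by simp) x).lineDeriv_eq_fderiv, map_neg, neg_mul,
      neg_neg]

end Uniqueness

section Product

variable {V : Type*} [NormedAddCommGroup V] [InnerProductSpace ℝ V] {Ω : Set Plane}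
  {a : Plane → ℝ} {A : Plane → Plane →L[ℝ] ℝ} {w : Plane → V}

lemma contDiff_mul_of_tsupport_subset (hΩ : IsOpen Ω) {φ w : Plane → ℝ} (hφ : ContDiff ℝ ∞ φ)
    (hφΩ : tsupport φ ⊆ Ω) (hw : ContDiffOn ℝ ∞ w Ω) : ContDiff ℝ ∞ fun x => φ x * w x :=
  contDiff_iff_contDiffAt.2 fun x => by
    by_cases hx : x ∈ tsupport φ
    · exact hφ.contDiffAt.mul (hw.contDiffAt (hΩ.mem_nhds (hφΩ hx)))
    · refine (contDiffAt_const (c := (0 : ℝ))).congr_of_eventuallyEq ?_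
      filter_upwards [notMem_tsupport_iff_eventuallyEq.1 hx] with y hy
      rw [hy, Pi.zero_apply, zero_mul]

lemma locallyIntegrableOn_bilin {E F W : Type*} [NormedAddCommGroup E] [NormedSpace ℝ E]
    [NormedAddCommGroup F] [NormedSpace ℝ F] [NormedAddCommGroup W] [NormedSpace ℝ W]
    (B : E →L[ℝ] F →L[ℝ] W) (hΩ : IsOpen Ω) {f : Plane → E} {g : Plane → F}
    (hf : LocallyIntegrableOn f Ω) (hg : ContinuousOn g Ω) :
    LocallyIntegrableOn (fun x => B (f x) (g x)) Ω := by
  refine (locallyIntegrableOn_iff hΩ.isLocallyClosed).2 fun k hkΩ hk => ?_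
  obtain ⟨C, hC⟩ := hk.exists_bound_of_continuousOn (hg.mono hkΩ)
  exact B.flip.integrable_of_bilin_of_bdd_left C
    ((hg.mono hkΩ).aestronglyMeasurable hk.measurableSet)
    (ae_restrict_of_forall_mem hk.measurableSet hC) (hf.integrableOn_compact_subset hkΩ hk)

lemma IsWeakGrad.smul_contDiffOn [CompleteSpace V] (hΩ : IsOpen Ω) (h : IsWeakGrad Ω a A)
    (hw : ContDiffOn ℝ ∞ w Ω) :
    IsWeakGrad Ω (fun x => a x • w x) (fun x => a x • fderiv ℝ w x + (A x).smulRight (w x)) := by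
  have haw := locallyIntegrableOn_bilin (ContinuousLinearMap.lsmul ℝ ℝ) hΩ h.1 hw.continuousOn
  have hG := (locallyIntegrableOn_bilin (ContinuousLinearMap.lsmul ℝ ℝ) hΩ h.1
    (hw.continuousOn_fderiv_of_isOpen hΩ (by simp))).add (locallyIntegrableOn_bilin
    (ContinuousLinearMap.smulRightL ℝ Plane V) hΩ h.2.1 hw.continuousOn)
  refine ⟨haw, hG, fun φ hφ hφc hφΩ e => ?_⟩
  have hint :=
    (integrable_fderiv_smul_of_locallyIntegrableOn haw hφ hφc hφΩ e).integrableOn (s := Ω)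
  have hint' := (integrable_smul_of_locallyIntegrableOn (locallyIntegrableOn_clm_apply hG e)
    hφ.continuous hφc hφΩ).integrableOn (s := Ω)
  refine eq_neg_iff_add_eq_zero.2 ?_
  refine (integral_add hint hint').symm.trans (ext_inner_left ℝ fun c => ?_)
  let ψ : Plane → ℝ := fun x => φ x * ⟪c, w x⟫
  have hψ : ContDiff ℝ ∞ ψ :=
    contDiff_mul_of_tsupport_subset hΩ hφ hφΩ (contDiffOn_const.inner ℝ hw)
  have hψc : HasCompactSupport ψ := hφc.mul_right
  have hψΩ : tsupport ψ ⊆ Ω := tsupport_mul_subset_left.trans hφΩ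
  have hparts := h.2.2 ψ hψ hψc hψΩ e
  rw [eq_neg_iff_add_eq_zero, ← integral_add
    (integrable_fderiv_smul_of_locallyIntegrableOn h.1 hψ hψc hψΩ e).integrableOn
    (integrable_smul_of_locallyIntegrableOn (locallyIntegrableOn_clm_apply h.2.1 e)
      hψ.continuous hψc hψΩ).integrableOn] at hparts
  refine (integral_inner (hint.add hint') c).symm.trans
    (Eq.trans ?_ (hparts.trans (inner_zero_right c).symm))
  refine setIntegral_congr_fun hΩ.measurableSet fun x hx => ?_
  have hwd : DifferentiableAt ℝ w x :=
    (hw.contDiffAt (hΩ.mem_nhds hx)).differentiableAt (by simp)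
  have hψx : fderiv ℝ ψ x e = φ x * ⟪c, fderiv ℝ w x e⟫ + ⟪c, w x⟫ * fderiv ℝ φ x e := by
    have := (hφ.differentiable (by simp) x).hasFDerivAt.mul
      ((hasFDerivAt_const c x).inner ℝ hwd.hasFDerivAt)
    rw [show fderiv ℝ ψ x = _ from this.fderiv]
    simp
  simp [hψx, ψ, inner_add_right, inner_smul_right]
  ring

lemma isWeakGrad_fderiv [CompleteSpace V] (hΩ : IsOpen Ω) (hw : ContDiffOn ℝ ∞ w Ω) :
    IsWeakGrad Ω w (fderiv ℝ w) := by
  simpa using (isWeakGrad_of_lipschitzWith Ω (LipschitzWith.const (1 : ℝ))).smul_contDiffOn hΩ hw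

end Product

section Limit

variable {α : Type*} [MeasurableSpace α] {μ : Measure α}

lemma tendsto_integral_bdd_smul {E : Type*} [NormedAddCommGroup E] [NormedSpace ℝ E]
    {F : ℕ → α → E} {f : α → E} {m : α → ℝ} {B : ℝ} (hm : AEStronglyMeasurable m μ)
    (hB : ∀ x, ‖m x‖ ≤ B) (hF : ∀ k, Integrable (F k) μ) (hf : Integrable f μ)
    (hFf : Tendsto (fun k => eLpNorm (F k - f) 1 μ) atTop (𝓝 0)) :
    Tendsto (fun k => ∫ x, m x • F k x ∂μ) atTop (𝓝 (∫ x, m x • f x ∂μ)) := by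
  refine tendsto_integral_of_L1' _ (hm.smul hf.1)
    (.of_forall fun k => (hF k).bdd_smul B hm (ae_of_all _ hB)) ?_
  have hB0 : Tendsto (fun k => ENNReal.ofReal B * eLpNorm (F k - f) 1 μ) atTop (𝓝 0) := by
    simpa only [mul_zero] using ENNReal.Tendsto.const_mul hFf (.inr ENNReal.ofReal_ne_top)
  refine tendsto_of_tendsto_of_tendsto_of_le_of_le tendsto_const_nhds hB0 (fun _ => zero_le)
    fun k => eLpNorm_le_mul_eLpNorm_of_ae_le_mul (ae_of_all _ fun x => ?_) 1
  change ‖m x • F k x - m x • f x‖ ≤ B * ‖F k x - f x‖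
  rw [← smul_sub, norm_smul]
  exact mul_le_mul_of_nonneg_right (hB x) (norm_nonneg _)

lemma integrable_bilin {E F G : Type*} [NormedAddCommGroup E] [NormedSpace ℝ E]
    [NormedAddCommGroup F] [NormedSpace ℝ F] [NormedAddCommGroup G] [NormedSpace ℝ G]
    (B : E →L[ℝ] F →L[ℝ] G) {u : α → E} {w : α → F} (hu : MemLp u 2 μ) (hw : MemLp w 2 μ) :
    Integrable (fun x => B (u x) (w x)) μ :=
  memLp_one_iff_integrable.1 (B.memLp_of_bilin 1 hu hw)

lemma tendsto_eLpNorm_sub_self {E : Type*} [NormedAddCommGroup E] (f : α → E) (p : ℝ≥0∞) :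
    Tendsto (fun _ : ℕ => eLpNorm (f - f) p μ) atTop (𝓝 0) := by
  simp

lemma tendsto_eLpNorm_bilin {E F G : Type*} [NormedAddCommGroup E] [NormedSpace ℝ E]
    [NormedAddCommGroup F] [NormedSpace ℝ F] [NormedAddCommGroup G] [NormedSpace ℝ G]
    (B : E →L[ℝ] F →L[ℝ] G) {U : ℕ → α → E} {u : α → E} {W : ℕ → α → F} {w : α → F}
    (hU : ∀ k, MemLp (U k) 2 μ) (hu : MemLp u 2 μ) (hW : ∀ k, MemLp (W k) 2 μ) (hw : MemLp w 2 μ)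
    (hUu : Tendsto (fun k => eLpNorm (U k - u) 2 μ) atTop (𝓝 0))
    (hWw : Tendsto (fun k => eLpNorm (W k - w) 2 μ) atTop (𝓝 0)) :
    Tendsto (fun k => eLpNorm ((fun x => B (U k x) (W k x)) - fun x => B (u x) (w x)) 1 μ)
      atTop (𝓝 0) := by
  have htoLp : ∀ (p : α → E) (q : α → F) (hp : MemLp p 2 μ) (hq : MemLp q 2 μ),
      B.holderL μ 2 2 1 (hp.toLp p) (hq.toLp q) = (B.memLp_of_bilin 1 hp hq).toLp _ :=
    fun p q hp hq => MemLp.toLp_congr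
      (B.memLp_of_bilin 1 (Lp.memLp (hp.toLp p)) (Lp.memLp (hq.toLp q)))
      (B.memLp_of_bilin 1 hp hq) <| by
      filter_upwards [hp.coeFn_toLp, hq.coeFn_toLp] with x hpx hqx
      rw [hpx, hqx]
  have hlim := ((B.holderL μ 2 2 1).continuous₂.tendsto _).comp
    (((Lp.tendsto_Lp_iff_tendsto_eLpNorm'' U hU u hu).2 hUu).prodMk_nhds
      ((Lp.tendsto_Lp_iff_tendsto_eLpNorm'' W hW w hw).2 hWw))
  simp only [Function.comp_def, Function.uncurry_apply_pair, htoLp] at hlim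
  exact (Lp.tendsto_Lp_iff_tendsto_eLpNorm'' _ (fun k => B.memLp_of_bilin 1 (hU k) (hW k)) _
    (B.memLp_of_bilin 1 hu hw)).1 hlim

lemma tendsto_eLpNorm_one_add {E : Type*} [NormedAddCommGroup E] {F H : ℕ → α → E} {f h : α → E}
    (hF : ∀ k, Integrable (F k) μ) (hf : Integrable f μ) (hH : ∀ k, Integrable (H k) μ)
    (hh : Integrable h μ) (hFf : Tendsto (fun k => eLpNorm (F k - f) 1 μ) atTop (𝓝 0))
    (hHh : Tendsto (fun k => eLpNorm (H k - h) 1 μ) atTop (𝓝 0)) :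
    Tendsto (fun k => eLpNorm ((fun x => F k x + H k x) - fun x => f x + h x) 1 μ)
      atTop (𝓝 0) := by
  have hsum := hFf.add hHh
  rw [add_zero] at hsum
  refine tendsto_of_tendsto_of_tendsto_of_le_of_le tendsto_const_nhds hsum (fun _ => zero_le)
    fun k => ?_
  have hsplit : ((fun x => F k x + H k x) - fun x => f x + h x) = (F k - f) + (H k - h) :=
    add_sub_add_comm (F k) (H k) f h
  simpa only [hsplit] using eLpNorm_add_le ((hF k).sub hf).1 ((hH k).sub hh).1 le_rfl

section ProductRule

variable {E F : Type*} [NormedAddCommGroup E] [NormedSpace ℝ E] [NormedAddCommGroup F]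
  [NormedSpace ℝ F] {a : α → ℝ} {A : α → E →L[ℝ] ℝ}

lemma integrable_smul_add_smulRight (ha : MemLp a 2 μ) (hA : MemLp A 2 μ) {u : α → F}
    {G : α → E →L[ℝ] F} (hu : MemLp u 2 μ) (hG : MemLp G 2 μ) :
    Integrable (fun x => a x • G x + (A x).smulRight (u x)) μ :=
  (integrable_bilin (ContinuousLinearMap.lsmul ℝ ℝ) ha hG).add
    (integrable_bilin (ContinuousLinearMap.smulRightL ℝ E F) hA hu)

lemma tendsto_eLpNorm_smul_add_smulRight (ha : MemLp a 2 μ) (hA : MemLp A 2 μ) {U : ℕ → α → F}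
    {u : α → F} {H : ℕ → α → E →L[ℝ] F} {G : α → E →L[ℝ] F} (hU : ∀ k, MemLp (U k) 2 μ)
    (hu : MemLp u 2 μ) (hH : ∀ k, MemLp (H k) 2 μ) (hG : MemLp G 2 μ)
    (hUu : Tendsto (fun k => eLpNorm (U k - u) 2 μ) atTop (𝓝 0))
    (hHG : Tendsto (fun k => eLpNorm (H k - G) 2 μ) atTop (𝓝 0)) :
    Tendsto (fun k => eLpNorm ((fun x => a x • H k x + (A x).smulRight (U k x)) -
      fun x => a x • G x + (A x).smulRight (u x)) 1 μ) atTop (𝓝 0) :=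
  tendsto_eLpNorm_one_add
    (fun k => integrable_bilin (ContinuousLinearMap.lsmul ℝ ℝ) ha (hH k))
    (integrable_bilin (ContinuousLinearMap.lsmul ℝ ℝ) ha hG)
    (fun k => integrable_bilin (ContinuousLinearMap.smulRightL ℝ E F) hA (hU k))
    (integrable_bilin (ContinuousLinearMap.smulRightL ℝ E F) hA hu)
    (tendsto_eLpNorm_bilin (ContinuousLinearMap.lsmul ℝ ℝ) (fun _ => ha) ha hH hG
      (tendsto_eLpNorm_sub_self a 2) hHG)
    (tendsto_eLpNorm_bilin (ContinuousLinearMap.smulRightL ℝ E F) (fun _ => hA) hA hU hu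
      (tendsto_eLpNorm_sub_self A 2) hUu)

end ProductRule

lemma isWeakGrad_of_tendsto {V : Type*} [NormedAddCommGroup V] [NormedSpace ℝ V] [CompleteSpace V]
    {Ω : Set Plane} {U : ℕ → Plane → V} {H : ℕ → Plane → Plane →L[ℝ] V} {u : Plane → V}
    {G : Plane → Plane →L[ℝ] V} (hUH : ∀ k, IsWeakGrad Ω (U k) (H k))
    (hU : ∀ k, IntegrableOn (U k) Ω) (hu : IntegrableOn u Ω)
    (hH : ∀ k, IntegrableOn (H k) Ω) (hG : IntegrableOn G Ω)
    (hUu : Tendsto (fun k => eLpNorm (U k - u) 1 (volume.restrict Ω)) atTop (𝓝 0))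
    (hHG : Tendsto (fun k => eLpNorm (H k - G) 1 (volume.restrict Ω)) atTop (𝓝 0)) :
    IsWeakGrad Ω u G := by
  refine ⟨hu.locallyIntegrableOn, hG.locallyIntegrableOn, fun φ hφ hφc hφΩ e => ?_⟩
  have hφ' : Continuous fun x => fderiv ℝ φ x e :=
    (hφ.continuous_fderiv (by simp)).clm_apply continuous_const
  obtain ⟨B, hB⟩ := hφ.continuous.bounded_above_of_compact_support hφc
  obtain ⟨B', hB'⟩ := hφ'.bounded_above_of_compact_support (hφc.fderiv_apply (𝕜 := ℝ) e)
  have happly : ∀ {L : Plane → Plane →L[ℝ] V}, IntegrableOn L Ω →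
      (∫ x in Ω, φ x • L x) e = ∫ x in Ω, φ x • L x e := fun hL =>
    ContinuousLinearMap.integral_apply
      (hL.bdd_smul B hφ.continuous.aestronglyMeasurable (ae_of_all _ hB)) e
  have hlim := tendsto_integral_bdd_smul hφ.continuous.aestronglyMeasurable hB hH hG hHG
  have hlim_apply := ((ContinuousLinearMap.apply ℝ V e).continuous.tendsto _).comp hlim
  simp only [Function.comp_def, ContinuousLinearMap.apply_apply, happly (hH _), happly hG]
    at hlim_apply
  refine tendsto_nhds_unique
    (tendsto_integral_bdd_smul hφ'.aestronglyMeasurable hB' hU hu hUu) ?_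
  simpa only [(hUH _).2.2 φ hφ hφc hφΩ e] using hlim_apply.neg

end Limit

section SmoothApprox

/-- `v` is a sequence of functions smooth in `Ω` which converges to `u` in `L²(Ω)` and whose
derivatives converge to `G` in `L²(Ω)`, so that `u ∈ H¹(Ω)` has weak gradient `G`. -/
structure IsSmoothApprox {V : Type*} [NormedAddCommGroup V] [NormedSpace ℝ V] (Ω : Set Plane)
    (u : Plane → V) (G : Plane → Plane →L[ℝ] V) (v : ℕ → Plane → V) : Prop where
  smooth : ∀ k, ContDiffOn ℝ ∞ (v k) Ω
  memLp : ∀ k, MemLp (v k) 2 (volume.restrict Ω)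
  memLp_fderiv : ∀ k, MemLp (fderiv ℝ (v k)) 2 (volume.restrict Ω)
  tendsto : Tendsto (fun k => eLpNorm (v k - u) 2 (volume.restrict Ω)) atTop (𝓝 0)
  tendsto_fderiv : Tendsto (fun k => eLpNorm (fderiv ℝ (v k) - G) 2 (volume.restrict Ω)) atTop (𝓝 0)

lemma eventually_memLp_of_tendsto {α E : Type*} [MeasurableSpace α] {μ : Measure α}
    [NormedAddCommGroup E] {p : ℝ≥0∞} {F : ℕ → α → E} {f : α → E}
    (hF : ∀ k, AEStronglyMeasurable (F k) μ) (hf : MemLp f p μ)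
    (hFf : Tendsto (fun k => eLpNorm (F k - f) p μ) atTop (𝓝 0)) :
    ∀ᶠ k in atTop, MemLp (F k) p μ := by
  filter_upwards [hFf.eventually (gt_mem_nhds ENNReal.zero_lt_top)] with k hk
  have hsub : MemLp (F k - f) p μ := ⟨(hF k).sub hf.1, hk⟩
  simpa only [sub_add_cancel] using hsub.add hf

variable {Ω : Set Plane}

lemma exists_isSmoothApprox (hΩ : IsOpen Ω) {γ : ℝ → Plane} {u : Plane → Plane}
    {w : ℝ → Plane} (hu : MemH1 Ω u) (h : IsTraceOn Ω γ u w) :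
    ∃ v, IsSmoothApprox Ω u (weakGrad Ω u) v ∧
      Tendsto (fun k => eLpNorm (fun t => v k (γ t) - w t) 2 (volume.restrict (Ioc 0 1)))
        atTop (𝓝 0) := by
  obtain ⟨-, v, hv, hvu, hvG, hvw⟩ := h
  have hmem := (eventually_memLp_of_tendsto
    (fun k => (hv k).continuousOn.aestronglyMeasurable hΩ.measurableSet) hu.1 hvu).and
    (eventually_memLp_of_tendsto (fun k => (measurable_fderiv ℝ (v k)).aestronglyMeasurable)
      (hu.memLp_weakGrad hΩ) hvG)
  obtain ⟨N, hN⟩ := eventually_atTop.1 hmem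
  have hshift : Tendsto (fun k => k + N) atTop atTop := tendsto_add_atTop_nat N
  exact ⟨fun k => v (k + N), ⟨fun k => hv _, fun k => (hN _ (Nat.le_add_left N k)).1,
    fun k => (hN _ (Nat.le_add_left N k)).2, hvu.comp hshift, hvG.comp hshift⟩, hvw.comp hshift⟩

namespace IsSmoothApprox

variable {V : Type*} [NormedAddCommGroup V] [InnerProductSpace ℝ V]
  {u : Plane → V} {G : Plane → Plane →L[ℝ] V} {v : ℕ → Plane → V}

lemma isWeakGrad_smul [CompleteSpace V] (h : IsSmoothApprox Ω u G v) (hΩ : IsOpen Ω)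
    (hu : MemLp u 2 (volume.restrict Ω)) (hG : MemLp G 2 (volume.restrict Ω)) {a : Plane → ℝ}
    {A : Plane → Plane →L[ℝ] ℝ} (hA : IsWeakGrad Ω a A) (ha2 : MemLp a 2 (volume.restrict Ω))
    (hA2 : MemLp A 2 (volume.restrict Ω)) :
    IsWeakGrad Ω (fun x => a x • u x) (fun x => a x • G x + (A x).smulRight (u x)) := by
  exact isWeakGrad_of_tendsto (fun k => hA.smul_contDiffOn hΩ (h.smooth k))
    (fun k => integrable_bilin (ContinuousLinearMap.lsmul ℝ ℝ) ha2 (h.memLp k))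
    (integrable_bilin (ContinuousLinearMap.lsmul ℝ ℝ) ha2 hu)
    (fun k => integrable_smul_add_smulRight ha2 hA2 (h.memLp k) (h.memLp_fderiv k))
    (integrable_smul_add_smulRight ha2 hA2 hu hG)
    (tendsto_eLpNorm_bilin (ContinuousLinearMap.lsmul ℝ ℝ) (fun _ => ha2) ha2 h.memLp hu
      (tendsto_eLpNorm_sub_self a 2) h.tendsto)
    (tendsto_eLpNorm_smul_add_smulRight ha2 hA2 h.memLp hu h.memLp_fderiv hG h.tendsto
      h.tendsto_fderiv)

lemma isWeakGrad_norm_sq (h : IsSmoothApprox Ω u G v) (hΩ : IsOpen Ω)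
    (hu : MemLp u 2 (volume.restrict Ω)) (hG : MemLp G 2 (volume.restrict Ω)) :
    IsWeakGrad Ω (fun x => ⟪u x, u x⟫) (fun x => 2 • (innerSL ℝ (u x)).comp (G x)) := by
  let B : V →L[ℝ] (Plane →L[ℝ] V) →L[ℝ] (Plane →L[ℝ] ℝ) :=
    2 • (ContinuousLinearMap.compL ℝ Plane V ℝ).comp (innerSL ℝ)
  refine isWeakGrad_of_tendsto (U := fun k x => ⟪v k x, v k x⟫)
    (H := fun k x => B (v k x) (fderiv ℝ (v k) x)) (fun k => ?_)
    (fun k => integrable_bilin (innerSL ℝ) (h.memLp k) (h.memLp k))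
    (integrable_bilin (innerSL ℝ) hu hu)
    (fun k => integrable_bilin B (h.memLp k) (h.memLp_fderiv k)) (integrable_bilin B hu hG)
    (tendsto_eLpNorm_bilin (innerSL ℝ) h.memLp hu h.memLp hu h.tendsto h.tendsto)
    (tendsto_eLpNorm_bilin B h.memLp hu h.memLp_fderiv hG h.tendsto h.tendsto_fderiv)
  refine (isWeakGrad_fderiv hΩ ((h.smooth k).inner ℝ (h.smooth k))).congr_ae .rfl
    (ae_restrict_of_forall_mem hΩ.measurableSet fun x hx => ?_)
  have hd := ((h.smooth k).contDiffAt (hΩ.mem_nhds hx)).differentiableAt (by simp)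
  ext e
  rw [fderiv_inner_apply ℝ hd hd, real_inner_comm (v k x)]
  exact (two_nsmul ⟪v k x, fderiv ℝ (v k) x e⟫).symm

lemma ae_inner_eq_zero (h : IsSmoothApprox Ω u G v) (hΩ : IsOpen Ω)
    (hu : MemLp u 2 (volume.restrict Ω)) (hG : MemLp G 2 (volume.restrict Ω))
    (hu1 : ∀ᵐ x ∂volume.restrict Ω, ‖u x‖ = 1) :
    ∀ᵐ x ∂volume.restrict Ω, ∀ e, ⟪u x, G x e⟫ = 0 := by
  have hone : (fun x => ⟪u x, u x⟫) =ᵐ[volume.restrict Ω] fun _ => 1 :=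
    hu1.mono fun x hx => by simp only [real_inner_self_eq_norm_sq, hx, one_pow]
  have hzero := ((h.isWeakGrad_norm_sq hΩ hu hG).congr_ae hone .rfl).ae_eq hΩ
    (isWeakGrad_of_lipschitzWith Ω (LipschitzWith.const (1 : ℝ)))
  filter_upwards [hzero] with x hx e
  have he := DFunLike.congr_fun hx e
  rw [fderiv_fun_const] at he
  simpa using he

end IsSmoothApprox

end SmoothApprox

end WeakGradient

/-! ### The weighted trace inequality -/

section LayerWeight

lemma lintegral_exp_neg_mul_abs {b : ℝ} (hb : 0 < b) :
    ∫⁻ r : ℝ, ENNReal.ofReal (Real.exp (-(b * |r|))) = ENNReal.ofReal (2 / b) := by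
  have hint : ∫ r : ℝ, Real.exp (-(b * |r|)) = 2 / b := by
    have hIoi := integral_exp_mul_Ioi (neg_lt_zero.2 hb) 0
    simp only [neg_mul, mul_zero, Real.exp_zero] at hIoi
    rw [integral_comp_abs (f := fun r => Real.exp (-(b * r))), hIoi, neg_div_neg_eq, mul_one_div]
  have hpos : 0 < 2 / b := by positivity
  rw [← hint, ofReal_integral_eq_lintegral_ofReal
    (not_imp_comm.1 integral_undef (hint ▸ hpos.ne'))
    (Eventually.of_forall fun r => (Real.exp_pos _).le)]

/-- The density `ε⁻¹ exp (-c |r| / ε)` of a transition layer, as a weight for the integration of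
nonnegative functions of the distance to the interface. -/
def layerWeight (c ε r : ℝ) : ℝ≥0∞ := ENNReal.ofReal (layerDecay c ε r / ε)

@[fun_prop]
lemma measurable_layerWeight (c ε : ℝ) : Measurable (layerWeight c ε) := by
  unfold layerWeight layerDecay
  fun_prop

lemma layerWeight_abs (c ε r : ℝ) : layerWeight c ε |r| = layerWeight c ε r := by
  simp only [layerWeight, layerDecay, abs_div, abs_abs]

variable {c ε : ℝ}

lemma layerWeight_le_one_div (hc : 0 ≤ c) (hε : 0 ≤ ε) (r : ℝ) :
    layerWeight c ε r ≤ ENNReal.ofReal (1 / ε) :=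
  ENNReal.ofReal_le_ofReal (by gcongr; exact layerDecay_le_one hc ε r)

lemma lintegral_layerWeight (hc : 0 < c) (hε : 0 < ε) :
    ∫⁻ r, layerWeight c ε r = ENNReal.ofReal (2 / c) := by
  have hscale : ∀ r : ℝ, layerWeight c ε r
      = ENNReal.ofReal (1 / ε) * ENNReal.ofReal (Real.exp (-(c / ε * |r|))) := fun r => by
    rw [layerWeight, layerDecay, ← ENNReal.ofReal_mul (by positivity), abs_div, abs_of_pos hε,
      one_div_mul_eq_div, mul_div_left_comm, mul_comm |r|]
  simp_rw [hscale]
  rw [lintegral_const_mul _ (by fun_prop), lintegral_exp_neg_mul_abs (by positivity),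
    ← ENNReal.ofReal_mul (by positivity)]
  congr 1
  field_simp

lemma lintegral_layerWeight_mul_abs_le (hc : 0 < c) (hε : 0 < ε) :
    ∫⁻ r, layerWeight c ε r * ENNReal.ofReal |r| ≤ ENNReal.ofReal (8 / c ^ 2 * ε) := by
  -- Half of the exponential rate absorbs the factor `|r|`.
  have hle : ∀ r : ℝ, layerWeight c ε r * ENNReal.ofReal |r|
      ≤ ENNReal.ofReal (2 / c) * ENNReal.ofReal (Real.exp (-(c / (2 * ε) * |r|))) := fun r => by
    rw [layerWeight, ← ENNReal.ofReal_mul (by have := layerDecay_pos c ε r; positivity),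
      ← ENNReal.ofReal_mul (by positivity)]
    refine ENNReal.ofReal_le_ofReal ?_
    have hhalf := mul_exp_neg_mul_le (half_pos hc) |r / ε|
    have hr : |r / ε| = |r| / ε := by rw [abs_div, abs_of_pos hε]
    calc layerDecay c ε r / ε * |r|
        = |r / ε| * Real.exp (-(c / 2 * |r / ε|)) * Real.exp (-(c / 2 * |r / ε|)) := by
          rw [mul_assoc, ← Real.exp_add, ← neg_add, ← add_mul, add_halves, hr, layerDecay, hr]
          ring
      _ ≤ 1 / (c / 2) * Real.exp (-(c / 2 * |r / ε|)) := by gcongr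
      _ = 2 / c * Real.exp (-(c / (2 * ε) * |r|)) := by
          rw [hr, one_div_div]
          congr 3
          field_simp
  calc ∫⁻ r, layerWeight c ε r * ENNReal.ofReal |r|
      ≤ ∫⁻ r, ENNReal.ofReal (2 / c) * ENNReal.ofReal (Real.exp (-(c / (2 * ε) * |r|))) :=
        lintegral_mono hle
    _ = ENNReal.ofReal (2 / c * (2 / (c / (2 * ε)))) := by
        rw [lintegral_const_mul _ (by fun_prop), lintegral_exp_neg_mul_abs (by positivity),
          ← ENNReal.ofReal_mul (by positivity)]
    _ = ENNReal.ofReal (8 / c ^ 2 * ε) := by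
        congr 1
        field_simp
        norm_num

lemma layerWeight_le_of_le_abs {ρ r : ℝ} (hc : 0 < c) (hρ : 0 < ρ) (hε : 0 < ε) (hr : ρ ≤ |r|) :
    layerWeight c ε r ≤ ENNReal.ofReal ((2 / (c * ρ)) ^ 2 * ε) :=
  ENNReal.ofReal_le_ofReal (layerDecay_div_le_of_le_abs hc hρ hε hr)

lemma setLIntegral_layerWeight_mul_le (I : Set Plane) {δ ρ : ℝ} (hc : 0 < c) (hρ : 0 < ρ)
    (hε : 0 < ε) {H : Plane → ℝ≥0∞}
    (hH : ∀ᵐ x ∂volume.restrict {x | Metric.infDist x I ≤ δ}, H x ≤ 1) :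
    ∫⁻ x in {x | Metric.infDist x I ≤ δ}, layerWeight c ε (Metric.infDist x I) * H x
      ≤ (∫⁻ x in {x | Metric.infDist x I < ρ}, layerWeight c ε (Metric.infDist x I) * H x)
        + ENNReal.ofReal ((2 / (c * ρ)) ^ 2 * ε) * volume {x | Metric.infDist x I ≤ δ} := by
  have hd : Measurable fun x : Plane => Metric.infDist x I :=
    (Metric.continuous_infDist_pt I).measurable
  set far := {x | Metric.infDist x I ≤ δ} ∩ {x | ρ ≤ Metric.infDist x I}
  have hfar : MeasurableSet far :=
    (measurableSet_le hd measurable_const).inter (measurableSet_le measurable_const hd)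
  have hcover : {x | Metric.infDist x I ≤ δ} ⊆ {x | Metric.infDist x I < ρ} ∪ far := fun x hx =>
    (lt_or_ge (Metric.infDist x I) ρ).imp id fun hρx => ⟨hx, hρx⟩
  refine (lintegral_mono_set hcover).trans ((lintegral_union_le _ _ _).trans ?_)
  gcongr
  calc ∫⁻ x in far, layerWeight c ε (Metric.infDist x I) * H x
      ≤ ∫⁻ x in far, ENNReal.ofReal ((2 / (c * ρ)) ^ 2 * ε) := by
        refine lintegral_mono_ae ?_
        filter_upwards [self_mem_ae_restrict hfar,
          ae_restrict_of_ae_restrict_of_subset inter_subset_left hH] with x hx hHx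
        exact (mul_le_of_le_one_right zero_le hHx).trans
          (layerWeight_le_of_le_abs hc hρ hε (hx.2.trans (le_abs_self _)))
    _ ≤ ENNReal.ofReal ((2 / (c * ρ)) ^ 2 * ε) * volume {x | Metric.infDist x I ≤ δ} := by
        rw [setLIntegral_const]
        gcongr
        exact inter_subset_left

end LayerWeight

section WeightedTrace

lemma lintegral_enorm_sq_eq {α E : Type*} [MeasurableSpace α] {μ : Measure α}
    [NormedAddCommGroup E] (f : α → E) : ∫⁻ x, ‖f x‖ₑ ^ 2 ∂μ = eLpNorm f 2 μ ^ 2 := by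
  have h := eLpNorm_nnreal_pow_eq_lintegral (μ := μ) (f := f) (p := 2) two_ne_zero
  simpa only [NNReal.coe_ofNat, ENNReal.rpow_ofNat, ENNReal.coe_ofNat] using h.symm

lemma tendsto_lintegral_enorm_sq {α E : Type*} [MeasurableSpace α] {μ : Measure α}
    [NormedAddCommGroup E] {F : ℕ → α → E}
    (hF : Tendsto (fun k => eLpNorm (F k) 2 μ) atTop (𝓝 0)) :
    Tendsto (fun k => ∫⁻ x, ‖F k x‖ₑ ^ 2 ∂μ) atTop (𝓝 0) := by
  simpa only [lintegral_enorm_sq_eq, zero_pow two_ne_zero] using ENNReal.Tendsto.pow (n := 2) hF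

lemma lintegral_enorm_sq_le {α E : Type*} [MeasurableSpace α] {μ : Measure α}
    [NormedAddCommGroup E] {f g : α → E} (hfg : AEStronglyMeasurable (f - g) μ) :
    ∫⁻ x, ‖f x‖ₑ ^ 2 ∂μ ≤ 2 * (∫⁻ x, ‖(f - g) x‖ₑ ^ 2 ∂μ) + 2 * ∫⁻ x, ‖g x‖ₑ ^ 2 ∂μ := by
  have hm : AEMeasurable (fun x => ‖(f - g) x‖ₑ ^ 2) μ := hfg.enorm.pow_const 2
  rw [← lintegral_const_mul'' _ hm, ← lintegral_const_mul' _ _ ENNReal.ofNat_ne_top,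
    ← lintegral_add_left' (hm.const_mul 2)]
  refine lintegral_mono fun x => ?_
  rw [← mul_add]
  refine le_trans ?_ (ennreal_add_sq_le _ _)
  gcongr
  simpa only [Pi.sub_apply, sub_add_cancel] using enorm_add_le (f x - g x) (g x)

lemma enorm_inner_le_of_norm_le_one {E : Type*} [NormedAddCommGroup E] [InnerProductSpace ℝ E]
    (a : E) {e : E} (he : ‖e‖ ≤ 1) : ‖⟪a, e⟫‖ₑ ≤ ‖a‖ₑ := by
  rw [enorm_le_iff_norm_le]
  exact (norm_inner_le_norm a e).trans (mul_le_of_le_one_right (norm_nonneg a) he)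

lemma enorm_inner_sq_le {E : Type*} [NormedAddCommGroup E] [InnerProductSpace ℝ E]
    (a b : E) {e : E} (he : ‖e‖ ≤ 1) :
    ‖⟪b, e⟫‖ₑ ^ 2 ≤ 2 * ‖⟪a, e⟫‖ₑ ^ 2 + 2 * ‖a - b‖ₑ ^ 2 := by
  rw [← mul_add]
  refine le_trans ?_ (ennreal_add_sq_le _ _)
  gcongr
  calc ‖⟪b, e⟫‖ₑ = ‖⟪a, e⟫ - ⟪a - b, e⟫‖ₑ := by rw [← inner_sub_left, sub_sub_cancel]
    _ ≤ ‖⟪a, e⟫‖ₑ + ‖⟪a - b, e⟫‖ₑ := enorm_sub_le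
    _ ≤ ‖⟪a, e⟫‖ₑ + ‖a - b‖ₑ := by gcongr; exact enorm_inner_le_of_norm_le_one _ he

lemma norm_gradient_signedDistTo_le (I : Set Plane) (x : Plane) :
    ‖gradient (signedDistTo I) x‖ ≤ 1 := by
  rw [gradient, LinearIsometryEquiv.norm_map]
  exact_mod_cast norm_fderiv_le_of_lipschitz ℝ (lipschitzWith_signedDistTo I)

namespace IsRegularClosedCurve

variable {γ : ℝ → Plane}

lemma volume_tube_lt_top (h : IsRegularClosedCurve γ) (δ : ℝ) :
    volume {x | Metric.infDist x (range γ) ≤ δ} < (⊤ : ℝ≥0∞) := by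
  refine (measure_mono fun x (hx : Metric.infDist x (range γ) ≤ δ) => ?_).trans_lt
    (h.isCompact_range.isBounded.thickening (δ := δ + 1)).measure_lt_top
  exact Metric.mem_thickening_iff.2
    ((Metric.infDist_lt_iff (range_nonempty γ)).1 (hx.trans_lt (lt_add_one δ)))

lemma exists_setLIntegral_layerWeight_le (h : IsRegularClosedCurve γ) {c : ℝ} (hc : 0 < c)
    (δ : ℝ) : ∃ C : ℝ, 0 ≤ C ∧ ∀ ε, 0 < ε → ε ≤ 1 →
      ∫⁻ x in {x | Metric.infDist x (range γ) ≤ δ}, layerWeight c ε (Metric.infDist x (range γ))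
        ≤ ENNReal.ofReal C := by
  obtain ⟨C, ρ, hρ, hC⟩ := h.exists_comparableOn
  set V := volume {x | Metric.infDist x (range γ) ≤ δ}
  have hV : V ≠ ⊤ := (h.volume_tube_lt_top δ).ne
  refine ⟨C * (2 / c) + (2 / (c * ρ)) ^ 2 * V.toReal, by positivity, fun ε hε hε1 => ?_⟩
  have hsplit := setLIntegral_layerWeight_mul_le (range γ) (δ := δ) (H := 1) hc hρ hε
    (Eventually.of_forall fun _ => le_rfl)
  simp only [Pi.one_apply, mul_one] at hsplit
  have hCV : ENNReal.ofReal (C * (2 / c) + (2 / (c * ρ)) ^ 2 * V.toReal)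
      = C * ENNReal.ofReal (2 / c) + ENNReal.ofReal ((2 / (c * ρ)) ^ 2) * V := by
    rw [ENNReal.ofReal_add (by positivity) (by positivity), ENNReal.ofReal_mul NNReal.zero_le_coe,
      ENNReal.ofReal_coe_nnreal, ENNReal.ofReal_mul (by positivity), ENNReal.ofReal_toReal hV]
  rw [hCV]
  refine hsplit.trans ?_
  gcongr
  · refine (h.setLIntegral_infDist_le hC (measurable_layerWeight c ε)).trans ?_
    simp_rw [layerWeight_abs, ← lintegral_layerWeight hc hε]
    gcongr
    exact Measure.restrict_le_self
  · exact mul_le_of_le_one_right (by positivity) hε1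

variable {C : ℝ≥0} {ρ : ℝ} {k : ℝ → ℝ≥0∞} {Ω : Set Plane} {u : Plane → Plane} {w : ℝ → Plane}

lemma setLIntegral_inner_gradient_le_of_smooth (h : IsRegularClosedCurve γ)
    (hC : ComparableOn (normalCoord γ) C (Icc 0 1 ×ˢ Ioo (-ρ) ρ)) (hρ : 0 < ρ)
    (hk : Measurable k) {κ : ℝ≥0∞} (hκ : κ ≠ ⊤) (hkκ : ∀ s, k s ≤ κ) (hΩo : IsOpen Ω)
    (hΩ : ∀ x, Metric.infDist x (range γ) < ρ → x ∈ Ω) {G : Plane → Plane →L[ℝ] Plane}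
    {v : Plane → Plane} (hv : ContDiffOn ℝ 1 v Ω)
    (hvu : AEStronglyMeasurable (v - u) (volume.restrict Ω))
    (hvG : AEStronglyMeasurable (fderiv ℝ v - G) (volume.restrict Ω))
    (hw : ∀ᵐ t ∂volume.restrict (Ioc (0 : ℝ) 1), ⟪w t, unitNormal γ t⟫ = 0) :
    ∫⁻ x in {x | Metric.infDist x (range γ) < ρ},
        k (Metric.infDist x (range γ)) * ‖⟪u x, gradient (signedDistTo (range γ)) x⟫‖ₑ ^ 2
      ≤ 4 * C * (∫⁻ r in Ioo (-ρ) ρ, k |r|) * (∫⁻ t in Ioc (0 : ℝ) 1, ‖v (γ t) - w t‖ₑ ^ 2)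
        + 4 * C ^ 2 * (∫⁻ r in Ioo (-ρ) ρ, k |r| * ENNReal.ofReal |r|)
          * (2 * (∫⁻ x in Ω, ‖(fderiv ℝ v - G) x‖ₑ ^ 2) + 2 * ∫⁻ x in Ω, ‖G x‖ₑ ^ 2)
        + 2 * κ * ∫⁻ x in Ω, ‖(v - u) x‖ₑ ^ 2 := by
  set D : Set Plane := {x | Metric.infDist x (range γ) < ρ}
  set g := gradient (signedDistTo (range γ))
  have hpointwise : ∀ x, k (Metric.infDist x (range γ)) * ‖⟪u x, g x⟫‖ₑ ^ 2
      ≤ 2 * (k (Metric.infDist x (range γ)) * ‖⟪v x, g x⟫‖ₑ ^ 2)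
        + 2 * κ * ‖(v - u) x‖ₑ ^ 2 := fun x =>
    calc _ ≤ k (Metric.infDist x (range γ)) * (2 * ‖⟪v x, g x⟫‖ₑ ^ 2 + 2 * ‖(v - u) x‖ₑ ^ 2) := by
          gcongr
          exact enorm_inner_sq_le (v x) (u x) (norm_gradient_signedDistTo_le _ x)
      _ = 2 * (k (Metric.infDist x (range γ)) * ‖⟪v x, g x⟫‖ₑ ^ 2)
          + 2 * k (Metric.infDist x (range γ)) * ‖(v - u) x‖ₑ ^ 2 := by ring
      _ ≤ _ := by gcongr; exact hkκ _
  have htrace : ∫⁻ t in Ioc (0 : ℝ) 1, ‖⟪v (γ t), unitNormal γ t⟫‖ₑ ^ 2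
      ≤ ∫⁻ t in Ioc (0 : ℝ) 1, ‖v (γ t) - w t‖ₑ ^ 2 := by
    refine lintegral_mono_ae ?_
    filter_upwards [hw] with t ht
    rw [← sub_zero ⟪v (γ t), unitNormal γ t⟫, ← ht, ← inner_sub_left]
    gcongr
    exact enorm_inner_le_of_norm_le_one _ (h.norm_unitNormal t).le
  have hvuD : AEMeasurable (fun x => 2 * κ * ‖(v - u) x‖ₑ ^ 2) (volume.restrict D) :=
    ((hvu.mono_measure (Measure.restrict_mono hΩ le_rfl)).enorm.pow_const 2).const_mul _
  calc ∫⁻ x in D, k (Metric.infDist x (range γ)) * ‖⟪u x, g x⟫‖ₑ ^ 2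
      ≤ 2 * (∫⁻ x in D, k (Metric.infDist x (range γ)) * ‖⟪v x, g x⟫‖ₑ ^ 2)
        + 2 * κ * ∫⁻ x in D, ‖(v - u) x‖ₑ ^ 2 := by
        rw [← lintegral_const_mul' _ _ ENNReal.ofNat_ne_top,
          ← lintegral_const_mul' _ _ (ENNReal.mul_ne_top ENNReal.ofNat_ne_top hκ),
          ← lintegral_add_right' _ hvuD]
        exact lintegral_mono hpointwise
    _ ≤ 2 * (2 * C * (∫⁻ r in Ioo (-ρ) ρ, k |r|) * (∫⁻ t in Ioc (0 : ℝ) 1, ‖v (γ t) - w t‖ₑ ^ 2)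
          + 2 * C ^ 2 * (∫⁻ r in Ioo (-ρ) ρ, k |r| * ENNReal.ofReal |r|)
            * (2 * (∫⁻ x in Ω, ‖(fderiv ℝ v - G) x‖ₑ ^ 2) + 2 * ∫⁻ x in Ω, ‖G x‖ₑ ^ 2))
        + 2 * κ * ∫⁻ x in Ω, ‖(v - u) x‖ₑ ^ 2 := by
        gcongr ?_ + 2 * κ * ?_
        · refine mul_le_mul_right ((h.setLIntegral_inner_gradient_le hC hρ hk hΩo hΩ hv).trans ?_) 2
          gcongr
          exact lintegral_enorm_sq_le hvG
        · exact lintegral_mono_set hΩ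
    _ = _ := by ring

lemma setLIntegral_inner_gradient_le_of_isTraceOn (h : IsRegularClosedCurve γ)
    (hC : ComparableOn (normalCoord γ) C (Icc 0 1 ×ˢ Ioo (-ρ) ρ)) (hρ : 0 < ρ)
    (hk : Measurable k) {κ : ℝ≥0∞} (hκ : κ ≠ ⊤) (hkκ : ∀ s, k s ≤ κ) (hΩo : IsOpen Ω)
    (hΩ : ∀ x, Metric.infDist x (range γ) < ρ → x ∈ Ω) (hu : MemH1 Ω u) (huw : IsTraceOn Ω γ u w)
    (hw : ∀ᵐ t ∂volume.restrict (Ioc (0 : ℝ) 1), ⟪w t, unitNormal γ t⟫ = 0) :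
    ∫⁻ x in {x | Metric.infDist x (range γ) < ρ},
        k (Metric.infDist x (range γ)) * ‖⟪u x, gradient (signedDistTo (range γ)) x⟫‖ₑ ^ 2
      ≤ 8 * C ^ 2 * (∫⁻ r in Ioo (-ρ) ρ, k |r| * ENNReal.ofReal |r|)
        * ∫⁻ x in Ω, ‖weakGrad Ω u x‖ₑ ^ 2 := by
  obtain ⟨v, hv, hvw⟩ := exists_isSmoothApprox hΩo hu huw
  set K₀ := ∫⁻ r in Ioo (-ρ) ρ, k |r|
  set K₁ := ∫⁻ r in Ioo (-ρ) ρ, k |r| * ENNReal.ofReal |r|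
  have hK₀ : K₀ ≠ ⊤ := ((setLIntegral_mono measurable_const fun r _ => hkκ |r|).trans_lt (by
    rw [setLIntegral_const, Real.volume_Ioo]; finiteness)).ne
  have hK₁ : K₁ ≠ ⊤ := by
    refine ((setLIntegral_mono (g := fun _ => κ * ENNReal.ofReal ρ) measurable_const
      fun r hr => ?_).trans_lt (by rw [setLIntegral_const, Real.volume_Ioo]; finiteness)).ne
    gcongr
    exacts [hkκ _, (abs_lt.2 hr).le]
  have hG := hu.memLp_weakGrad hΩo
  have hCt : (C : ℝ≥0∞) ≠ ⊤ := ENNReal.coe_ne_top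
  have hlim := ((ENNReal.Tendsto.const_mul (a := 4 * C * K₀) (tendsto_lintegral_enorm_sq hvw)
      (Or.inr (by finiteness))).add
    (ENNReal.Tendsto.const_mul (a := 4 * C ^ 2 * K₁)
      ((ENNReal.Tendsto.const_mul (a := 2) (tendsto_lintegral_enorm_sq hv.tendsto_fderiv)
        (Or.inr ENNReal.ofNat_ne_top)).add_const (2 * ∫⁻ x in Ω, ‖weakGrad Ω u x‖ₑ ^ 2))
      (Or.inr (by finiteness)))).add
    (ENNReal.Tendsto.const_mul (a := 2 * κ) (tendsto_lintegral_enorm_sq hv.tendsto)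
      (Or.inr (by finiteness)))
  refine (ge_of_tendsto' hlim fun j => h.setLIntegral_inner_gradient_le_of_smooth hC hρ hk hκ hkκ
    hΩo hΩ ((hv.smooth j).of_le (mod_cast le_top)) ((hv.memLp j).1.sub hu.1.1)
    ((hv.memLp_fderiv j).1.sub hG.1) hw).trans_eq ?_
  ring

lemma exists_setLIntegral_inner_gradient_le (h : IsRegularClosedCurve γ) {c δ : ℝ} (hc : 0 < c)
    (hδ : 0 < δ) : ∃ C : ℝ, 0 ≤ C ∧ ∀ (Ω : Set Plane) (u : Plane → Plane) (w : ℝ → Plane),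
      IsOpen Ω → {x | Metric.infDist x (range γ) ≤ δ} ⊆ Ω → MemH1Circle Ω u → IsTraceOn Ω γ u w →
      (∀ᵐ t ∂volume.restrict (Ioc (0 : ℝ) 1), ⟪w t, unitNormal γ t⟫ = 0) →
      ∀ ε, 0 < ε → ∫⁻ x in {x | Metric.infDist x (range γ) ≤ δ},
        layerWeight c ε (Metric.infDist x (range γ))
          * ‖⟪u x, gradient (signedDistTo (range γ)) x⟫‖ₑ ^ 2
        ≤ ENNReal.ofReal (C * ε) * (1 + ∫⁻ x in Ω, ‖weakGrad Ω u x‖ₑ ^ 2) := by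
  obtain ⟨C, ρ', hρ', hC'⟩ := h.exists_comparableOn
  obtain ⟨ρ, hρ, hρρ', hρδ⟩ : ∃ ρ, 0 < ρ ∧ ρ ≤ ρ' ∧ ρ ≤ δ :=
    ⟨min ρ' δ, lt_min hρ' hδ, min_le_left _ _, min_le_right _ _⟩
  have hC := hC'.mono (prod_mono_right (Ioo_subset_Ioo (neg_le_neg hρρ') hρρ'))
  set V := volume {x | Metric.infDist x (range γ) ≤ δ}
  have hV : V ≠ ⊤ := (h.volume_tube_lt_top δ).ne
  refine ⟨8 * C ^ 2 * (8 / c ^ 2) + (2 / (c * ρ)) ^ 2 * V.toReal, by positivity,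
    fun Ω u w hΩo hΩ hu huw hw ε hε => ?_⟩
  set I := ∫⁻ x in Ω, ‖weakGrad Ω u x‖ₑ ^ 2
  have hnear := h.setLIntegral_inner_gradient_le_of_isTraceOn hC hρ (measurable_layerWeight c ε)
    ENNReal.ofReal_ne_top (layerWeight_le_one_div hc.le hε.le) hΩo
    (fun x hx => hΩ (hx.le.trans hρδ)) hu.1 huw hw
  have hunit : ∀ᵐ x ∂volume.restrict {x | Metric.infDist x (range γ) ≤ δ},
      ‖⟪u x, gradient (signedDistTo (range γ)) x⟫‖ₑ ^ 2 ≤ 1 := by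
    filter_upwards [ae_restrict_of_ae_restrict_of_subset hΩ hu.2] with x hx
    refine pow_le_one₀ zero_le ((enorm_inner_le_of_norm_le_one _
      (norm_gradient_signedDistTo_le _ x)).trans_eq ?_)
    rw [← ofReal_norm, hx, ENNReal.ofReal_one]
  have hC₁ : ENNReal.ofReal (8 * C ^ 2 * (8 / c ^ 2) * ε)
      = 8 * (C : ℝ≥0∞) ^ 2 * ENNReal.ofReal (8 / c ^ 2 * ε) := by
    rw [mul_assoc, ENNReal.ofReal_mul (by positivity), ENNReal.ofReal_mul (by positivity),
      ENNReal.ofReal_pow (by positivity), ENNReal.ofReal_coe_nnreal, ENNReal.ofReal_ofNat]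
  have hC₂ : ENNReal.ofReal ((2 / (c * ρ)) ^ 2 * V.toReal * ε)
      = ENNReal.ofReal ((2 / (c * ρ)) ^ 2 * ε) * V := by
    rw [mul_right_comm, ENNReal.ofReal_mul (by positivity), ENNReal.ofReal_toReal hV]
  refine (setLIntegral_layerWeight_mul_le _ hc hρ hε hunit).trans ?_
  rw [add_mul, ENNReal.ofReal_add (by positivity) (by positivity), add_mul, hC₁, hC₂]
  refine add_le_add (hnear.trans ?_) (le_mul_of_one_le_right zero_le le_self_add)
  gcongr
  · simp_rw [layerWeight_abs]
    exact (setLIntegral_le_lintegral _ _).trans (lintegral_layerWeight_mul_abs_le hc hε)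
  · exact le_add_self

end IsRegularClosedCurve

end WeightedTrace

/-! ### Matrix algebra -/

section MatrixAlgebra

lemma frobSq_eq_sum_norm_sq (A : Plane →L[ℝ] Plane) :
    frobSq A = ∑ j, ‖A (EuclideanSpace.single j 1)‖ ^ 2 := by
  simp only [frobSq, EuclideanSpace.real_norm_sq_eq]
  exact Finset.sum_comm

lemma frobSq_nonneg (A : Plane →L[ℝ] Plane) : 0 ≤ frobSq A := by
  unfold frobSq
  positivity

lemma divOf_sq_le (A : Plane →L[ℝ] Plane) : divOf A ^ 2 ≤ 2 * frobSq A :=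
  calc divOf A ^ 2 ≤ 2 * ∑ i, A (EuclideanSpace.single i 1) i ^ 2 := by
        simpa [divOf] using sq_sum_le_card_mul_sum_sq (s := Finset.univ)
          (f := fun i => A (EuclideanSpace.single i 1) i)
    _ ≤ 2 * frobSq A := by
        unfold frobSq
        gcongr with i
        exact Finset.single_le_sum (f := fun j => A (EuclideanSpace.single j 1) i ^ 2)
          (fun j _ => sq_nonneg _) (Finset.mem_univ i)

lemma norm_sq_le_frobSq (A : Plane →L[ℝ] Plane) : ‖A‖ ^ 2 ≤ frobSq A := by
  have hbound : ∀ x, ‖A x‖ ≤ Real.sqrt (frobSq A) * ‖x‖ := fun x => by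
    have hx : x = ∑ j, x j • EuclideanSpace.single j (1 : ℝ) := by
      ext i; fin_cases i <;> simp [Fin.sum_univ_two]
    calc ‖A x‖ = ‖∑ j, x j • A (EuclideanSpace.single j 1)‖ := by
          conv_lhs => rw [hx, map_sum]
          simp only [map_smul]
      _ ≤ ∑ j, ‖x j‖ * ‖A (EuclideanSpace.single j 1)‖ :=
          (norm_sum_le _ _).trans_eq (by simp only [norm_smul])
      _ ≤ Real.sqrt (∑ j, ‖x j‖ ^ 2) * Real.sqrt (∑ j, ‖A (EuclideanSpace.single j 1)‖ ^ 2) :=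
          Real.sum_mul_le_sqrt_mul_sqrt _ _ _
      _ = Real.sqrt (frobSq A) * ‖x‖ := by
          rw [mul_comm, frobSq_eq_sum_norm_sq, EuclideanSpace.norm_eq]
  calc ‖A‖ ^ 2 ≤ Real.sqrt (frobSq A) ^ 2 := by
        gcongr
        exact A.opNorm_le_bound (Real.sqrt_nonneg _) hbound
    _ = frobSq A := Real.sq_sqrt (frobSq_nonneg A)

variable {G : Plane →L[ℝ] Plane} {l : Plane →L[ℝ] ℝ} {u q : Plane} {a s : ℝ}

lemma apply_single_of_eq_smul_innerSL (hl : l = s • innerSL ℝ q) (j : Fin 2) :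
    l (EuclideanSpace.single j 1) = s * q j := by
  simp [hl, EuclideanSpace.inner_single_right]

lemma frobSq_smul_add_smulRight (hl : l = s • innerSL ℝ q) (hq : ‖q‖ = 1) (hu : ‖u‖ = 1)
    (hG : ∀ e, ⟪u, G e⟫ = 0) :
    frobSq (a • G + l.smulRight u) = a ^ 2 * frobSq G + s ^ 2 := by
  have horth : ∀ j : Fin 2, ‖(a • G + l.smulRight u) (EuclideanSpace.single j 1)‖ ^ 2
      = a ^ 2 * ‖G (EuclideanSpace.single j 1)‖ ^ 2 + s ^ 2 * q j ^ 2 := fun j => by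
    rw [add_apply, smul_apply, ContinuousLinearMap.smulRight_apply,
      apply_single_of_eq_smul_innerSL hl, norm_add_sq_real, real_inner_smul_left,
      real_inner_smul_right, real_inner_comm, hG]
    simp only [norm_smul, hu, mul_pow, Real.norm_eq_abs, sq_abs]
    ring
  have hq2 : ∑ j, q j ^ 2 = 1 := by rw [← EuclideanSpace.real_norm_sq_eq, hq, one_pow]
  simp only [frobSq_eq_sum_norm_sq, horth, Finset.sum_add_distrib, ← Finset.mul_sum, hq2, mul_one]

lemma divOf_smul_add_smulRight (hl : l = s • innerSL ℝ q) :
    divOf (a • G + l.smulRight u) = a * divOf G + s * ⟪u, q⟫ := by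
  simp only [divOf, add_apply, smul_apply, ContinuousLinearMap.smulRight_apply, PiLp.add_apply,
    PiLp.smul_apply, smul_eq_mul, apply_single_of_eq_smul_innerSL hl, PiLp.inner_apply,
    RCLike.inner_apply, conj_trivial, Finset.sum_add_distrib, Finset.mul_sum, mul_assoc]

end MatrixAlgebra

section Integrability

variable {α : Type*} [MeasurableSpace α] {μ : Measure α}

lemma integrable_frobSq {G : α → Plane →L[ℝ] Plane} (hG : MemLp G 2 μ) :
    Integrable (fun x => frobSq (G x)) μ :=
  integrable_finsetSum _ fun i _ => integrable_finsetSum _ fun j _ =>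
    ((EuclideanSpace.proj (𝕜 := ℝ) i ∘L ContinuousLinearMap.apply ℝ Plane
      (EuclideanSpace.single j (1 : ℝ))).comp_memLp' hG).integrable_sq

lemma integrable_divOf_sq {G : α → Plane →L[ℝ] Plane} (hG : MemLp G 2 μ) :
    Integrable (fun x => divOf (G x) ^ 2) μ :=
  (memLp_finsetSum _ fun i _ =>
    (EuclideanSpace.proj (𝕜 := ℝ) i ∘L ContinuousLinearMap.apply ℝ Plane _).comp_memLp'
      hG).integrable_sq

lemma lintegral_enorm_sq_le_of_integral_frobSq_le {G : α → Plane →L[ℝ] Plane} (hG : MemLp G 2 μ)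
    {B : ℝ} (hB : ∫ x, frobSq (G x) ∂μ ≤ B) : ∫⁻ x, ‖G x‖ₑ ^ 2 ∂μ ≤ ENNReal.ofReal B :=
  calc ∫⁻ x, ‖G x‖ₑ ^ 2 ∂μ ≤ ∫⁻ x, ENNReal.ofReal (frobSq (G x)) ∂μ := by
        refine lintegral_mono fun x => ?_
        rw [← ofReal_norm, ← ENNReal.ofReal_pow (norm_nonneg _)]
        exact ENNReal.ofReal_le_ofReal (norm_sq_le_frobSq _)
    _ = ENNReal.ofReal (∫ x, frobSq (G x) ∂μ) :=
        (ofReal_integral_eq_lintegral_ofReal (integrable_frobSq hG)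
          (.of_forall fun x => frobSq_nonneg _)).symm
    _ ≤ ENNReal.ofReal B := ENNReal.ofReal_le_ofReal hB

/-- Without integrability of `f` this rests on the junk value `∫ x, f x ∂μ = 0`. -/
lemma integral_le_integral_of_ae_le {f g : α → ℝ} (h : f ≤ᵐ[μ] g) (hg : Integrable g μ)
    (hg0 : 0 ≤ ∫ x, g x ∂μ) : ∫ x, f x ∂μ ≤ ∫ x, g x ∂μ := by
  by_cases hf : Integrable f μ
  · exact integral_mono_ae hf hg h
  · rwa [integral_undef hf]

lemma setIntegral_le_of_setLIntegral_le {Ω T : Set α} {r : α → ℝ}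
    (hr : AEStronglyMeasurable r (μ.restrict Ω)) (hr0 : ∀ x, 0 ≤ r x) (hrT : ∀ x ∉ T, r x = 0)
    {C : ℝ} (hC : 0 ≤ C) (h : ∫⁻ x in T, ENNReal.ofReal (r x) ∂μ ≤ ENNReal.ofReal C) :
    IntegrableOn r Ω μ ∧ ∫ x in Ω, r x ∂μ ≤ C := by
  have hsupp : T.indicator (fun x => ENNReal.ofReal (r x)) = fun x => ENNReal.ofReal (r x) :=
    indicator_eq_self.2 fun x hx => by_contra fun hxT => hx (by simp [hrT x hxT])
  have hle : ∫⁻ x in Ω, ENNReal.ofReal (r x) ∂μ ≤ ENNReal.ofReal C :=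
    calc ∫⁻ x in Ω, ENNReal.ofReal (r x) ∂μ ≤ ∫⁻ x, ENNReal.ofReal (r x) ∂μ :=
          setLIntegral_le_lintegral _ _
      _ = ∫⁻ x, T.indicator (fun x => ENNReal.ofReal (r x)) x ∂μ := by rw [hsupp]
      _ ≤ ENNReal.ofReal C := (lintegral_indicator_le _ _).trans h
  refine ⟨⟨hr, ?_⟩, ?_⟩
  · rw [hasFiniteIntegral_iff_ofReal (.of_forall hr0)]
    exact hle.trans_lt ENNReal.ofReal_lt_top
  · rw [integral_eq_lintegral_of_nonneg_ae (.of_forall hr0) hr]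
    exact ENNReal.toReal_le_of_le_ofReal hC hle

lemma setIntegral_frobSq_weakGrad_le {Ω : Set Plane} {u : Plane → Plane} {M : ℝ}
    (h : h1Norm Ω u ≤ M) : ∫ x in Ω, frobSq (weakGrad Ω u x) ≤ M ^ 2 := by
  have hu0 : 0 ≤ ∫ x in Ω, ‖u x‖ ^ 2 := integral_nonneg fun x => by positivity
  linarith [(Real.sqrt_le_iff.1 h).2]

lemma MemH1Circle.volume_lt_top {Ω : Set Plane} {u : Plane → Plane} (h : MemH1Circle Ω u) :
    volume Ω < ⊤ := by
  have hone : MemLp (fun _ : Plane => (1 : ℝ)) 2 (volume.restrict Ω) :=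
    h.1.1.norm.ae_eq h.2
  simpa using (memLp_const_iff (by simp) (by simp)).1 hone

lemma memLp_of_bound_of_volume_lt_top {F : Type*} [NormedAddCommGroup F] {Ω : Set Plane}
    (hΩ : volume Ω < ⊤) {a : Plane → F} (ha : AEStronglyMeasurable a (volume.restrict Ω)) {B : ℝ}
    (hB : ∀ x, ‖a x‖ ≤ B) (p : ℝ≥0∞) : MemLp a p (volume.restrict Ω) := by
  have : IsFiniteMeasure (volume.restrict Ω) := ⟨by simpa using hΩ⟩
  exact .of_bound ha B (.of_forall hB)

end Integrability

lemma inter_frontier_nonempty_of_isPreconnected {X : Type*} [TopologicalSpace X] {s t : Set X}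
    (ht : IsPreconnected t) (hts : (t ∩ s).Nonempty) (htsc : (t ∩ sᶜ).Nonempty) :
    (t ∩ frontier s).Nonempty := by
  by_contra hempty
  have hfr : ∀ x ∈ t, x ∉ frontier s := fun x hx hxs => hempty ⟨x, hx, hxs⟩
  have hint : ∀ x ∈ t, x ∈ closure s → x ∈ interior s := fun x hx hxc =>
    by_contra fun hxi => hfr x hx ⟨hxc, hxi⟩
  obtain ⟨x, hxt, hxs⟩ := hts
  obtain ⟨y, hyt, hys⟩ := htsc
  obtain ⟨z, -, hzi, hzc⟩ := ht (interior s) (closure s)ᶜ isOpen_interior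
    isClosed_closure.isOpen_compl
    (fun z hz => or_iff_not_imp_right.2 fun h => hint z hz (not_not.1 h))
    ⟨x, hxt, hint x hxt (subset_closure hxs)⟩
    ⟨y, hyt, fun hyc => hys (interior_subset (hint y hyt hyc))⟩
  exact hzc (interior_subset_closure hzi)

lemma closedBall_subset_of_forall_lt_dist {E : Type*} [NormedAddCommGroup E] [NormedSpace ℝ E]
    {Ω : Set E} {y : E} {r : ℝ} (hy : y ∈ Ω) (hr : ∀ z ∈ frontier Ω, r < dist y z) :
    Metric.closedBall y r ⊆ Ω := by
  intro x hx
  by_contra hxΩ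
  have hr0 : 0 ≤ r := dist_nonneg.trans (Metric.mem_closedBall.1 hx)
  obtain ⟨z, hz, hzΩ⟩ := inter_frontier_nonempty_of_isPreconnected
    (convex_closedBall y r).isPreconnected ⟨y, Metric.mem_closedBall_self hr0, hy⟩ ⟨x, hx, hxΩ⟩
  exact (hr z hzΩ).not_ge (Metric.mem_closedBall'.1 hz)

lemma infDist_le_subset_of_forall_lt_dist {E : Type*} [NormedAddCommGroup E] [NormedSpace ℝ E]
    {Ω I : Set E} (hI : IsCompact I) (hne : I.Nonempty) (hIΩ : I ⊆ Ω) {r : ℝ}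
    (hr : ∀ y ∈ I, ∀ z ∈ frontier Ω, r < dist y z) : {x | Metric.infDist x I ≤ r} ⊆ Ω := by
  intro x hx
  obtain ⟨y, hy, hxy⟩ := hI.exists_infDist_eq_dist hne x
  exact closedBall_subset_of_forall_lt_dist (hIΩ hy) (hr y hy)
    (Metric.mem_closedBall.2 (hxy.symm.trans_le hx))

/-! ### The competitor -/

/-- The competitor `p(d_I) u`: the field `u` modulated across the curve by the profile `p`. -/
def competitor (I : Set Plane) (p : ℝ → ℝ) (u : Plane → Plane) (x : Plane) : Plane :=
  p (signedDistTo I x) • u x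

lemma fderiv_comp_real {E : Type*} [NormedAddCommGroup E] [InnerProductSpace ℝ E] [CompleteSpace E]
    {q : ℝ → ℝ} {d : E → ℝ} {x : E} (hq : DifferentiableAt ℝ q (d x))
    (hd : DifferentiableAt ℝ d x) :
    fderiv ℝ (fun y => q (d y)) x = deriv q (d x) • innerSL ℝ (gradient d x) := by
  have hgrad : innerSL ℝ (gradient d x) = fderiv ℝ d x := by
    ext e
    exact InnerProductSpace.toDual_symm_apply
  rw [hgrad]
  exact (hq.hasDerivAt.comp_hasFDerivAt x hd.hasFDerivAt).fderiv

lemma memLp_smul_add_smulRight {α E F : Type*} [MeasurableSpace α] {μ : Measure α}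
    [NormedAddCommGroup E] [NormedSpace ℝ E] [NormedAddCommGroup F] [NormedSpace ℝ F] {p : ℝ≥0∞}
    {f : α → F} {G : α → E →L[ℝ] F} {a : α → ℝ} {l : α → E →L[ℝ] ℝ} {A B : ℝ}
    (ha : AEStronglyMeasurable a μ) (hA : ∀ x, ‖a x‖ ≤ A) (hG : MemLp G p μ)
    (hl : AEStronglyMeasurable l μ) (hB : ∀ x, ‖l x‖ ≤ B) (hf : MemLp f p μ) :
    MemLp (fun x => a x • G x + (l x).smulRight (f x)) p μ := by
  refine (hG.of_le_mul (c := A) (ha.smul hG.1) (.of_forall fun x => ?_)).add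
    (hf.of_le_mul (c := B) ?_ (.of_forall fun x => ?_))
  · rw [Pi.smul_apply', norm_smul]
    exact mul_le_mul_of_nonneg_right (hA x) (norm_nonneg _)
  · exact (ContinuousLinearMap.smulRightL ℝ E F).aestronglyMeasurable_comp₂ hl hf.1
  · rw [ContinuousLinearMap.norm_smulRight_apply]
    exact mul_le_mul_of_nonneg_right (hB x) (norm_nonneg _)

lemma memLp_fderiv_of_lipschitzWith {Ω : Set Plane} (hΩ : volume Ω < ⊤) {a : Plane → ℝ} {L : ℝ≥0}
    (ha : LipschitzWith L a) (p : ℝ≥0∞) : MemLp (fderiv ℝ a) p (volume.restrict Ω) :=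
  memLp_of_bound_of_volume_lt_top hΩ (measurable_fderiv ℝ a).aestronglyMeasurable
    (fun _ => norm_fderiv_le_of_lipschitz ℝ ha) p

lemma memH1_of_lipschitzWith {Ω : Set Plane} (hΩ : volume Ω < ⊤) {a : Plane → ℝ} {L : ℝ≥0} {B : ℝ}
    (ha : LipschitzWith L a) (hB : ∀ x, ‖a x‖ ≤ B) : MemH1 Ω a :=
  ⟨memLp_of_bound_of_volume_lt_top hΩ ha.continuous.aestronglyMeasurable hB 2, fderiv ℝ a,
    isWeakGrad_of_lipschitzWith Ω ha, memLp_fderiv_of_lipschitzWith hΩ ha 2⟩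

lemma MemH1.congr_ae {V : Type*} [NormedAddCommGroup V] [NormedSpace ℝ V] {Ω : Set Plane}
    {a b : Plane → V} (h : MemH1 Ω a) (hab : a =ᵐ[volume.restrict Ω] b) : MemH1 Ω b := by
  obtain ⟨ha, A, hA, hA2⟩ := h
  exact ⟨ha.ae_eq hab, A, hA.congr_ae hab .rfl, hA2⟩

namespace IsSmoothApprox

variable {V : Type*} [NormedAddCommGroup V] [InnerProductSpace ℝ V] [CompleteSpace V]
  {Ω : Set Plane} {u : Plane → V} {G : Plane → Plane →L[ℝ] V} {v : ℕ → Plane → V}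
  {a : Plane → ℝ} {L : ℝ≥0} {B : ℝ}

lemma isWeakGrad_smul_of_lipschitzWith (h : IsSmoothApprox Ω u G v) (hΩ : IsOpen Ω)
    (hΩv : volume Ω < ⊤) (hu : MemLp u 2 (volume.restrict Ω)) (hG : MemLp G 2 (volume.restrict Ω))
    (ha : LipschitzWith L a) (hB : ∀ x, ‖a x‖ ≤ B) :
    IsWeakGrad Ω (fun x => a x • u x) (fun x => a x • G x + (fderiv ℝ a x).smulRight (u x)) :=
  h.isWeakGrad_smul hΩ hu hG (isWeakGrad_of_lipschitzWith Ω ha)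
    (memH1_of_lipschitzWith hΩv ha hB).1 (memLp_fderiv_of_lipschitzWith hΩv ha 2)

lemma memH1_smul_of_lipschitzWith (h : IsSmoothApprox Ω u G v) (hΩ : IsOpen Ω)
    (hΩv : volume Ω < ⊤) (hu : MemLp u 2 (volume.restrict Ω)) (hG : MemLp G 2 (volume.restrict Ω))
    (ha : LipschitzWith L a) (hB : ∀ x, ‖a x‖ ≤ B) : MemH1 Ω fun x => a x • u x :=
  ⟨hu.of_le_mul (ha.continuous.aestronglyMeasurable.smul hu.1) (.of_forall fun x => by
      rw [norm_smul]; exact mul_le_mul_of_nonneg_right (hB x) (norm_nonneg _)), _,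
    h.isWeakGrad_smul_of_lipschitzWith hΩ hΩv hu hG ha hB,
    memLp_smul_add_smulRight ha.continuous.aestronglyMeasurable hB hG
      (measurable_fderiv ℝ a).aestronglyMeasurable (fun _ => norm_fderiv_le_of_lipschitz ℝ ha) hu⟩

end IsSmoothApprox

lemma IsRegularClosedCurve.ae_norm_gradient {γ : ℝ → Plane} (h : IsRegularClosedCurve γ) :
    ∀ᵐ x : Plane, DifferentiableAt ℝ (signedDistTo (range γ)) x ∧
      ‖gradient (signedDistTo (range γ)) x‖ = 1 := by
  filter_upwards [measure_eq_zero_iff_ae_notMem.1 h.volume_range,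
    (lipschitzWith_signedDistTo (range γ)).ae_differentiableAt] with x hx hd
  exact ⟨hd, norm_gradient_signedDistTo h.isCompact_range
    ((h.isCompact_range.isClosed.notMem_iff_infDist_pos (range_nonempty γ)).1 hx) hd⟩

namespace IsLayerProfile

section Profile

variable {f g φ θ p : ℝ → ℝ} {δ c K ε : ℝ}

lemma norm_le_one (h : IsLayerProfile f g φ θ δ c K ε p) (r : ℝ) : ‖p r‖ ≤ 1 := by
  rw [Real.norm_of_nonneg (h.mem_Icc r).1]
  exact (h.mem_Icc r).2

lemma const_nonneg (h : IsLayerProfile f g φ θ δ c K ε p) (hε : 0 < ε) : 0 ≤ K := by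
  have hK : 0 ≤ K / ε * layerDecay c ε 0 := (abs_nonneg _).trans (h.deriv_le 0)
  simpa [hε.ne'] using mul_nonneg (nonneg_of_mul_nonneg_left hK (layerDecay_pos c ε 0)) hε.le

lemma abs_deriv_le (h : IsLayerProfile f g φ θ δ c K ε p) (hc : 0 ≤ c) (hε : 0 < ε) (r : ℝ) :
    |deriv p r| ≤ K / ε :=
  (h.deriv_le r).trans
    (mul_le_of_le_one_right (div_nonneg (h.const_nonneg hε) hε.le) (layerDecay_le_one hc ε r))

lemma deriv_sq_le (h : IsLayerProfile f g φ θ δ c K ε p) (hc : 0 ≤ c) (hε : 0 < ε) (r : ℝ) :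
    ε * deriv p r ^ 2 ≤ K ^ 2 * (layerDecay c ε r / ε) :=
  calc ε * deriv p r ^ 2 ≤ ε * (K / ε * layerDecay c ε r) ^ 2 := by
        rw [← sq_abs]
        gcongr
        exact h.deriv_le r
    _ = K ^ 2 * (layerDecay c ε r ^ 2 / ε) := by field_simp
    _ ≤ K ^ 2 * (layerDecay c ε r / ε) := by
        gcongr
        exact layerDecay_sq_le hc ε r

lemma lipschitzWith (h : IsLayerProfile f g φ θ δ c K ε p) (hc : 0 ≤ c) (hε : 0 < ε) :
    LipschitzWith (Real.toNNReal (K / ε)) p :=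
  lipschitzWith_of_nnnorm_deriv_le (h.contDiff.differentiable one_ne_zero) fun r =>
    (NNReal.coe_le_coe.1 <| by simpa using (h.abs_deriv_le hc hε r).trans (le_max_left _ 0))

lemma potential_eq_zero (h : IsLayerProfile f g φ θ δ c K ε p) (hfg : IsPotential f g) {r : ℝ}
    (hr : δ ≤ |r|) : f (p r) = 0 := by
  rw [hfg.f_eq _ (h.mem_Icc r).1, h.outer r hr, step]
  split_ifs
  · simp [hfg.g_one]
  · simp [hfg.g_zero]

lemma continuous_potential (h : IsLayerProfile f g φ θ δ c K ε p) (hfg : IsPotential f g) :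
    Continuous fun r => f (p r) :=
  hfg.f_smooth.continuousOn.comp_continuous h.contDiff.continuous fun r => (h.mem_Icc r).1

lemma hasDerivAt_integral (h : IsLayerProfile f g φ θ δ c K ε p) (hfg : IsPotential f g) (r : ℝ) :
    HasDerivAt (fun r => ∫ s in (0 : ℝ)..p r, g s) (g (p r) * deriv p r) r := by
  have hg : Continuous fun s => g |s| :=
    hfg.g_continuousOn.comp_continuous continuous_abs fun s => abs_nonneg s
  have hext : (fun r => ∫ s in (0 : ℝ)..p r, g s) = fun r => ∫ s in (0 : ℝ)..p r, g |s| :=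
    funext fun r => intervalIntegral.integral_congr fun s hs => by
      rw [uIcc_of_le (h.mem_Icc r).1] at hs
      simp only [abs_of_nonneg hs.1]
  have hprim : HasDerivAt (fun y => ∫ s in (0 : ℝ)..y, g |s|) (g (p r)) (p r) := by
    simpa [abs_of_nonneg (h.mem_Icc r).1] using intervalIntegral.integral_hasDerivAt_right
      (hg.intervalIntegrable 0 (p r)) (hg.stronglyMeasurableAtFilter _ _) hg.continuousAt
  rw [hext]
  exact hprim.comp r (h.contDiff.differentiable one_ne_zero r).hasDerivAt

lemma exists_lipschitzWith_integral (h : IsLayerProfile f g φ θ δ c K ε p) (hfg : IsPotential f g)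
    (hc : 0 ≤ c) (hε : 0 < ε) :
    ∃ (L : ℝ≥0) (B : ℝ), LipschitzWith L (fun r => ∫ s in (0 : ℝ)..p r, g s) ∧
      ∀ r, ‖∫ s in (0 : ℝ)..p r, g s‖ ≤ B := by
  obtain ⟨C, hC, hgC⟩ := hfg.exists_g_le_mul
  have hg : ∀ s ∈ Icc (0 : ℝ) 1, g s ≤ C := fun s hs =>
    (hgC s hs).trans (mul_le_of_le_one_right hC.le (by nlinarith [hs.1, hs.2]))
  refine ⟨Real.toNNReal (C * (K / ε)), C, lipschitzWith_of_nnnorm_deriv_le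
    (fun r => (h.hasDerivAt_integral hfg r).differentiableAt) fun r => ?_, fun r => ?_⟩
  · rw [(h.hasDerivAt_integral hfg r).deriv, ← norm_toNNReal]
    refine Real.toNNReal_le_toNNReal ?_
    rw [norm_mul, Real.norm_of_nonneg (hfg.g_nonneg _ (h.mem_Icc r).1)]
    exact mul_le_mul (hg _ (h.mem_Icc r)) (h.abs_deriv_le hc hε r) (abs_nonneg _) hC.le
  · have hbound := hfg.abs_integral_g_sub_step_le hg (h.mem_Icc r) 0
    simp only [step, lt_irrefl, if_false, sub_zero] at hbound
    exact hbound.trans (mul_le_of_le_one_right hC.le (h.norm_le_one r))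

end Profile

section Competitor

variable {f g φ θ p : ℝ → ℝ} {δ c K ε : ℝ} {γ : ℝ → Plane} {Ω : Set Plane} {u : Plane → Plane}
  {v : ℕ → Plane → Plane}

lemma norm_competitor (h : IsLayerProfile f g φ θ δ c K ε p) (I : Set Plane) {x : Plane}
    (hx : ‖u x‖ = 1) : ‖competitor I p u x‖ = p (signedDistTo I x) := by
  rw [competitor, norm_smul, hx, mul_one, Real.norm_of_nonneg (h.mem_Icc _).1]

lemma competitor_eq_self (h : IsLayerProfile f g φ θ δ c K ε p) {I : Set Plane} {x : Plane}
    (hx : x ∈ plusRegion Ω I \ tube Ω I δ) : competitor I p u x = u x := by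
  have hδ : δ ≤ |signedDistTo I x| := not_lt.1 fun hlt => hx.2 ⟨hx.1.1, hlt⟩
  rw [competitor, h.outer _ hδ, step, if_pos hx.1.2, one_smul]

lemma competitor_eq_zero (h : IsLayerProfile f g φ θ δ c K ε p) {I : Set Plane} {x : Plane}
    (hx : x ∈ minusRegion Ω I \ tube Ω I δ) : competitor I p u x = 0 := by
  have hδ : δ ≤ |signedDistTo I x| := not_lt.1 fun hlt => hx.2 ⟨hx.1.1, hlt⟩
  rw [competitor, h.outer _ hδ, step, if_neg hx.1.2.not_gt, zero_smul]

lemma competitor_eq_smul (h : IsLayerProfile f g φ θ δ c K ε p) {I : Set Plane} {x : Plane}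
    (hx : x ∈ tube Ω I (δ / 2)) : competitor I p u x = θ (signedDistTo I x / ε) • u x := by
  rw [competitor, h.inner _ hx.2.le]

lemma ae_norm_competitor_le_one (h : IsLayerProfile f g φ θ δ c K ε p) (I : Set Plane)
    (hu : MemH1Circle Ω u) : ∀ᵐ x ∂volume.restrict Ω, ‖competitor I p u x‖ ≤ 1 := by
  filter_upwards [hu.2] with x hx
  exact (h.norm_competitor I hx).trans_le (h.mem_Icc _).2

lemma psi_competitor (h : IsLayerProfile f g φ θ δ c K ε p) (I : Set Plane) {x : Plane}
    (hx : ‖u x‖ = 1) :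
    psi g (competitor I p u) x = ∫ s in (0 : ℝ)..p (signedDistTo I x), g s := by
  rw [psi, h.norm_competitor I hx]

lemma lipschitzWith_comp_signedDistTo (h : IsLayerProfile f g φ θ δ c K ε p) (hc : 0 ≤ c)
    (hε : 0 < ε) (I : Set Plane) :
    LipschitzWith (Real.toNNReal (K / ε)) fun x => p (signedDistTo I x) := by
  simpa [Function.comp_def] using (h.lipschitzWith hc hε).comp (lipschitzWith_signedDistTo I)

lemma memH1_competitor (h : IsLayerProfile f g φ θ δ c K ε p) (hc : 0 ≤ c) (hε : 0 < ε)
    (I : Set Plane) (hΩ : IsOpen Ω) (hu : MemH1Circle Ω u)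
    (hv : IsSmoothApprox Ω u (weakGrad Ω u) v) : MemH1 Ω (competitor I p u) :=
  hv.memH1_smul_of_lipschitzWith hΩ hu.volume_lt_top hu.1.1 (hu.1.memLp_weakGrad hΩ)
    (h.lipschitzWith_comp_signedDistTo hc hε I) fun _ => h.norm_le_one _

lemma weakGrad_competitor_ae_eq (h : IsLayerProfile f g φ θ δ c K ε p) (hc : 0 ≤ c) (hε : 0 < ε)
    (I : Set Plane) (hΩ : IsOpen Ω) (hu : MemH1Circle Ω u)
    (hv : IsSmoothApprox Ω u (weakGrad Ω u) v) :
    weakGrad Ω (competitor I p u) =ᵐ[volume.restrict Ω] fun x =>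
      p (signedDistTo I x) • weakGrad Ω u x
        + (fderiv ℝ (fun y => p (signedDistTo I y)) x).smulRight (u x) :=
  (hv.isWeakGrad_smul_of_lipschitzWith hΩ hu.volume_lt_top hu.1.1 (hu.1.memLp_weakGrad hΩ)
    (h.lipschitzWith_comp_signedDistTo hc hε I) fun _ => h.norm_le_one _).weakGrad_ae_eq hΩ

lemma ae_frobSq_weakGrad_competitor (h : IsLayerProfile f g φ θ δ c K ε p) (hc : 0 ≤ c)
    (hε : 0 < ε) (hγ : IsRegularClosedCurve γ) (hΩ : IsOpen Ω) (hu : MemH1Circle Ω u)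
    (hv : IsSmoothApprox Ω u (weakGrad Ω u) v) :
    ∀ᵐ x ∂volume.restrict Ω, frobSq (weakGrad Ω (competitor (range γ) p u) x)
      = p (signedDistTo (range γ) x) ^ 2 * frobSq (weakGrad Ω u x)
        + deriv p (signedDistTo (range γ) x) ^ 2 := by
  filter_upwards [hu.2, h.weakGrad_competitor_ae_eq hc hε (range γ) hΩ hu hv,
    ae_restrict_of_ae hγ.ae_norm_gradient,
    hv.ae_inner_eq_zero hΩ hu.1.1 (hu.1.memLp_weakGrad hΩ) hu.2] with x hux hgrad hd horth
  rw [hgrad]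
  exact frobSq_smul_add_smulRight
    (fderiv_comp_real (h.contDiff.differentiable one_ne_zero _) hd.1) hd.2 hux horth

lemma ae_divOf_weakGrad_competitor (h : IsLayerProfile f g φ θ δ c K ε p) (hc : 0 ≤ c)
    (hε : 0 < ε) (I : Set Plane) (hΩ : IsOpen Ω) (hu : MemH1Circle Ω u)
    (hv : IsSmoothApprox Ω u (weakGrad Ω u) v) :
    ∀ᵐ x ∂volume.restrict Ω, divOf (weakGrad Ω (competitor I p u) x)
      = p (signedDistTo I x) * divOf (weakGrad Ω u x)
        + deriv p (signedDistTo I x) * ⟪u x, gradient (signedDistTo I) x⟫ := by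
  filter_upwards [h.weakGrad_competitor_ae_eq hc hε I hΩ hu hv,
    ae_restrict_of_ae (lipschitzWith_signedDistTo I).ae_differentiableAt] with x hgrad hd
  rw [hgrad]
  exact divOf_smul_add_smulRight (fderiv_comp_real (h.contDiff.differentiable one_ne_zero _) hd)

lemma psi_competitor_ae_eq (h : IsLayerProfile f g φ θ δ c K ε p) (I : Set Plane)
    (hu : MemH1Circle Ω u) :
    (fun x => ∫ s in (0 : ℝ)..p (signedDistTo I x), g s) =ᵐ[volume.restrict Ω]
      psi g (competitor I p u) := by
  filter_upwards [hu.2] with x hx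
  exact (h.psi_competitor I hx).symm

lemma memH1_psi_competitor (h : IsLayerProfile f g φ θ δ c K ε p) (hfg : IsPotential f g)
    (hc : 0 ≤ c) (hε : 0 < ε) (I : Set Plane) (hu : MemH1Circle Ω u) :
    MemH1 Ω (psi g (competitor I p u)) := by
  obtain ⟨L, B, hL, hB⟩ := h.exists_lipschitzWith_integral hfg hc hε
  exact (memH1_of_lipschitzWith hu.volume_lt_top (hL.comp (lipschitzWith_signedDistTo I))
    fun x => hB _).congr_ae (h.psi_competitor_ae_eq I hu)

lemma ae_weakGrad_psi_competitor_xi (h : IsLayerProfile f g φ θ δ c K ε p) (hfg : IsPotential f g)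
    (hc : 0 ≤ c) (hε : 0 < ε) (hγ : IsRegularClosedCurve γ) (hΩ : IsOpen Ω)
    (hu : MemH1Circle Ω u) :
    ∀ᵐ x ∂volume.restrict Ω,
      weakGrad Ω (psi g (competitor (range γ) p u)) x (xi (range γ) φ δ x)
        = φ (signedDistTo (range γ) x / δ)
          * (g (p (signedDistTo (range γ) x)) * deriv p (signedDistTo (range γ) x)) := by
  obtain ⟨L, -, hL, -⟩ := h.exists_lipschitzWith_integral hfg hc hε
  have hlip : LipschitzWith (L * 1)
      fun x => ∫ s in (0 : ℝ)..p (signedDistTo (range γ) x), g s :=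
    hL.comp (lipschitzWith_signedDistTo (range γ))
  have hweak := (isWeakGrad_of_lipschitzWith Ω hlip).congr_ae
    (h.psi_competitor_ae_eq (range γ) hu) .rfl
  filter_upwards [hweak.weakGrad_ae_eq hΩ, ae_restrict_of_ae hγ.ae_norm_gradient] with x hgrad hd
  have hderiv := h.hasDerivAt_integral hfg (signedDistTo (range γ) x)
  have hfderiv := fderiv_comp_real hderiv.differentiableAt hd.1
  rw [hgrad, hfderiv, hderiv.deriv, xi, map_smul, smul_apply, innerSL_apply_apply,
    real_inner_self_eq_norm_sq, hd.2, one_pow, smul_eq_mul, smul_eq_mul, mul_one]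

end Competitor

end IsLayerProfile

/-! ### Energy bounds for the competitor -/

lemma setIntegral_le_of_ofReal_le_mul {α : Type*} [MeasurableSpace α] {μ : Measure α} {Ω T : Set α}
    {r : α → ℝ} {ρ : α → ℝ≥0∞} {A D : ℝ} (hr : AEStronglyMeasurable r (μ.restrict Ω))
    (hr0 : ∀ x, 0 ≤ r x) (hrT : ∀ x ∉ T, r x = 0) (hA : 0 ≤ A) (hD : 0 ≤ D)
    (hrρ : ∀ x, ENNReal.ofReal (r x) ≤ ENNReal.ofReal A * ρ x)
    (hρ : ∫⁻ x in T, ρ x ∂μ ≤ ENNReal.ofReal D) :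
    IntegrableOn r Ω μ ∧ ∫ x in Ω, r x ∂μ ≤ A * D :=
  setIntegral_le_of_setLIntegral_le hr hr0 hrT (mul_nonneg hA hD) <|
    calc ∫⁻ x in T, ENNReal.ofReal (r x) ∂μ ≤ ∫⁻ x in T, ENNReal.ofReal A * ρ x ∂μ :=
          lintegral_mono hrρ
      _ = ENNReal.ofReal A * ∫⁻ x in T, ρ x ∂μ := lintegral_const_mul' _ _ ENNReal.ofReal_ne_top
      _ ≤ ENNReal.ofReal (A * D) := by
          rw [ENNReal.ofReal_mul hA]
          gcongr

lemma layerWeight_infDist (c ε : ℝ) (I : Set Plane) (x : Plane) :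
    layerWeight c ε (Metric.infDist x I)
      = ENNReal.ofReal (layerDecay c ε (signedDistTo I x) / ε) := by
  rw [← abs_signedDistTo, layerWeight_abs, layerWeight]

namespace IsLayerProfile

section LayerIntegrals

variable {f g φ θ p : ℝ → ℝ} {δ c K ε C D : ℝ} {Ω I : Set Plane} {u : Plane → Plane}

lemma deriv_eq_zero_of_notMem (h : IsLayerProfile f g φ θ δ c K ε p) {x : Plane}
    (hx : x ∉ {x | Metric.infDist x I ≤ δ}) : deriv p (signedDistTo I x) = 0 :=
  h.deriv_outer (by rw [abs_signedDistTo]; exact (not_le.1 hx).le)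

lemma potential_eq_zero_of_notMem (h : IsLayerProfile f g φ θ δ c K ε p) (hfg : IsPotential f g)
    {x : Plane} (hx : x ∉ {x | Metric.infDist x I ≤ δ}) : f (p (signedDistTo I x)) = 0 :=
  h.potential_eq_zero hfg (by rw [abs_signedDistTo]; exact (not_le.1 hx).le)

lemma setIntegral_deriv_sq_le (h : IsLayerProfile f g φ θ δ c K ε p) (hc : 0 ≤ c) (hε : 0 < ε)
    (hC : 0 ≤ C) (hT : ∫⁻ x in {x | Metric.infDist x I ≤ δ},
      layerWeight c ε (Metric.infDist x I) ≤ ENNReal.ofReal C) :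
    IntegrableOn (fun x => ε * deriv p (signedDistTo I x) ^ 2) Ω ∧
      ∫ x in Ω, ε * deriv p (signedDistTo I x) ^ 2 ≤ K ^ 2 * C := by
  refine setIntegral_le_of_ofReal_le_mul ?_ (fun x => by positivity)
    (fun x hx => by simp [h.deriv_eq_zero_of_notMem hx]) (sq_nonneg K) hC (fun x => ?_) hT
  · have hderiv := h.contDiff.continuous_deriv le_rfl
    have hdist := (lipschitzWith_signedDistTo I).continuous
    exact (by fun_prop : Continuous _).aestronglyMeasurable
  · rw [layerWeight_infDist, ← ENNReal.ofReal_mul (sq_nonneg K)]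
    exact ENNReal.ofReal_le_ofReal (h.deriv_sq_le hc hε _)

lemma setIntegral_potential_le (h : IsLayerProfile f g φ θ δ c K ε p) (hfg : IsPotential f g)
    (hε : 0 < ε) (hC : 0 ≤ C) (hT : ∫⁻ x in {x | Metric.infDist x I ≤ δ},
      layerWeight c ε (Metric.infDist x I) ≤ ENNReal.ofReal C) :
    IntegrableOn (fun x => 1 / ε * f (p (signedDistTo I x))) Ω ∧
      ∫ x in Ω, 1 / ε * f (p (signedDistTo I x)) ≤ K * C := by
  have hf : ∀ r, 0 ≤ f (p r) := fun r => by
    rw [hfg.f_eq _ (h.mem_Icc r).1]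
    positivity
  refine setIntegral_le_of_ofReal_le_mul ?_ (fun x => mul_nonneg (by positivity) (hf _))
    (fun x hx => by simp [h.potential_eq_zero_of_notMem hfg hx]) (h.const_nonneg hε) hC
    (fun x => ?_) hT
  · exact (continuous_const.mul ((h.continuous_potential hfg).comp
      (lipschitzWith_signedDistTo I).continuous)).aestronglyMeasurable
  · rw [layerWeight_infDist, ← ENNReal.ofReal_mul (h.const_nonneg hε), one_div_mul_eq_div,
      mul_div_assoc']
    exact ENNReal.ofReal_le_ofReal (div_le_div_of_nonneg_right (h.potential_le _) hε.le)

lemma setIntegral_deriv_mul_inner_sq_le (h : IsLayerProfile f g φ θ δ c K ε p) (hc : 0 ≤ c)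
    (hε : 0 < ε) (hu : AEStronglyMeasurable u (volume.restrict Ω)) (hD : 0 ≤ D)
    (hT : ∫⁻ x in {x | Metric.infDist x I ≤ δ}, layerWeight c ε (Metric.infDist x I)
      * ‖⟪u x, gradient (signedDistTo I) x⟫‖ₑ ^ 2 ≤ ENNReal.ofReal D) :
    IntegrableOn (fun x =>
        ε * (deriv p (signedDistTo I x) * ⟪u x, gradient (signedDistTo I) x⟫) ^ 2) Ω ∧
      ∫ x in Ω, ε * (deriv p (signedDistTo I x) * ⟪u x, gradient (signedDistTo I) x⟫) ^ 2
        ≤ K ^ 2 * D := by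
  refine setIntegral_le_of_ofReal_le_mul ?_ (fun x => by positivity)
    (fun x hx => by simp [h.deriv_eq_zero_of_notMem hx]) (sq_nonneg K) hD (fun x => ?_) hT
  · have hderiv := (h.contDiff.continuous_deriv le_rfl).comp
      (lipschitzWith_signedDistTo I).continuous
    have hgrad : Measurable (gradient (signedDistTo I)) :=
      (InnerProductSpace.toDual ℝ Plane).symm.continuous.measurable.comp
        (measurable_fderiv ℝ (signedDistTo I))
    exact ((hderiv.aestronglyMeasurable.mul
      (hu.inner hgrad.aestronglyMeasurable)).pow 2).const_mul ε
  · rw [layerWeight_infDist, ← ofReal_norm, ← ENNReal.ofReal_pow (norm_nonneg _), Real.norm_eq_abs,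
      sq_abs, ← ENNReal.ofReal_mul' (sq_nonneg _), ← ENNReal.ofReal_mul (sq_nonneg K), mul_pow,
      ← mul_assoc, ← mul_assoc]
    exact ENNReal.ofReal_le_ofReal
      (mul_le_mul_of_nonneg_right (h.deriv_sq_le hc hε _) (sq_nonneg _))

end LayerIntegrals

section Energy

variable {f g φ θ p : ℝ → ℝ} {δ c K ε μ B C D : ℝ} {γ : ℝ → Plane} {Ω I : Set Plane}
  {u : Plane → Plane} {v : ℕ → Plane → Plane}

lemma setIntegral_divOf_sq_competitor_le (h : IsLayerProfile f g φ θ δ c K ε p) (hc : 0 ≤ c)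
    (hε : 0 < ε) (hΩ : IsOpen Ω) (hu : MemH1Circle Ω u)
    (hv : IsSmoothApprox Ω u (weakGrad Ω u) v) (hμ : 0 ≤ μ)
    (hB : ∫ x in Ω, frobSq (weakGrad Ω u x) ≤ B) (hD : 0 ≤ D)
    (hT : ∫⁻ x in {x | Metric.infDist x I ≤ δ}, layerWeight c ε (Metric.infDist x I)
      * ‖⟪u x, gradient (signedDistTo I) x⟫‖ₑ ^ 2 ≤ ENNReal.ofReal D) :
    ∫ x in Ω, ε / 2 * μ * divOf (weakGrad Ω (competitor I p u) x) ^ 2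
      ≤ 2 * μ * ε * B + μ * (K ^ 2 * D) := by
  obtain ⟨hRi, hR⟩ := h.setIntegral_deriv_mul_inner_sq_le hc hε hu.1.1.1 hD hT
  have hF : IntegrableOn (fun x => frobSq (weakGrad Ω u x)) Ω :=
    integrable_frobSq (hu.1.memLp_weakGrad hΩ)
  refine (integral_le_integral_of_ae_le ?_ ((hF.const_mul (2 * μ * ε)).add (hRi.const_mul μ))
    (integral_nonneg fun x => ?_)).trans ?_
  · filter_upwards [h.ae_divOf_weakGrad_competitor hc hε I hΩ hu hv] with x hx
    set P := p (signedDistTo I x)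
    set P' := deriv p (signedDistTo I x)
    have hPdiv : (P * divOf (weakGrad Ω u x)) ^ 2 ≤ 2 * frobSq (weakGrad Ω u x) := by
      rw [mul_pow]
      exact (mul_le_of_le_one_left (sq_nonneg _)
        (pow_le_one₀ (h.mem_Icc _).1 (h.mem_Icc _).2)).trans (divOf_sq_le _)
    calc ε / 2 * μ * divOf (weakGrad Ω (competitor I p u) x) ^ 2
        ≤ ε / 2 * μ * (2 * ((P * divOf (weakGrad Ω u x)) ^ 2
          + (P' * ⟪u x, gradient (signedDistTo I) x⟫) ^ 2)) := by
          rw [hx]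
          gcongr
          exact add_sq_le
      _ ≤ ε / 2 * μ * (2 * (2 * frobSq (weakGrad Ω u x)
          + (P' * ⟪u x, gradient (signedDistTo I) x⟫) ^ 2)) := by gcongr
      _ = 2 * μ * ε * frobSq (weakGrad Ω u x)
          + μ * (ε * (P' * ⟪u x, gradient (signedDistTo I) x⟫) ^ 2) := by ring
  · have := frobSq_nonneg (weakGrad Ω u x)
    simp only [Pi.add_apply]
    positivity
  · simp only [Pi.add_apply]
    rw [integral_add (hF.const_mul _) (hRi.const_mul _), integral_const_mul, integral_const_mul]
    gcongr

lemma ae_frobSq_weakGrad_competitor_le (h : IsLayerProfile f g φ θ δ c K ε p) (hc : 0 ≤ c)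
    (hε : 0 < ε) (hγ : IsRegularClosedCurve γ) (hΩ : IsOpen Ω) (hu : MemH1Circle Ω u)
    (hv : IsSmoothApprox Ω u (weakGrad Ω u) v) :
    ∀ᵐ x ∂volume.restrict Ω, frobSq (weakGrad Ω (competitor (range γ) p u) x)
      ≤ frobSq (weakGrad Ω u x) + deriv p (signedDistTo (range γ) x) ^ 2 := by
  filter_upwards [h.ae_frobSq_weakGrad_competitor hc hε hγ hΩ hu hv] with x hx
  rw [hx]
  gcongr
  exact mul_le_of_le_one_left (frobSq_nonneg _) (pow_le_one₀ (h.mem_Icc _).1 (h.mem_Icc _).2)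

lemma setIntegral_frobSq_competitor_le (h : IsLayerProfile f g φ θ δ c K ε p) (hc : 0 ≤ c)
    (hε : 0 < ε) (hγ : IsRegularClosedCurve γ) (hΩ : IsOpen Ω) (hu : MemH1Circle Ω u)
    (hv : IsSmoothApprox Ω u (weakGrad Ω u) v)
    (hB : ∫ x in Ω, frobSq (weakGrad Ω u x) ≤ B) (hC : 0 ≤ C)
    (hT : ∫⁻ x in {x | Metric.infDist x (range γ) ≤ δ},
      layerWeight c ε (Metric.infDist x (range γ)) ≤ ENNReal.ofReal C) :
    ∫ x in Ω, ε / 2 * frobSq (weakGrad Ω (competitor (range γ) p u) x)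
      ≤ ε / 2 * B + 1 / 2 * (K ^ 2 * C) := by
  obtain ⟨hPi, hP⟩ := h.setIntegral_deriv_sq_le (Ω := Ω) hc hε hC hT
  have hF : IntegrableOn (fun x => frobSq (weakGrad Ω u x)) Ω :=
    integrable_frobSq (hu.1.memLp_weakGrad hΩ)
  refine (integral_le_integral_of_ae_le ?_ ((hF.const_mul (ε / 2)).add (hPi.const_mul (1 / 2)))
    (integral_nonneg fun x => ?_)).trans ?_
  · filter_upwards [h.ae_frobSq_weakGrad_competitor_le hc hε hγ hΩ hu hv] with x hx
    exact (mul_le_mul_of_nonneg_left hx (half_pos hε).le).trans_eq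
      (by simp only [Pi.add_apply]; ring)
  · have := frobSq_nonneg (weakGrad Ω u x)
    simp only [Pi.add_apply]
    positivity
  · simp only [Pi.add_apply]
    rw [integral_add (hF.const_mul _) (hPi.const_mul _), integral_const_mul, integral_const_mul]
    gcongr

lemma energy_competitor_le (h : IsLayerProfile f g φ θ δ c K ε p) (hfg : IsPotential f g)
    (hc : 0 ≤ c) (hε : 0 < ε) (hγ : IsRegularClosedCurve γ) (hΩ : IsOpen Ω)
    (hu : MemH1Circle Ω u) (hv : IsSmoothApprox Ω u (weakGrad Ω u) v) (hμ : 0 ≤ μ)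
    (hB : ∫ x in Ω, frobSq (weakGrad Ω u x) ≤ B) (hC : 0 ≤ C) (hD : 0 ≤ D)
    (hTC : ∫⁻ x in {x | Metric.infDist x (range γ) ≤ δ},
      layerWeight c ε (Metric.infDist x (range γ)) ≤ ENNReal.ofReal C)
    (hTD : ∫⁻ x in {x | Metric.infDist x (range γ) ≤ δ},
      layerWeight c ε (Metric.infDist x (range γ))
        * ‖⟪u x, gradient (signedDistTo (range γ)) x⟫‖ₑ ^ 2 ≤ ENNReal.ofReal D) :
    energy Ω μ f ε (competitor (range γ) p u)
      ≤ (2 * μ + 1 / 2) * ε * B + μ * (K ^ 2 * D) + (K ^ 2 / 2 + K) * C := by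
  obtain ⟨hfi, hf⟩ := h.setIntegral_potential_le (Ω := Ω) hfg hε hC hTC
  have hpot : (fun x => 1 / ε * f (p (signedDistTo (range γ) x)))
      =ᵐ[volume.restrict Ω] fun x => 1 / ε * f ‖competitor (range γ) p u x‖ := by
    filter_upwards [hu.2] with x hx
    rw [h.norm_competitor _ hx]
  have hgrad := (h.memH1_competitor hc hε (range γ) hΩ hu hv).memLp_weakGrad hΩ
  have hdiv := (integrable_divOf_sq hgrad).const_mul (ε / 2 * μ)
  have hfrob := (integrable_frobSq hgrad).const_mul (ε / 2)
  have hdivle := h.setIntegral_divOf_sq_competitor_le hc hε hΩ hu hv hμ hB hD hTD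
  have hfroble := h.setIntegral_frobSq_competitor_le hc hε hγ hΩ hu hv hB hC hTC
  have hsum : IntegrableOn (fun x => ε / 2 * μ * divOf (weakGrad Ω (competitor (range γ) p u) x) ^ 2
      + ε / 2 * frobSq (weakGrad Ω (competitor (range γ) p u) x)) Ω := hdiv.add hfrob
  rw [energy, integral_add hsum (hfi.congr hpot), integral_add hdiv hfrob,
    ← integral_congr_ae hpot]
  linarith

lemma setIntegral_calibration_defect_le (h : IsLayerProfile f g φ θ δ c K ε p)
    (hfg : IsPotential f g) (hc : 0 ≤ c) (hε : 0 < ε) (hγ : IsRegularClosedCurve γ)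
    (hΩ : IsOpen Ω) (hu : MemH1Circle Ω u) (hv : IsSmoothApprox Ω u (weakGrad Ω u) v)
    (hB : ∫ x in Ω, frobSq (weakGrad Ω u x) ≤ B) (hT : {x | Metric.infDist x (range γ) ≤ δ} ⊆ Ω) :
    ∫ x in Ω, (ε / 2 * frobSq (weakGrad Ω (competitor (range γ) p u) x)
        + 1 / ε * f ‖competitor (range γ) p u x‖
        - weakGrad Ω (psi g (competitor (range γ) p u)) x (xi (range γ) φ δ x))
      ≤ ε / 2 * B + K * ε * volume.real {x | Metric.infDist x (range γ) ≤ δ} := by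
  set T : Set Plane := {x | Metric.infDist x (range γ) ≤ δ}
  have hTm : MeasurableSet T :=
    (isClosed_le (Metric.continuous_infDist_pt _) continuous_const).measurableSet
  have hKε : 0 ≤ K * ε := mul_nonneg (h.const_nonneg hε) hε.le
  have hF : IntegrableOn (fun x => frobSq (weakGrad Ω u x)) Ω :=
    integrable_frobSq (hu.1.memLp_weakGrad hΩ)
  have hTi : IntegrableOn (T.indicator fun _ => K * ε) Ω :=
    ((integrable_indicator_iff hTm).2
      (integrableOn_const (hγ.volume_tube_lt_top δ).ne)).integrableOn
  refine (integral_le_integral_of_ae_le ?_ ((hF.const_mul (ε / 2)).add hTi)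
    (integral_nonneg fun x => ?_)).trans ?_
  · filter_upwards [hu.2, h.ae_frobSq_weakGrad_competitor_le hc hε hγ hΩ hu hv,
      h.ae_weakGrad_psi_competitor_xi hfg hc hε hγ hΩ hu] with x hux hfrob hψ
    have hdefect : ε / 2 * deriv p (signedDistTo (range γ) x) ^ 2
        + 1 / ε * f (p (signedDistTo (range γ) x)) - φ (signedDistTo (range γ) x / δ)
          * (g (p (signedDistTo (range γ) x)) * deriv p (signedDistTo (range γ) x))
        ≤ T.indicator (fun _ => K * ε) x := by
      by_cases hx : x ∈ T
      · rw [indicator_of_mem hx]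
        exact h.defect_le _
      · simp [indicator_of_notMem hx, h.deriv_eq_zero_of_notMem hx,
          h.potential_eq_zero_of_notMem hfg hx]
    rw [h.norm_competitor _ hux, hψ, Pi.add_apply]
    linarith [mul_le_mul_of_nonneg_left hfrob (half_pos hε).le]
  · exact add_nonneg (mul_nonneg (half_pos hε).le (frobSq_nonneg _))
      (indicator_nonneg (fun _ _ => hKε) x)
  · simp only [Pi.add_apply]
    rw [integral_add (hF.const_mul _) hTi, integral_const_mul, setIntegral_indicator hTm,
      inter_eq_right.2 hT, setIntegral_const, smul_eq_mul, mul_comm (volume.real T)]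
    gcongr

lemma bulkError_competitor_le (h : IsLayerProfile f g φ θ δ c K ε p) (hε : 0 < ε)
    (hγ : IsRegularClosedCurve γ) (hΩ : IsOpen Ω) (hu : MemH1Circle Ω u) :
    bulkError Ω (range γ) g δ (competitor (range γ) p u)
      ≤ K * ε * volume.real {x | Metric.infDist x (range γ) ≤ δ} := by
  have hKε : 0 ≤ K * ε := mul_nonneg (h.const_nonneg hε) hε.le
  have htube : tube Ω (range γ) δ ⊆ {x | Metric.infDist x (range γ) ≤ δ} := fun x hx =>
    (abs_signedDistTo _ x).symm.trans_le hx.2.le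
  have hfin := (hγ.volume_tube_lt_top δ).ne
  have hmeas : MeasurableSet (tube Ω (range γ) δ) := (hΩ.inter (isOpen_lt
    (lipschitzWith_signedDistTo _).continuous.abs continuous_const)).measurableSet
  refine (integral_le_integral_of_ae_le (g := fun _ => K * ε) ?_
    (integrableOn_const (measure_ne_top_of_subset htube hfin))
    (integral_nonneg fun _ => hKε)).trans ?_
  · filter_upwards [ae_restrict_of_ae_restrict_of_subset (fun x hx => hx.1) hu.2,
      ae_restrict_mem hmeas] with x hux hx
    have hstep : (plusRegion Ω (range γ)).indicator (fun _ => (1 : ℝ)) x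
        = step (signedDistTo (range γ) x) := by
      classical
      rw [indicator_apply, step]
      exact if_congr (and_iff_right hx.1) rfl rfl
    rw [h.psi_competitor _ hux, hstep]
    exact h.bulk_le _
  · rw [setIntegral_const, smul_eq_mul, mul_comm]
    exact mul_le_mul_of_nonneg_left (measureReal_mono htube hfin) hKε

lemma modulatedEnergy_add_bulkError_competitor_le (h : IsLayerProfile f g φ θ δ c K ε p)
    (hfg : IsPotential f g) (hc : 0 ≤ c) (hε : 0 < ε) (hγ : IsRegularClosedCurve γ)
    (hΩ : IsOpen Ω) (hu : MemH1Circle Ω u) (hv : IsSmoothApprox Ω u (weakGrad Ω u) v) (hμ : 0 ≤ μ)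
    (hB : ∫ x in Ω, frobSq (weakGrad Ω u x) ≤ B) (hT : {x | Metric.infDist x (range γ) ≤ δ} ⊆ Ω)
    (hD : 0 ≤ D) (hTD : ∫⁻ x in {x | Metric.infDist x (range γ) ≤ δ},
      layerWeight c ε (Metric.infDist x (range γ))
        * ‖⟪u x, gradient (signedDistTo (range γ)) x⟫‖ₑ ^ 2 ≤ ENNReal.ofReal D) :
    modulatedEnergy Ω (range γ) μ f g φ δ ε (competitor (range γ) p u)
        + bulkError Ω (range γ) g δ (competitor (range γ) p u)
      ≤ (2 * μ + 1 / 2) * ε * B + μ * (K ^ 2 * D)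
        + 2 * (K * ε * volume.real {x | Metric.infDist x (range γ) ≤ δ}) := by
  rw [modulatedEnergy]
  linarith [h.setIntegral_divOf_sq_competitor_le hc hε hΩ hu hv hμ hB hD hTD,
    h.setIntegral_calibration_defect_le hfg hc hε hγ hΩ hu hv hB hT,
    h.bulkError_competitor_le hε hγ hΩ hu]

end Energy

end IsLayerProfile

lemma IsRegularClosedCurve.exists_setLIntegral_inner_gradient_le_of_h1Norm_le {γ n : ℝ → Plane}
    (h : IsRegularClosedCurve γ) {c δ : ℝ} (hc : 0 < c) (hδ : 0 < δ) (hn : ∀ t, n t ≠ 0)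
    (hnγ : ∀ t, ⟪n t, deriv γ t⟫ = 0) :
    ∃ C : ℝ, 0 ≤ C ∧ ∀ (Ω : Set Plane) (u : Plane → Plane) (w : ℝ → Plane) (M : ℝ),
      IsOpen Ω → {x | Metric.infDist x (range γ) ≤ δ} ⊆ Ω → MemH1Circle Ω u → h1Norm Ω u ≤ M →
      IsTraceOn Ω γ u w → (∀ᵐ t ∂volume.restrict (Ioc (0 : ℝ) 1), ⟪w t, n t⟫ = 0) →
      ∀ ε, 0 < ε → ∫⁻ x in {x | Metric.infDist x (range γ) ≤ δ},
        layerWeight c ε (Metric.infDist x (range γ))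
          * ‖⟪u x, gradient (signedDistTo (range γ)) x⟫‖ₑ ^ 2
        ≤ ENNReal.ofReal (C * ε * (1 + M ^ 2)) := by
  obtain ⟨C, hC, htrace⟩ := h.exists_setLIntegral_inner_gradient_le hc hδ
  refine ⟨C, hC, fun Ω u w M hΩ hT hu hM hw hwn ε hε => ?_⟩
  have hnormal : ∀ᵐ t ∂volume.restrict (Ioc (0 : ℝ) 1), ⟪w t, unitNormal γ t⟫ = 0 :=
    hwn.mono fun t => h.inner_unitNormal_eq_zero (hn t) (hnγ t)
  refine (htrace Ω u w hΩ hT hu hw hnormal ε hε).trans ?_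
  rw [ENNReal.ofReal_mul (mul_nonneg hC hε.le), ENNReal.ofReal_add zero_le_one (sq_nonneg M),
    ENNReal.ofReal_one]
  gcongr
  exact lintegral_enorm_sq_le_of_integral_frobSq_le (hu.1.memLp_weakGrad hΩ)
    (setIntegral_frobSq_weakGrad_le hM)

lemma IsRegularClosedCurve.exists_energy_competitor_le {f g φ θ : ℝ → ℝ} (hfg : IsPotential f g)
    {μ c δ K : ℝ} (hμ : 0 ≤ μ) (hc : 0 < c) (hδ : 0 < δ) (hK : 0 ≤ K) {γ n : ℝ → Plane}
    (h : IsRegularClosedCurve γ) (hn : ∀ t, n t ≠ 0) (hnγ : ∀ t, ⟪n t, deriv γ t⟫ = 0) (M : ℝ) :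
    ∃ c₁ : ℝ, 0 < c₁ ∧ ∀ (Ω : Set Plane) (u : Plane → Plane) (w : ℝ → Plane),
      IsOpen Ω → {x | Metric.infDist x (range γ) ≤ δ} ⊆ Ω → MemH1Circle Ω u → h1Norm Ω u ≤ M →
      IsTraceOn Ω γ u w → (∀ᵐ t ∂volume.restrict (Ioc (0 : ℝ) 1), ⟪w t, n t⟫ = 0) →
      ∀ ε p, 0 < ε → ε ≤ 1 → IsLayerProfile f g φ θ δ c K ε p →
        energy Ω μ f ε (competitor (range γ) p u) ≤ c₁ ∧
        modulatedEnergy Ω (range γ) μ f g φ δ ε (competitor (range γ) p u)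
          + bulkError Ω (range γ) g δ (competitor (range γ) p u) ≤ c₁ * ε := by
  obtain ⟨C, hC, hlayer⟩ := h.exists_setLIntegral_layerWeight_le hc δ
  obtain ⟨D, hD, htrace⟩ := h.exists_setLIntegral_inner_gradient_le_of_h1Norm_le hc hδ hn hnγ
  set V := volume.real {x | Metric.infDist x (range γ) ≤ δ}
  set A := (2 * μ + 1 / 2) * M ^ 2 + μ * (K ^ 2 * (D * (1 + M ^ 2)))
  have hA : 0 ≤ A := by positivity
  have hlayer0 : 0 ≤ (K ^ 2 / 2 + K) * C := by positivity
  have hdefect0 : 0 ≤ 2 * (K * V) := by positivity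
  refine ⟨A + (K ^ 2 / 2 + K) * C + 2 * (K * V) + 1, by positivity,
    fun Ω u w hΩ hT hu hM hw hwn ε p hε hε1 hp => ?_⟩
  obtain ⟨v, hv, -⟩ := exists_isSmoothApprox hΩ hu.1 hw
  have hB := setIntegral_frobSq_weakGrad_le hM
  have hTD := htrace Ω u w M hΩ hT hu hM hw hwn ε hε
  have hD0 : 0 ≤ D * ε * (1 + M ^ 2) := by positivity
  constructor
  · calc _ ≤ _ := hp.energy_competitor_le hfg hc.le hε h hΩ hu hv hμ hB hC hD0
            (hlayer ε hε hε1) hTD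
      _ = A * ε + (K ^ 2 / 2 + K) * C := by ring
      _ ≤ _ := by linarith [mul_le_of_le_one_right hA hε1]
  · calc _ ≤ _ := hp.modulatedEnergy_add_bulkError_competitor_le hfg hc.le hε h hΩ hu hv hμ hB hT
            hD0 hTD
      _ = (A + 2 * (K * V)) * ε := by ring
      _ ≤ _ := mul_le_mul_of_nonneg_right (by linarith) hε.le

end AnisoGL

end

theorem mainTheorem5_general
    (f g φ : ℝ → ℝ) (hfg : IsPotential f g) (hφ : IsCutoffProfile φ) (μ : ℝ) (hμ : 0 ≤ μ)
    (γ n : ℝ → Plane) (hγ : IsRegularClosedCurve γ) (hn : ∀ t, n t ≠ 0)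
    (hnγ : ∀ t, ⟪n t, deriv γ t⟫ = 0) (δ₀ : ℝ) (hδ₀ : 0 < δ₀) :
    ∃ θ : ℝ → ℝ, IsHeteroclinic f θ ∧
      ∀ M : ℝ, ∃ c₁ : ℝ, 0 < c₁ ∧
        ∀ Ω : Set Plane, IsOpen Ω → range γ ⊆ Ω →
          (∀ x ∈ range γ, ∀ y ∈ frontier Ω, δ₀ < dist x y) →
          ∀ u : Plane → Plane, MemH1Circle Ω u → h1Norm Ω u ≤ M →
            (∃ w : ℝ → Plane, IsTraceOn Ω γ u w ∧
              ∀ᵐ t ∂(volume.restrict (Ioc (0 : ℝ) 1)), ⟪w t, n t⟫ = 0) →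
            ∃ uε : ℝ → Plane → Plane, ∀ ε : ℝ, 0 < ε → ε ≤ 1 →
              MemH1 Ω (uε ε) ∧ MemLp (uε ε) ∞ (volume.restrict Ω) ∧ MemH1 Ω (psi g (uε ε)) ∧
              (∀ x ∈ plusRegion Ω (range γ) \ tube Ω (range γ) δ₀, uε ε x = u x) ∧
              (∀ x ∈ minusRegion Ω (range γ) \ tube Ω (range γ) δ₀, uε ε x = 0) ∧
              (∀ x ∈ tube Ω (range γ) (δ₀ / 2),
                uε ε x = θ (signedDistTo (range γ) x / ε) • u x) ∧
              energy Ω μ f ε (uε ε) ≤ c₁ ∧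
              eLpNorm (uε ε) ∞ (volume.restrict Ω) ≤ 1 ∧
              modulatedEnergy Ω (range γ) μ f g φ δ₀ ε (uε ε)
                + bulkError Ω (range γ) g δ₀ (uε ε) ≤ c₁ * ε := by
  obtain ⟨θ, c, hθ⟩ := hfg.exists_isExpTransition
  have hc := hθ.rate_pos
  obtain ⟨K, hK, hprofile⟩ :=
    hfg.exists_isLayerProfile hφ hθ ((hθ.contDiff_two hfg).of_le one_le_two) hδ₀
  choose! p hp using hprofile
  refine ⟨θ, hθ.isHeteroclinic hfg, fun M => ?_⟩
  obtain ⟨c₁, hc₁, hbounds⟩ := hγ.exists_energy_competitor_le hfg hμ hc hδ₀ hK.le hn hnγ M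
  refine ⟨c₁, hc₁, ?_⟩
  rintro Ω hΩ hγΩ hdist u hu hM ⟨w, hw, hwn⟩
  have hT := infDist_le_subset_of_forall_lt_dist hγ.isCompact_range (range_nonempty γ) hγΩ hdist
  obtain ⟨v, hv, -⟩ := exists_isSmoothApprox hΩ hu.1 hw
  refine ⟨fun ε => competitor (range γ) (p ε) u, fun ε hε hε1 => ?_⟩
  have hpε := hp ε hε hε1
  have hmem := hpε.memH1_competitor hc.le hε (range γ) hΩ hu hv
  have hle := hpε.ae_norm_competitor_le_one (range γ) hu
  obtain ⟨henergy, hmodulated⟩ := hbounds Ω u w hΩ hT hu hM hw hwn ε (p ε) hε hε1 hpε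
  exact ⟨hmem, memLp_top_of_bound hmem.1.1 1 hle,
    hpε.memH1_psi_competitor hfg hc.le hε (range γ) hu, fun _ => hpε.competitor_eq_self,
    fun _ => hpε.competitor_eq_zero, fun _ => hpε.competitor_eq_smul, henergy,
    by simpa using eLpNormEssSup_le_of_ae_bound hle, hmodulated⟩

theorem mainTheorem5
    -- the potential, the anisotropy and the cut-off profile
    (f g φ : ℝ → ℝ) (hfg : IsPotential f g) (hφ : IsCutoffProfile φ) (μ : ℝ) (hμ : 0 < μ)
    -- the curve with its inner normal, and the width of its neighbourhood
    (γ n : ℝ → Plane) (hγ : IsSmoothSimpleClosedCurve γ) (hn : IsInnerNormal γ n)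
    (δ₀ : ℝ) (hδ₀ : δ₀ ∈ Ioo (0 : ℝ) 1) (hproj : HasSmoothProjection (range γ) (4 * δ₀)) :
    ∃ θ : ℝ → ℝ, IsHeteroclinic f θ ∧
      ∀ M : ℝ, ∃ c₁ : ℝ, 0 < c₁ ∧
        ∀ Ω : Set Plane, IsOpen Ω → IsConnected Ω → Bornology.IsBounded Ω → range γ ⊆ Ω →
          (∀ x ∈ range γ, ∀ y ∈ frontier Ω, 4 * δ₀ ≤ dist x y) →
          ∀ u : Plane → Plane, MemH1Circle Ω u → h1Norm Ω u ≤ M →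
            (∃ w : ℝ → Plane, IsTraceOn Ω γ u w ∧
              ∀ᵐ t ∂(volume.restrict (Ioc (0 : ℝ) 1)), ⟪w t, n t⟫ = 0) →
            ∃ uε : ℝ → Plane → Plane, ∀ ε : ℝ, 0 < ε → ε ≤ 1 →
              -- regularity, including the weak differentiability of `ψ_ε`
              MemH1 Ω (uε ε) ∧ MemLp (uε ε) ∞ (volume.restrict Ω) ∧ MemH1 Ω (psi g (uε ε)) ∧
              -- the values away from the curve
              (∀ x ∈ plusRegion Ω (range γ) \ tube Ω (range γ) δ₀, uε ε x = u x) ∧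
              (∀ x ∈ minusRegion Ω (range γ) \ tube Ω (range γ) δ₀, uε ε x = 0) ∧
              -- the heteroclinic profile near the curve
              (∀ x ∈ tube Ω (range γ) (δ₀ / 2),
                uε ε x = θ (signedDistTo (range γ) x / ε) • u x) ∧
              -- well-preparedness
              energy Ω μ f ε (uε ε) ≤ c₁ ∧
              eLpNorm (uε ε) ∞ (volume.restrict Ω) ≤ 1 ∧
              modulatedEnergy Ω (range γ) μ f g φ δ₀ ε (uε ε)
                + bulkError Ω (range γ) g δ₀ (uε ε) ≤ c₁ * ε := by
  obtain ⟨θ, hθ, h⟩ := mainTheorem5_general f g φ hfg hφ μ hμ.le γ n hγ.isRegularClosedCurve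
    (fun t => norm_ne_zero_iff.1 (by simp [hn.unit])) hn.orthogonal δ₀ hδ₀.1
  exact ⟨θ, hθ, fun M => (h M).imp fun c₁ hc₁ => ⟨hc₁.1, fun Ω hΩ _ _ hγΩ hdist =>
    hc₁.2 Ω hΩ hγΩ fun x hx y hy => by linarith [hdist x hx y hy, hδ₀.1]⟩⟩
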